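/- Let $d\ge 2$. There is a constant $C>0$ depending only on $d$ such that the following holds. Let $\Omega\subset\mathbb{R}^d$ be a bounded open set, let $u:\Omega\to\mathbb{R}^d$ be measurable, let $(e_i)_{i=1}^d$ be an orthonormal basis of $\mathbb{R}^d$, and let $V=\{e_i: 1\le i\le d\}\cup\{e_i+e_j: 1\le i<j\le d\}$. For $\xi\in V$ and $z\in\xi^\perp$ put $\Omega^\xi_z=\{s\in\mathbb{R}: z+s\xi\in\Omega\}$ and $u^\xi_z(s)=\xi\cdot u(z+s\xi)$ for $s\in\Omega^\xi_z$. Assume that for every $\xi\in V$ one has $u^\xi_z\in BV(\Omega^\xi_z)$ for $\mathcal{H}^{d-1}$-a.e. $z\in\xi^\perp$, and $$\Lambda_u^\xi:=\int_{\xi^\perp}\Big((|D^a u^\xi_z|+|D^c u^\xi_z|)(\Omega^\xi_z)+\sum_{s\in J_{u^\xi_z}}|[u^\xi_z](s)|\wedge 1\Big)\,d\mathcal{H}^{d-1}(z)<+\infty ,$$ where $D^a$, $D^c$ denote the absolutely continuous and the Cantor part of the derivative, $J$ the (approximate) jump set and $[\cdot]$ the jump. For $\varepsilon>0$ let $\Omega_\varepsilon=\{x\in\Omega: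 \mathrm{dist}(x,\partial\Omega)>\sqrt d\,\varepsilon\}$. Then there are a family $(u^\varepsilon)_{\varepsilon>0}$ in $SBV^\infty(\Omega;\mathbb{R}^d)$ (bounded $SBV$ functions with bounded approximate gradient $\nabla u^\varepsilon$ and $\mathcal{H}^{d-1}(J_{u^\varepsilon})<\infty$), sets $\mathcal{B}^\varepsilon\subset\Omega$ and shifts $y^\varepsilon\in[0,1)^d$ such that, for every $\varepsilon>0$, with the grid of cubes $Q_k=\{x: \varepsilon(y^\varepsilon_i+k_i)\le e_i\cdot x<\varepsilon(y^\varepsilon_i+k_i+1)\ \text{for all } i\}$, $k\in\mathbb{Z}^d$: 1. $\mathcal{B}^\varepsilon$ is the union of the finitely many bad cubes, namely the $Q_k$ with $\overline{Q_k}\subset\Omega$ that have, for some $\xi\in V$, two vertices $p$ and $p+\varepsilon\xi$ with $|\xi\cdot(u(p+\varepsilon\xi)-u(p))|>1$; 2. $u^\varepsilon=0$ on $\mathcal{B}^\varepsilon$, and on each other cube $Q_k$ with $\overline{Q_k}\subset\Omega$ the function $u^\varepsilon$ is the multilinear interpolation of the values of $u$ at the vertices of $Q_k$; 3. $J_{u^\varepsilon}\subset\partial\mathcal{B}^\varepsilon$;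 4. with $e(u^\varepsilon)=\frac12(\nabla u^\varepsilon+(\nabla u^\varepsilon)^T)$ and $\partial^*\mathcal{B}^\varepsilon$ the essential boundary of $\mathcal{B}^\varepsilon$, $$\int_{\Omega_\varepsilon}|e(u^\varepsilon)|\,dx+\mathcal{H}^{d-1}(\partial^*\mathcal{B}^\varepsilon\cap\Omega_\varepsilon)\le C\sum_{\xi\in V}\Lambda_u^\xi .$$ Moreover $u^\varepsilon\to u$ in measure on $\Omega$ as $\varepsilon\to 0$. -/

import Mathlib

open MeasureTheory Filter Topology Set
open scoped ENNReal

noncomputable section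

namespace FinDirGBD

/-! ### Approximate limits, jump points, essential boundary -/

section Pointwise

variable {E F : Type*} [NormedAddCommGroup E] [InnerProductSpace ℝ E] [MeasureSpace E]
  [NormedAddCommGroup F]

/-- `u` has approximate limit `a` at `x`: the mean of `|u - a|` over `B_r(x)` tends to `0`. -/
def HasApproxLimit (u : E → F) (x : E) (a : F) : Prop :=
  Tendsto (fun r : ℝ => ⨍⁻ y in Metric.ball x r, ‖u y - a‖ₑ ∂volume) (𝓝[>] 0) (𝓝 0)

/-- The approximate discontinuity set `S_u` in `Ω`. -/
def discontinuitySet (Ω : Set E) (u : E → F) : Set E :=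
  {x ∈ Ω | ¬ ∃ a, HasApproxLimit u x a}

/-- The half ball `{y ∈ B_r(x) : ν · (y - x) > 0}`. -/
def halfBall (x ν : E) (r : ℝ) : Set E :=
  {y ∈ Metric.ball x r | 0 < inner ℝ ν (y - x)}

/-- `x` is an approximate jump point of `u` with one-sided approximate limits `a ≠ b` on the two
sides of the hyperplane through `x` orthogonal to the unit vector `ν`. -/
structure IsApproxJump (u : E → F) (x : E) (a b : F) (ν : E) : Prop where
  ne : a ≠ b
  norm_eq_one : ‖ν‖ = 1
  tendsto_pos : Tendsto (fun r : ℝ => ⨍⁻ y in halfBall x ν r, ‖u y - a‖ₑ ∂volume) (𝓝[>] 0) (𝓝 0)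
  tendsto_neg : Tendsto (fun r : ℝ => ⨍⁻ y in halfBall x (-ν) r, ‖u y - b‖ₑ ∂volume) (𝓝[>] 0) (𝓝 0)

/-- The jump set `J_u` in `Ω`. -/
def jumpSet (Ω : Set E) (u : E → F) : Set E :=
  {x ∈ Ω | ∃ a b ν, IsApproxJump u x a b ν}

/-- The size `|[u](x)| = |a - b|` of the jump at a jump point (`0` elsewhere). The triple
`(a, b, ν)` is unique up to exchanging the two sides, so that the supremum runs over one value. -/
def jumpSize (u : E → F) (x : E) : ℝ≥0∞ :=
  ⨆ (a : F) (b : F) (ν : E) (_ : IsApproxJump u x a b ν), ‖a - b‖ₑ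

/-- The essential boundary `∂*A`: the points where `A` has neither density `0` nor density `1`. -/
def essentialBoundary (A : Set E) : Set E :=
  {x | ¬ Tendsto (fun r : ℝ => volume (A ∩ Metric.ball x r) / volume (Metric.ball x r))
          (𝓝[>] 0) (𝓝 0) ∧
       ¬ Tendsto (fun r : ℝ => volume (A ∩ Metric.ball x r) / volume (Metric.ball x r))
          (𝓝[>] 0) (𝓝 1)}

end Pointwise

/-! ### Functions of bounded variation -/

section BV

variable {E : Type*} [NormedAddCommGroup E] [NormedSpace ℝ E] [MeasureSpace E]

/-- The finite signed measure `μ`, concentrated on `Ω`, is the distributional derivative of the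
scalar function `f` in direction `v` on `Ω`. -/
structure IsDistribDeriv (Ω : Set E) (f : E → ℝ) (v : E) (μ : SignedMeasure E) : Prop where
  concentrated : μ.totalVariation Ωᶜ = 0
  integral_eq : ∀ φ : E → ℝ, ContDiff ℝ (⊤ : ℕ∞) φ → HasCompactSupport φ → tsupport φ ⊆ Ω →
    ∫ x in Ω, f x * fderiv ℝ φ x v =
      -(∫ x, φ x ∂μ.toJordanDecomposition.posPart - ∫ x, φ x ∂μ.toJordanDecomposition.negPart)

/-- `f ∈ BV(Ω)` for a scalar function `f`. -/
def IsBV (Ω : Set E) (f : E → ℝ) : Prop :=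
  IntegrableOn f Ω ∧ ∀ v, ∃ μ, IsDistribDeriv Ω f v μ

open Classical in
/-- The measure `D_v f` on the open set `Ω` (it is unique if it exists; `0` if it does not). -/
def distribDeriv (Ω : Set E) (f : E → ℝ) (v : E) : SignedMeasure E :=
  if h : ∃ μ, IsDistribDeriv Ω f v μ then h.choose else 0

/-- The density of the absolutely continuous part of `D_v f`. -/
def acDensity (Ω : Set E) (f : E → ℝ) (v : E) : E → ℝ :=
  (distribDeriv Ω f v).rnDeriv volume

/-- The absolutely continuous part `D^a_v f`. -/
def acPart (Ω : Set E) (f : E → ℝ) (v : E) : SignedMeasure E :=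
  (volume : Measure E).withDensityᵥ (acDensity Ω f v)

/-- The singular part `D^s_v f`. -/
def singPart (Ω : Set E) (f : E → ℝ) (v : E) : SignedMeasure E :=
  (distribDeriv Ω f v).singularPart volume

end BV

/-! ### One-dimensional slices -/

/-- `(|D^a f| + |D^c f|)(I) + ∑_{s ∈ J_f} |[f](s)| ∧ 1` for `f ∈ BV(I)`, `I ⊆ ℝ` open, where
`D^c f` is the restriction of `D^s f` to `I ∖ S_f`. -/
def truncVariation (I : Set ℝ) (f : ℝ → ℝ) : ℝ≥0∞ :=
  (acPart I f 1).totalVariation I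
    + (singPart I f 1).totalVariation (I \ discontinuitySet I f)
    + ∑' s : jumpSet I f, min (jumpSize f s) 1

variable {d : ℕ}

/-- `Ω^ξ_z = {s : z + s ξ ∈ Ω}`. -/
def sliceDomain (Ω : Set (EuclideanSpace ℝ (Fin d))) (ξ z : EuclideanSpace ℝ (Fin d)) : Set ℝ :=
  {s | z + s • ξ ∈ Ω}

/-- `u^ξ_z(s) = ξ · u(z + s ξ)`. -/
def slice (u : EuclideanSpace ℝ (Fin d) → EuclideanSpace ℝ (Fin d))
    (ξ z : EuclideanSpace ℝ (Fin d)) (s : ℝ) : ℝ :=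
  inner ℝ ξ (u (z + s • ξ))

/-- `Λ^ξ_u`, the integral over `z ∈ ξ^⊥` with respect to `H^{d-1}`. -/
def sliceEnergy (Ω : Set (EuclideanSpace ℝ (Fin d)))
    (u : EuclideanSpace ℝ (Fin d) → EuclideanSpace ℝ (Fin d))
    (ξ : EuclideanSpace ℝ (Fin d)) : ℝ≥0∞ :=
  ∫⁻ z : (Submodule.span ℝ {ξ})ᗮ, truncVariation (sliceDomain Ω ξ z) (slice u ξ z)
    ∂(μHE[d - 1] : Measure (Submodule.span ℝ {ξ})ᗮ)

open Classical in
/-- `V = {e_i} ∪ {e_i + e_j : i < j}`. -/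
def directions (e : OrthonormalBasis (Fin d) ℝ (EuclideanSpace ℝ (Fin d))) :
    Finset (EuclideanSpace ℝ (Fin d)) :=
  Finset.univ.image (fun i => e i) ∪
    (Finset.univ.filter (fun p : Fin d × Fin d => p.1 < p.2)).image (fun p => e p.1 + e p.2)

/-! ### `SBV^∞` and the symmetrized gradient -/

/-- The entry `∂_j u_i` of the approximate gradient `∇u`, the density of `D^a u`. -/
def gradEntry (Ω : Set (EuclideanSpace ℝ (Fin d)))
    (u : EuclideanSpace ℝ (Fin d) → EuclideanSpace ℝ (Fin d)) (i j : Fin d)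
    (x : EuclideanSpace ℝ (Fin d)) : ℝ :=
  acDensity Ω (fun y => u y i) (EuclideanSpace.single j 1) x

/-- The Frobenius norm of `e(u)(x) = (∇u(x) + ∇u(x)ᵀ) / 2`. -/
def symGradNorm (Ω : Set (EuclideanSpace ℝ (Fin d)))
    (u : EuclideanSpace ℝ (Fin d) → EuclideanSpace ℝ (Fin d))
    (x : EuclideanSpace ℝ (Fin d)) : ℝ :=
  √(∑ i, ∑ j, ((gradEntry Ω u i j x + gradEntry Ω u j i x) / 2) ^ 2)

/-- `u ∈ SBV^∞(Ω; ℝ^d)`: `u ∈ BV`, the Cantor part `D^c u = D^s u ⌞ (Ω ∖ S_u)` vanishes, `u` and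
`∇u` are bounded, and `H^{d-1}(J_u) < ∞`. -/
structure IsSBVInfty (Ω : Set (EuclideanSpace ℝ (Fin d)))
    (u : EuclideanSpace ℝ (Fin d) → EuclideanSpace ℝ (Fin d)) : Prop where
  isBV : ∀ i, IsBV Ω (fun x => u x i)
  cantor_eq_zero : ∀ i j, (singPart Ω (fun x => u x i) (EuclideanSpace.single j 1)).totalVariation
    (Ω \ discontinuitySet Ω u) = 0
  bounded : MemLp u ⊤ (volume.restrict Ω)
  grad_bounded : ∀ i j, MemLp (gradEntry Ω u i j) ⊤ (volume.restrict Ω)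
  jump_finite : μHE[d - 1] (jumpSet Ω u) < ⊤

/-! ### The shifted grid `ε (y + ℤ^d)` in the coordinates of an orthonormal basis -/

/-- The vertices of the grid cube with index `k`, labelled by the sets `s` of coordinates in which
the upper endpoint is taken. -/
def gridVertex (e : OrthonormalBasis (Fin d) ℝ (EuclideanSpace ℝ (Fin d))) (ε : ℝ)
    (y : Fin d → ℝ) (k : Fin d → ℤ) (s : Finset (Fin d)) : EuclideanSpace ℝ (Fin d) :=
  ∑ i, (ε * (y i + k i + if i ∈ s then 1 else 0)) • e i

/-- The half-open grid cube `ε y + ε k + ε [0,1)^d`. -/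
def gridCube (e : OrthonormalBasis (Fin d) ℝ (EuclideanSpace ℝ (Fin d))) (ε : ℝ)
    (y : Fin d → ℝ) (k : Fin d → ℤ) : Set (EuclideanSpace ℝ (Fin d)) :=
  {x | ∀ i, inner ℝ (e i) x ∈ Ico (ε * (y i + k i)) (ε * (y i + k i + 1))}

/-- The multilinear interpolation of the values of `u` at the vertices of the cube `k`. -/
def multilinearInterp (e : OrthonormalBasis (Fin d) ℝ (EuclideanSpace ℝ (Fin d))) (ε : ℝ)
    (y : Fin d → ℝ) (k : Fin d → ℤ)
    (u : EuclideanSpace ℝ (Fin d) → EuclideanSpace ℝ (Fin d))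
    (x : EuclideanSpace ℝ (Fin d)) : EuclideanSpace ℝ (Fin d) :=
  ∑ s : Finset (Fin d),
    (∏ i, if i ∈ s then inner ℝ (e i) x / ε - y i - k i
      else 1 - (inner ℝ (e i) x / ε - y i - k i)) • u (gridVertex e ε y k s)

/-- The grid cubes whose closure lies in `Ω` and which have, for some `ξ ∈ V`, two vertices
`p`, `q = p + ε ξ` with `|ξ · (u(q) - u(p))| > 1`. -/
def badCubes (Ω : Set (EuclideanSpace ℝ (Fin d)))
    (e : OrthonormalBasis (Fin d) ℝ (EuclideanSpace ℝ (Fin d)))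
    (u : EuclideanSpace ℝ (Fin d) → EuclideanSpace ℝ (Fin d)) (ε : ℝ) (y : Fin d → ℝ) :
    Set (Fin d → ℤ) :=
  {k | closure (gridCube e ε y k) ⊆ Ω ∧
    ∃ ξ ∈ directions e, ∃ s t, gridVertex e ε y k t = gridVertex e ε y k s + ε • ξ ∧
      1 < |inner ℝ ξ (u (gridVertex e ε y k t) - u (gridVertex e ε y k s))|}

/-- `Ω_ε = {x ∈ Ω : dist(x, ∂Ω) > √d ε}`. -/
def innerDomain (Ω : Set (EuclideanSpace ℝ (Fin d))) (ε : ℝ) : Set (EuclideanSpace ℝ (Fin d)) :=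
  {x ∈ Ω | √d * ε < Metric.infDist x (frontier Ω)}

end FinDirGBD

end

/-! The shift of the lattice `ε (y + ℤ^d)` is chosen by averaging. For `ξ ∈ V`, the truncated
increment `|ξ · (u(x + ε ξ) - u(x))| ∧ 1`, over the points `x` whose segment to `x + ε ξ` stays in
`Ω`, has integral at most `|ξ| ε Λ^ξ_u`. By Fubini this reduces to a BV function `f` of one
variable. There `f(s + h) - f(s) = Df([s, s + h))` for a.e. `s`, and since `t ↦ t ∧ 1` is
subadditive, the truncation of the right-hand side is at most `κ([s, s + h))`, where `κ` consists of
`|D^a f|`, `|D^c f|` and an atom of mass `|[f]| ∧ 1` at each jump. Integration in `s` yields `h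
κ(ℝ)` (`lintegral_min_increment_le`, `lintegral_truncIncrement_le`). An integral over `ℝ^d` is `ε^d`
times the average over the shifts of the sum over the lattice (`lintegral_eq_average`), so some
lattice has truncated increments of total size at most `C ε^(1-d) ∑ Λ^ξ_u`.

This lattice energy controls everything (`exists_gridApprox`). A bad cube contains an increment
truncated to `1`, so the number of bad cubes is bounded by the energy, and each has perimeter `2 d
ε^(d-1)`. In a good cube the truncation is inactive. There the symmetrized gradient of the
multilinear interpolation is at most `C / ε` times the increments in the cube: the mixed entry for
`e_a`, `e_b` combines increments of `e_a · u` and `e_b · u` along edges with the increment of `(e_a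
+ e_b) · u` along the diagonal of a two-dimensional face (`abs_inner_interpSlope_le`). This is why
`V` contains the sums `e_i + e_j`.

The interpolations on adjacent cubes agree on common faces and glue to a Lipschitz map, a finite sum
of products of hat functions. Setting it to zero on the bad cubes gives a function whose
distributional derivative is explicit: the divergence theorem on each bad cube produces surface
terms on its faces (`isDistribDeriv_cut`). Uniqueness of the derivative and of its Lebesgue
decomposition then gives the approximate gradient and the absence of a Cantor part.

For convergence in measure, the truncated distance between `u` and its values at the vertices,
averaged over the shifts, is an average of truncated `L¹` distances between `u`, extended by zero,
and its translates by vectors of length at most `d ε`, and these tend to zero. By Markov's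
inequality one shift is good for the energy and for this discrepancy at once (`exists_shift`). The
bad cubes and the layer near `∂Ω` have vanishing volume. -/

noncomputable section

open scoped Pointwise

namespace FinDirGBD

/-! ### Pairing of a signed measure with a bounded function -/

section Pairing

variable {α : Type*} [MeasurableSpace α]

/-- The integral of `φ` against the signed measure `s`. -/
def pairing (s : SignedMeasure α) (φ : α → ℝ) : ℝ :=
  ∫ x, φ x ∂s.toJordanDecomposition.posPart - ∫ x, φ x ∂s.toJordanDecomposition.negPart

lemma integrable_of_measurable_of_le {μ : Measure α} [IsFiniteMeasure μ] {φ : α → ℝ} {C : ℝ}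
    (hm : Measurable φ) (hb : ∀ x, |φ x| ≤ C) : Integrable φ μ :=
  Integrable.of_bound hm.aestronglyMeasurable C (Eventually.of_forall hb)

lemma signedMeasure_eq_sub (s : SignedMeasure α) :
    s = s.toJordanDecomposition.posPart.toSignedMeasure -
      s.toJordanDecomposition.negPart.toSignedMeasure :=
  (SignedMeasure.toSignedMeasure_toJordanDecomposition s).symm

/-- Two representations of `s` as a difference of finite measures give the identity `P + n = p + N`
of positive measures, so the pairing does not depend on the Jordan decomposition. Additivity of the
pairing rests on this. -/
lemma pairing_eq_of_eq_sub {s : SignedMeasure α} {P N : Measure α} [IsFiniteMeasure P]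
    [IsFiniteMeasure N] (h : s = P.toSignedMeasure - N.toSignedMeasure) {φ : α → ℝ} {C : ℝ}
    (hm : Measurable φ) (hb : ∀ x, |φ x| ≤ C) :
    pairing s φ = ∫ x, φ x ∂P - ∫ x, φ x ∂N := by
  have h1 := signedMeasure_eq_sub s
  set p := s.toJordanDecomposition.posPart with hp
  set n := s.toJordanDecomposition.negPart with hn
  have h2 : P + n = p + N := by
    rw [← Measure.toSignedMeasure_eq_toSignedMeasure_iff, Measure.toSignedMeasure_add,
      Measure.toSignedMeasure_add]
    exact sub_eq_sub_iff_add_eq_add.1 (h.symm.trans h1)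
  have h3 : ∫ x, φ x ∂(P + n) = ∫ x, φ x ∂(p + N) := by rw [h2]
  have I : ∀ (μ : Measure α) [IsFiniteMeasure μ], Integrable φ μ :=
    fun μ _ => integrable_of_measurable_of_le hm hb
  rw [integral_add_measure (I _) (I _), integral_add_measure (I _) (I _)] at h3
  unfold pairing
  linarith

lemma pairing_add (s t : SignedMeasure α) {φ : α → ℝ} {C : ℝ}
    (hm : Measurable φ) (hb : ∀ x, |φ x| ≤ C) :
    pairing (s + t) φ = pairing s φ + pairing t φ := by
  have I : ∀ (μ : Measure α) [IsFiniteMeasure μ], Integrable φ μ :=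
    fun μ _ => integrable_of_measurable_of_le hm hb
  have h : s + t =
      (s.toJordanDecomposition.posPart + t.toJordanDecomposition.posPart).toSignedMeasure -
      (s.toJordanDecomposition.negPart + t.toJordanDecomposition.negPart).toSignedMeasure := by
    rw [Measure.toSignedMeasure_add, Measure.toSignedMeasure_add]
    nth_rewrite 1 [signedMeasure_eq_sub s, signedMeasure_eq_sub t]
    abel
  rw [pairing_eq_of_eq_sub h hm hb, integral_add_measure (I _) (I _),
    integral_add_measure (I _) (I _)]
  unfold pairing
  ring

lemma pairing_zero (φ : α → ℝ) : pairing (0 : SignedMeasure α) φ = 0 := by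
  simp [pairing, SignedMeasure.toJordanDecomposition_zero]

lemma pairing_sum {ι : Type*} (A : Finset ι) (s : ι → SignedMeasure α) {φ : α → ℝ} {C : ℝ}
    (hm : Measurable φ) (hb : ∀ x, |φ x| ≤ C) :
    pairing (∑ i ∈ A, s i) φ = ∑ i ∈ A, pairing (s i) φ := by
  classical
  induction A using Finset.induction_on with
  | empty => simp [pairing_zero]
  | insert a A ha ih => rw [Finset.sum_insert ha, Finset.sum_insert ha, pairing_add _ _ hm hb, ih]

lemma pairing_withDensity {m : Measure α} {h : α → ℝ} (hh : Integrable h m)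
    {φ : α → ℝ} {C : ℝ} (hm : Measurable φ) (hb : ∀ x, |φ x| ≤ C) :
    pairing (m.withDensityᵥ h) φ = ∫ x, φ x * h x ∂m := by
  wlog hmeas : Measurable h generalizing h
  · have h1 := WithDensityᵥEq.congr_ae (μ := m) hh.1.ae_eq_mk
    rw [h1, this (hh.congr hh.1.ae_eq_mk) hh.1.measurable_mk]
    refine integral_congr_ae ?_
    filter_upwards [hh.1.ae_eq_mk] with x hx
    rw [hx]
  have f1 : IsFiniteMeasure (m.withDensity fun x => ENNReal.ofReal (h x)) :=
    isFiniteMeasure_withDensity_ofReal hh.2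
  have f2 : IsFiniteMeasure (m.withDensity fun x => ENNReal.ofReal (-h x)) :=
    isFiniteMeasure_withDensity_ofReal hh.neg.2
  rw [pairing_eq_of_eq_sub (withDensityᵥ_eq_withDensity_pos_part_sub_withDensity_neg_part hh) hm hb,
    integral_withDensity_eq_integral_toReal_smul (by fun_prop) (by simp),
    integral_withDensity_eq_integral_toReal_smul (by fun_prop) (by simp), ← integral_sub]
  · refine integral_congr_ae (Eventually.of_forall fun x => ?_)
    simp only [smul_eq_mul, ENNReal.toReal_ofReal']
    rcases le_total 0 (h x) with h0 | h0
    · rw [max_eq_left h0, max_eq_right (by linarith)]; ring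
    · rw [max_eq_right h0, max_eq_left (by linarith)]; ring
  · refine (hh.norm.bdd_mul (c := C) hm.aestronglyMeasurable
      (Eventually.of_forall hb)).mono (by fun_prop) (Eventually.of_forall fun x => ?_)
    simp only [smul_eq_mul, ENNReal.toReal_ofReal', norm_mul, Real.norm_eq_abs, abs_abs]
    rw [mul_comm]
    refine mul_le_mul_of_nonneg_left ?_ (abs_nonneg _)
    rw [abs_of_nonneg (le_max_right _ _)]
    exact max_le (le_abs_self _) (abs_nonneg _)
  · refine (hh.norm.bdd_mul (c := C) hm.aestronglyMeasurable
      (Eventually.of_forall hb)).mono (by fun_prop) (Eventually.of_forall fun x => ?_)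
    simp only [smul_eq_mul, ENNReal.toReal_ofReal', norm_mul, Real.norm_eq_abs, abs_abs]
    rw [mul_comm]
    refine mul_le_mul_of_nonneg_left ?_ (abs_nonneg _)
    rw [abs_of_nonneg (le_max_right _ _)]
    exact max_le (neg_le_abs _) (abs_nonneg _)

/-- On a Hahn set `i`, the two Jordan parts of `A` are, up to sign, the values of `s` on the subsets
`i ∩ A` and `iᶜ ∩ A`. -/
lemma totalVariation_eq_zero {s : SignedMeasure α} {A : Set α} (hA : MeasurableSet A)
    (h : ∀ B ⊆ A, MeasurableSet B → s B = 0) : s.totalVariation A = 0 := by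
  obtain ⟨i, hi, h1, h2, h3, h4⟩ := s.toJordanDecomposition_spec
  rw [SignedMeasure.totalVariation, Measure.add_apply, h3, h4,
    SignedMeasure.toMeasureOfZeroLE_apply _ _ _ hA, SignedMeasure.toMeasureOfLEZero_apply _ _ _ hA]
  have e1 := h (i ∩ A) inter_subset_right (hi.inter hA)
  have e2 := h (iᶜ ∩ A) inter_subset_right (hi.compl.inter hA)
  simp only [e1, e2, neg_zero]
  simp

lemma totalVariation_sum_eq_zero {ι : Type*} (S : Finset ι) (s : ι → SignedMeasure α) {A : Set α}
    (hA : MeasurableSet A) (h : ∀ i ∈ S, (s i).totalVariation A = 0) :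
    (∑ i ∈ S, s i).totalVariation A = 0 := by
  refine totalVariation_eq_zero hA fun B hB _ => ?_
  classical
  have : ∀ i ∈ S, s i B = 0 := fun i hi =>
    SignedMeasure.null_of_totalVariation_zero _ (measure_mono_null hB (h i hi))
  have key : ∀ S' : Finset ι, (∑ i ∈ S', s i) B = ∑ i ∈ S', s i B := by
    intro S'
    induction S' using Finset.induction_on with
    | empty => simp
    | insert a S' ha ih => rw [Finset.sum_insert ha, Finset.sum_insert ha, add_apply, ih]
  rw [key]
  exact Finset.sum_eq_zero this

lemma totalVariation_add_eq_zero {s t : SignedMeasure α} {A : Set α} (hA : MeasurableSet A)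
    (hs : s.totalVariation A = 0) (ht : t.totalVariation A = 0) :
    (s + t).totalVariation A = 0 := by
  refine totalVariation_eq_zero hA fun B hB _ => ?_
  rw [add_apply, SignedMeasure.null_of_totalVariation_zero _ (measure_mono_null hB hs),
    SignedMeasure.null_of_totalVariation_zero _ (measure_mono_null hB ht), add_zero]

lemma totalVariation_withDensity_eq_zero {m : Measure α} {h : α → ℝ} (hh : Integrable h m)
    {A : Set α} (hA : MeasurableSet A) (h0 : ∀ᵐ x ∂m, x ∈ A → h x = 0) :
    SignedMeasure.totalVariation (m.withDensityᵥ h) A = 0 := by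
  refine totalVariation_eq_zero hA fun B hB hBm => ?_
  rw [withDensityᵥ_apply hh hBm]
  refine setIntegral_eq_zero_of_ae_eq_zero ?_
  filter_upwards [h0] with x hx hxB using hx (hB hxB)

end Pairing

/-! ### Uniqueness of the distributional derivative -/

section Unique

variable {E : Type*} [NormedAddCommGroup E] [NormedSpace ℝ E] [FiniteDimensional ℝ E]

lemma exists_contDiff_cutoff {K U : Set E} (hK : IsCompact K) (hU : IsOpen U) (hKU : K ⊆ U) :
    ∃ φ : E → ℝ, ContDiff ℝ (⊤ : ℕ∞) φ ∧ HasCompactSupport φ ∧ tsupport φ ⊆ U ∧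
      (∀ x, φ x ∈ Icc (0 : ℝ) 1) ∧ ∀ x ∈ K, φ x = 1 := by
  obtain ⟨L, hL, hKL, hLU⟩ := exists_compact_between hK hU hKU
  obtain ⟨φ, h1, h2, h3, h4⟩ := exists_contMDiff_support_eq_eq_one_iff (n := (⊤ : ℕ∞))
    (modelWithCornersSelf ℝ E) (isOpen_interior (s := L)) hK.isClosed hKL
  have h5 : tsupport φ ⊆ L := by
    rw [tsupport, h3]
    exact closure_minimal interior_subset hL.isClosed
  exact ⟨φ, h1.contDiff, hL.of_isClosed_subset (isClosed_tsupport _) h5, h5.trans hLU,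
    fun x => h2 (mem_range_self x), fun x hx => (h4 x).1 hx⟩

lemma bounded_of_hasCompactSupport {X : Type*} [TopologicalSpace X] {φ : X → ℝ}
    (h : Continuous φ) (hc : HasCompactSupport φ) :
    ∃ C, ∀ x, |φ x| ≤ C := by
  obtain ⟨C, hC⟩ := h.bounded_above_of_compact_support hc
  exact ⟨C, hC⟩

variable [MeasureSpace E] [BorelSpace E]

/-- A smooth cutoff equal to `1` on `K` and supported in `U ∩ Ω` gives `P K ≤ Q U` for each open `U
⊇ K`; outer regularity of `Q` concludes. -/
lemma measure_compact_le {Ω : Set E} (hΩ : IsOpen Ω) {P Q : Measure E} [IsFiniteMeasure P]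
    [IsFiniteMeasure Q]
    (h : ∀ φ : E → ℝ, ContDiff ℝ (⊤ : ℕ∞) φ → HasCompactSupport φ → tsupport φ ⊆ Ω →
      ∫ x, φ x ∂P = ∫ x, φ x ∂Q) {K : Set E} (hK : IsCompact K) (hKΩ : K ⊆ Ω) : P K ≤ Q K := by
  rw [K.measure_eq_iInf_isOpen Q]
  refine le_iInf₂ fun U hU => le_iInf fun hUo => ?_
  obtain ⟨φ, h1, h2, h3, h4, h5⟩ := exists_contDiff_cutoff hK (hUo.inter hΩ)
    (subset_inter hU hKΩ)
  have I : ∀ (μ : Measure E) [IsFiniteMeasure μ], Integrable φ μ :=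
    fun μ _ => integrable_of_measurable_of_le (C := 1) h1.continuous.measurable
      fun x => abs_le.2 ⟨by linarith [(h4 x).1], (h4 x).2⟩
  have h6 : P.real K ≤ Q.real U := by
    calc P.real K = ∫ x, K.indicator 1 x ∂P := by
          rw [integral_indicator_one hK.measurableSet]
      _ ≤ ∫ x, φ x ∂P := by
          refine integral_mono ((integrable_const (1 : ℝ)).indicator hK.measurableSet) (I _) fun x => ?_
          by_cases hx : x ∈ K
          · simp [hx, h5 x hx]
          · simp [hx, (h4 x).1]
      _ = ∫ x, φ x ∂Q := h φ h1 h2 (h3.trans inter_subset_right)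
      _ ≤ ∫ x, U.indicator 1 x ∂Q := by
          refine integral_mono (I _) ((integrable_const (1 : ℝ)).indicator hUo.measurableSet) fun x => ?_
          by_cases hx : x ∈ U
          · simp [hx, (h4 x).2]
          · have : φ x = 0 := by
              by_contra hne
              exact hx (h3 (subset_tsupport _ hne)).1
            simp [hx, this]
      _ = Q.real U := by rw [integral_indicator_one hUo.measurableSet]
  exact (ENNReal.toReal_le_toReal (by finiteness) (by finiteness)).1 h6

lemma measure_eq_of_integral_eq {Ω : Set E} (hΩ : IsOpen Ω) {P Q : Measure E} [IsFiniteMeasure P]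
    [IsFiniteMeasure Q] (hP : P Ωᶜ = 0) (hQ : Q Ωᶜ = 0)
    (h : ∀ φ : E → ℝ, ContDiff ℝ (⊤ : ℕ∞) φ → HasCompactSupport φ → tsupport φ ⊆ Ω →
      ∫ x, φ x ∂P = ∫ x, φ x ∂Q) : P = Q := by
  have key : ∀ (P Q : Measure E) [IsFiniteMeasure P] [IsFiniteMeasure Q], P Ωᶜ = 0 →
      (∀ φ : E → ℝ, ContDiff ℝ (⊤ : ℕ∞) φ → HasCompactSupport φ → tsupport φ ⊆ Ω →
        ∫ x, φ x ∂P = ∫ x, φ x ∂Q) → P ≤ Q := by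
    intro P Q _ _ hP h
    refine Measure.le_iff.2 fun A hA => ?_
    have e : P A = P (A ∩ Ω) := by
      rw [← measure_inter_add_sdiff A hΩ.measurableSet,
        measure_mono_null (fun x hx => hx.2) hP (s := A \ Ω), add_zero]
    rw [e, (hA.inter hΩ.measurableSet).measure_eq_iSup_isCompact]
    refine iSup₂_le fun K hK => iSup_le fun hKc => ?_
    exact (measure_compact_le hΩ h hKc fun x hx => (hK hx).2).trans
      (measure_mono fun x hx => (hK hx).1)
  exact le_antisymm (key P Q hP h) (key Q P hQ fun φ a b c => (h φ a b c).symm)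

/-- Moving the negative parts across turns equality of the pairings into equality of integrals
against two positive measures concentrated on `Ω`, which test functions determine. -/
lemma IsDistribDeriv.unique {Ω : Set E} (hΩ : IsOpen Ω) {f : E → ℝ} {v : E} {μ ν : SignedMeasure E}
    (hμ : IsDistribDeriv Ω f v μ) (hν : IsDistribDeriv Ω f v ν) : μ = ν := by
  have hμ0 := hμ.concentrated
  have hν0 := hν.concentrated
  simp only [SignedMeasure.totalVariation, Measure.add_apply, add_eq_zero] at hμ0 hν0
  have hPQ : μ.toJordanDecomposition.posPart + ν.toJordanDecomposition.negPart =
      ν.toJordanDecomposition.posPart + μ.toJordanDecomposition.negPart := by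
    refine measure_eq_of_integral_eq hΩ (by simp [hμ0, hν0]) (by simp [hμ0, hν0])
      fun φ h1 h2 h3 => ?_
    obtain ⟨C, hC⟩ := bounded_of_hasCompactSupport h1.continuous h2
    have I : ∀ (μ : Measure E) [IsFiniteMeasure μ], Integrable φ μ :=
      fun μ _ => integrable_of_measurable_of_le h1.continuous.measurable hC
    rw [integral_add_measure (I _) (I _), integral_add_measure (I _) (I _)]
    have a := hμ.integral_eq φ h1 h2 h3
    have b := hν.integral_eq φ h1 h2 h3
    linarith
  rw [← Measure.toSignedMeasure_eq_toSignedMeasure_iff, Measure.toSignedMeasure_add,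
    Measure.toSignedMeasure_add] at hPQ
  rw [signedMeasure_eq_sub μ, signedMeasure_eq_sub ν]
  exact sub_eq_sub_iff_add_eq_add.2 hPQ

/-- `distribDeriv` is picked by choice; an explicitly exhibited derivative must be the chosen one.
-/
lemma distribDeriv_eq {Ω : Set E} (hΩ : IsOpen Ω) {f : E → ℝ} {v : E} {μ : SignedMeasure E}
    (hμ : IsDistribDeriv Ω f v μ) : distribDeriv Ω f v = μ := by
  have h : ∃ μ, IsDistribDeriv Ω f v μ := ⟨μ, hμ⟩
  rw [distribDeriv, dif_pos h]
  exact h.choose_spec.unique hΩ hμ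

end Unique

lemma IsBV.isDistribDeriv {E : Type*} [NormedAddCommGroup E] [NormedSpace ℝ E] [MeasureSpace E]
    {Ω : Set E} {f : E → ℝ} (h : IsBV Ω f) (v : E) :
    IsDistribDeriv Ω f v (distribDeriv Ω f v) := by
  rw [distribDeriv, dif_pos (h.2 v)]
  exact (h.2 v).choose_spec

/-! ### Increments of functions of bounded variation of one variable -/

section OneDim

lemma enorm_signedMeasure_le_totalVariation {α : Type*} [MeasurableSpace α] (s : SignedMeasure α)
    {A : Set α} (hA : MeasurableSet A) : ‖s A‖ₑ ≤ s.totalVariation A := by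
  rw [s.apply_eq_posPart_real_sub_negPart_real hA, SignedMeasure.totalVariation, Measure.add_apply]
  have h1 : ENNReal.ofReal (s.toJordanDecomposition.posPart.real A) =
    s.toJordanDecomposition.posPart A := by simp [Measure.real]
  have h2 : ENNReal.ofReal (s.toJordanDecomposition.negPart.real A) =
    s.toJordanDecomposition.negPart A := by simp [Measure.real]
  rw [← h1, ← h2, Real.enorm_eq_ofReal_abs, ← ENNReal.ofReal_add (by simp) (by simp)]
  refine ENNReal.ofReal_le_ofReal ?_
  have a : 0 ≤ s.toJordanDecomposition.posPart.real A := by simp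
  have b : 0 ≤ s.toJordanDecomposition.negPart.real A := by simp
  rw [abs_le]
  constructor <;> linarith

/-- The Jordan parts are mutually singular, so at most one of them charges the point `x`. -/
lemma totalVariation_singleton {α : Type*} [MeasurableSpace α] [MeasurableSingletonClass α]
    (s : SignedMeasure α) (x : α) : s.totalVariation {x} ≤ ‖s {x}‖ₑ := by
  have e := s.apply_eq_posPart_real_sub_negPart_real (measurableSet_singleton x)
  obtain ⟨A, hA, h1, h2⟩ := s.toJordanDecomposition.mutuallySingular
  rw [e, SignedMeasure.totalVariation, Measure.add_apply]
  by_cases hx : x ∈ A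
  · have h0 : s.toJordanDecomposition.posPart {x} = 0 :=
      measure_mono_null (singleton_subset_iff.2 hx) h1
    simp [Measure.real, h0, Real.enorm_eq_ofReal]
  · have h0 : s.toJordanDecomposition.negPart {x} = 0 :=
      measure_mono_null (singleton_subset_iff.2 hx) h2
    simp [Measure.real, h0, Real.enorm_eq_ofReal]

lemma measurableSet_setOf_Ico {h : ℝ} :
    MeasurableSet {p : ℝ × ℝ | p.1 ≤ p.2 ∧ p.2 < p.1 + h} :=
  (measurableSet_le measurable_fst measurable_snd).inter
    (measurableSet_lt measurable_snd (by fun_prop))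

lemma measurable_measure_Ico (ν : Measure ℝ) [SFinite ν] (h : ℝ) :
    Measurable fun s => ν (Ico s (s + h)) :=
  measurable_measure_prodMk_left (ν := ν) (measurableSet_setOf_Ico (h := h))

/-- Fubini on the strip `t ≤ x < t + h`. It converts the pairing of a measure with a moving integral
of `ψ` into the pairing of `ψ` with the mass of moving intervals. -/
lemma integral_window (ν : Measure ℝ) [IsFiniteMeasure ν] {h : ℝ} (hh : 0 < h) {ψ : ℝ → ℝ}
    (hψ : Continuous ψ) (hc : HasCompactSupport ψ) :
    ∫ x, (∫ t in (x - h)..x, ψ t) ∂ν = ∫ t, ψ t * ν.real (Ico t (t + h)) := by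
  have hi : Integrable ψ := hψ.integrable_of_hasCompactSupport hc
  have hI : Integrable (Function.uncurry fun (x t : ℝ) =>
      {p : ℝ × ℝ | p.2 ≤ p.1 ∧ p.1 < p.2 + h}.indicator (fun p => ψ p.2) (x, t))
      (ν.prod volume) := by
    have : Integrable (fun p : ℝ × ℝ => ψ p.2) (ν.prod volume) := hi.comp_snd ν
    refine this.indicator ?_
    exact measurable_swap (measurableSet_setOf_Ico (h := h))
  have := integral_integral_swap hI
  calc ∫ x, (∫ t in (x - h)..x, ψ t) ∂ν
      = ∫ x, (∫ t, {p : ℝ × ℝ | p.2 ≤ p.1 ∧ p.1 < p.2 + h}.indicator (fun p => ψ p.2) (x, t)) ∂ν := by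
        refine integral_congr_ae (Eventually.of_forall fun x => ?_)
        simp only
        rw [intervalIntegral.integral_of_le (by linarith), ← integral_indicator measurableSet_Ioc]
        refine integral_congr_ae (Eventually.of_forall fun t => ?_)
        simp only [indicator, mem_Ioc, mem_ofPred_eq]
        refine if_congr ?_ rfl rfl
        constructor <;> rintro ⟨a, b⟩ <;> constructor <;> linarith
    _ = ∫ t, ∫ x, {p : ℝ × ℝ | p.2 ≤ p.1 ∧ p.1 < p.2 + h}.indicator (fun p => ψ p.2) (x, t) ∂ν := this
    _ = ∫ t, ψ t * ν.real (Ico t (t + h)) := by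
        refine integral_congr_ae (Eventually.of_forall fun t => ?_)
        simp only
        rw [mul_comm, ← smul_eq_mul, ← setIntegral_const, ← integral_indicator measurableSet_Ico]
        rfl

/-- The complement is `Uᶜ - K`, the sum of a closed and a compact set. -/
lemma isOpen_setOf_add_mem {G : Type*} [AddCommGroup G] [TopologicalSpace G]
    [IsTopologicalAddGroup G] {K U : Set G} (hK : IsCompact K) (hU : IsOpen U) :
    IsOpen {x | ∀ k ∈ K, x + k ∈ U} := by
  rw [← isClosed_compl_iff]
  have : {x | ∀ k ∈ K, x + k ∈ U}ᶜ = (fun p : G × G => p.1 - p.2) '' (Uᶜ ×ˢ K) := by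
    ext x
    simp only [mem_compl_iff, mem_ofPred_eq, not_forall, mem_image, mem_prod, Prod.exists]
    constructor
    · rintro ⟨k, hk, h⟩
      exact ⟨x + k, k, ⟨h, hk⟩, by abel⟩
    · rintro ⟨a, k, ⟨ha, hk⟩, rfl⟩
      exact ⟨k, hk, by simpa using ha⟩
  rw [this]
  have e : (fun p : G × G => p.1 - p.2) '' (Uᶜ ×ˢ K) = Uᶜ + (Neg.neg '' K) := by
    ext x
    simp only [mem_image, mem_prod, Prod.exists, Set.mem_add]
    constructor
    · rintro ⟨a, b, ⟨h1, h2⟩, rfl⟩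
      exact ⟨a, h1, -b, ⟨b, h2, rfl⟩, by abel⟩
    · rintro ⟨a, h1, _, ⟨b, h2, rfl⟩, rfl⟩
      exact ⟨a, b, ⟨h1, h2⟩, by abel⟩
  rw [e]
  exact hU.isClosed_compl.add_right_of_isCompact (hK.image continuous_neg)

lemma setOf_Icc_subset_eq (I : Set ℝ) (h : ℝ) :
    {s | Icc s (s + h) ⊆ I} = {s | ∀ k ∈ Icc 0 h, s + k ∈ I} := by
  ext s
  constructor
  · intro H k hk
    exact H ⟨by linarith [hk.1], by linarith [hk.2]⟩
  · intro H t ht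
    have := H (t - s) ⟨by linarith [ht.1], by linarith [ht.2]⟩
    simpa using this

/-- As a test function, the moving integral of `ψ` has a finite difference as derivative, which
after a translation falls on `f` as an increment. -/
lemma contDiff_window {ψ : ℝ → ℝ} (hψ : ContDiff ℝ (⊤ : ℕ∞) ψ) (h : ℝ) :
    ContDiff ℝ (⊤ : ℕ∞) (fun x => ∫ t in (x - h)..x, ψ t) ∧
      ∀ x, fderiv ℝ (fun x => ∫ t in (x - h)..x, ψ t) x 1 = ψ x - ψ (x - h) := by
  have hc : Continuous ψ := hψ.continuous
  have hd : ∀ x, HasDerivAt (fun x => ∫ t in (0 : ℝ)..x, ψ t) (ψ x) x := fun x =>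
    intervalIntegral.integral_hasDerivAt_right (hc.intervalIntegrable _ _)
      (hc.stronglyMeasurableAtFilter _ _) hc.continuousAt
  have hP : ContDiff ℝ (⊤ : ℕ∞) (fun x => ∫ t in (0 : ℝ)..x, ψ t) := by
    rw [contDiff_infty_iff_deriv]
    refine ⟨fun x => (hd x).differentiableAt, ?_⟩
    rw [funext fun x => (hd x).deriv]
    exact hψ
  have e : (fun x => ∫ t in (x - h)..x, ψ t) =
      fun x => (∫ t in (0 : ℝ)..x, ψ t) - ∫ t in (0 : ℝ)..(x - h), ψ t := by
    funext x
    rw [intervalIntegral.integral_interval_sub_left (hc.intervalIntegrable _ _)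
      (hc.intervalIntegrable _ _)]
  rw [e]
  refine ⟨hP.sub (hP.comp (contDiff_id.sub contDiff_const)), fun x => ?_⟩
  have h2 : HasDerivAt (fun x => ∫ t in (0 : ℝ)..(x - h), ψ t) (ψ (x - h)) x := by
    have := (hd (x - h)).comp x ((hasDerivAt_id x).sub_const h)
    rw [mul_one] at this
    exact this
  have := (hd x).sub h2
  rw [fderiv_apply_one_eq_deriv]
  exact this.deriv

/-- The increments of a function whose derivative is a measure. -/
lemma IsDistribDeriv.ae_increment {I : Set ℝ} (hI : IsOpen I) {f : ℝ → ℝ} (hf : IntegrableOn f I)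
    {μ : SignedMeasure ℝ} (hμ : IsDistribDeriv I f 1 μ) {h : ℝ} (hh : 0 < h) :
    ∀ᵐ s, Icc s (s + h) ⊆ I → f (s + h) - f s = μ (Ico s (s + h)) := by
  set U := {s | Icc s (s + h) ⊆ I} with hU
  have hUo : IsOpen U := by
    rw [hU, setOf_Icc_subset_eq]
    exact isOpen_setOf_add_mem isCompact_Icc hI
  set F := I.indicator f with hF
  have hFi : Integrable F := (integrable_indicator_iff hI.measurableSet).2 hf
  have hFh : Integrable (fun s => F (s + h)) := hFi.comp_add_right h
  set p := μ.toJordanDecomposition.posPart with hp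
  set n := μ.toJordanDecomposition.negPart with hn
  have hloc : ∀ (ν : Measure ℝ) [IsFiniteMeasure ν],
      LocallyIntegrable (fun s => ν.real (Ico s (s + h))) := by
    intro ν _
    refine (locallyIntegrable_const (ν.real univ)).mono
      (measurable_measure_Ico ν h).ennreal_toReal.aestronglyMeasurable
      (Eventually.of_forall fun s => ?_)
    rw [Real.norm_of_nonneg (by simp), Real.norm_of_nonneg (by simp)]
    exact measureReal_mono (subset_univ _)
  -- Fundamental lemma of the calculus of variations on `U`: it suffices to test the difference of
  -- the two sides against smooth `ψ` supported in `U`.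
  have key := hUo.ae_eq_zero_of_integral_contDiff_smul_eq_zero (μ := volume)
    (f := fun s => F (s + h) - F s - (p.real (Ico s (s + h)) - n.real (Ico s (s + h))))
    (((hFh.sub hFi).locallyIntegrable.sub ((hloc p).sub (hloc n))).locallyIntegrableOn _) ?_
  · filter_upwards [key] with s hs hsU
    have h1 : F (s + h) = f (s + h) := indicator_of_mem (hsU ⟨by linarith, le_rfl⟩) _
    have h2 : F s = f s := indicator_of_mem (hsU ⟨le_rfl, by linarith⟩) _
    have := hs hsU
    rw [μ.apply_eq_posPart_real_sub_negPart_real measurableSet_Ico]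
    linarith
  intro ψ hψ hψc hψU
  have hψi : Integrable ψ := hψ.continuous.integrable_of_hasCompactSupport hψc
  obtain ⟨C, hC⟩ := bounded_of_hasCompactSupport hψ.continuous hψc
  obtain ⟨hφ, hφ'⟩ := contDiff_window hψ h
  set φ := fun x => ∫ t in (x - h)..x, ψ t with hφdef
  -- The moving integral spreads the support of `ψ` to the right by at most `h`; by the definition
  -- of `U` the enlarged support is still inside `I`.
  set K := (fun p : ℝ × ℝ => p.1 + p.2) '' (tsupport ψ ×ˢ Icc 0 h) with hK
  have hKc : IsCompact K := (hψc.prod isCompact_Icc).image continuous_add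
  have hsupp : tsupport φ ⊆ K := by
    refine closure_minimal (fun x hx => ?_) hKc.isClosed
    by_contra hxK
    refine hx ?_
    simp only [hφdef]
    refine (intervalIntegral.integral_congr (g := fun _ => (0 : ℝ)) fun t ht => ?_).trans (by simp)
    rw [uIcc_of_le (by linarith)] at ht
    by_contra hne
    exact hxK ⟨(t, x - t), ⟨subset_tsupport _ hne, by linarith [ht.2], by linarith [ht.1]⟩, by simp⟩
  have hKI : K ⊆ I := by
    rintro _ ⟨⟨t, k⟩, ⟨ht, hk⟩, rfl⟩
    exact hψU ht ⟨by simpa using hk.1, by simpa using hk.2⟩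
  have hφc : HasCompactSupport φ := hKc.of_isClosed_subset (isClosed_tsupport _) hsupp
  have main := hμ.integral_eq φ hφ hφc (hsupp.trans hKI)
  rw [integral_window _ hh hψ.continuous hψc, integral_window _ hh hψ.continuous hψc] at main
  simp_rw [hφ'] at main
  have i1 : Integrable fun x => F x * ψ x :=
    hFi.mul_bdd (c := C) hψ.continuous.aestronglyMeasurable (Eventually.of_forall hC)
  have i2 : Integrable fun x => F x * ψ (x - h) :=
    hFi.mul_bdd (c := C) (by have := hψ.continuous; fun_prop) (Eventually.of_forall fun x => hC _)
  have i3 : Integrable fun x => F (x + h) * ψ x :=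
    hFh.mul_bdd (c := C) hψ.continuous.aestronglyMeasurable (Eventually.of_forall hC)
  have i4 : ∀ (ν : Measure ℝ) [IsFiniteMeasure ν],
      Integrable (fun s => ψ s * ν.real (Ico s (s + h))) := by
    intro ν _
    refine hψi.mul_bdd (c := ν.real univ)
      (measurable_measure_Ico ν h).ennreal_toReal.aestronglyMeasurable
      (Eventually.of_forall fun s => ?_)
    rw [Real.norm_of_nonneg (by simp)]
    exact measureReal_mono (subset_univ _)
  have e1 : ∫ x in I, f x * (ψ x - ψ (x - h)) = (∫ x, F x * ψ x) - ∫ x, F (x + h) * ψ x := by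
    rw [← integral_indicator hI.measurableSet]
    have e2 : ∫ x, F (x + h) * ψ x = ∫ x, F x * ψ (x - h) := by
      rw [← integral_add_right_eq_self (fun x => F x * ψ (x - h)) h]
      simp
    rw [e2, ← integral_sub i1 i2]
    refine integral_congr_ae (Eventually.of_forall fun x => ?_)
    by_cases hx : x ∈ I
    · simp [hF, hx]; ring
    · simp [hF, hx]
  rw [e1] at main
  have e3 : ∫ x, ψ x • (F (x + h) - F x - (p.real (Ico x (x + h)) - n.real (Ico x (x + h)))) =
      (∫ x, F (x + h) * ψ x) - (∫ x, F x * ψ x) - ((∫ x, ψ x * p.real (Ico x (x + h))) -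
        ∫ x, ψ x * n.real (Ico x (x + h))) := by
    rw [← integral_sub i3 i1, ← integral_sub (i4 p) (i4 n)]
    refine Eq.trans (integral_congr_ae (Eventually.of_forall fun x => ?_))
      (integral_sub (i3.sub i1) ((i4 p).sub (i4 n)))
    simp only [smul_eq_mul]
    ring
  rw [e3]
  linarith

end OneDim

/-! ### One-sided limits and jump points of functions of one variable -/

section OneDim

lemma measurable_signedMeasure_Ico (μ : SignedMeasure ℝ) :
    Measurable fun p : ℝ × ℝ => μ (Ico p.1 (p.1 + p.2)) := by
  have key : ∀ (ν : Measure ℝ) [IsFiniteMeasure ν],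
      Measurable fun p : ℝ × ℝ => ν.real (Ico p.1 (p.1 + p.2)) := by
    intro ν _
    have hs : MeasurableSet {q : (ℝ × ℝ) × ℝ | q.1.1 ≤ q.2 ∧ q.2 < q.1.1 + q.1.2} :=
      (measurableSet_le (f := fun q : (ℝ × ℝ) × ℝ => q.1.1) (g := fun q => q.2)
        (by fun_prop) (by fun_prop)).inter
        (measurableSet_lt (f := fun q : (ℝ × ℝ) × ℝ => q.2) (g := fun q => q.1.1 + q.1.2)
        (by fun_prop) (by fun_prop))
    exact (measurable_measure_prodMk_left (ν := ν) hs).ennreal_toReal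
  simp_rw [μ.apply_eq_posPart_real_sub_negPart_real measurableSet_Ico]
  exact (key _).sub (key _)

/-- A primitive of the derivative on a subinterval. -/
lemma IsDistribDeriv.exists_primitive {I : Set ℝ} (hI : IsOpen I) {f : ℝ → ℝ}
    (hf : IntegrableOn f I) {μ : SignedMeasure ℝ} (hμ : IsDistribDeriv I f 1 μ) {a b s₀ : ℝ}
    (has : a < s₀) (hsI : Ioo a b ⊆ I) :
    ∃ s₁ ∈ Ioo a s₀, ∃ c, ∀ᵐ t, t ∈ Ioo s₁ b → f t = c + μ (Ico s₁ t) := by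
  have hFi : Integrable (I.indicator f) := (integrable_indicator_iff hI.measurableSet).2 hf
  set g := hFi.1.mk (I.indicator f) with hg
  have hgm : Measurable g := hFi.1.measurable_mk
  have hfg : ∀ᵐ x, x ∈ I → f x = g x := by
    filter_upwards [hFi.1.ae_eq_mk] with x hx hxI
    rw [hg, ← hx, indicator_of_mem hxI]
  have hfgh : ∀ h, ∀ᵐ x, x + h ∈ I → f (x + h) = g (x + h) := fun h =>
    (quasiMeasurePreserving_add_right volume h).ae hfg
  have h1 : ∀ᵐ h : ℝ, ∀ᵐ s : ℝ, a < s → 0 < h → s + h < b →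
      g (s + h) - g s = μ (Ico s (s + h)) := by
    refine Eventually.of_forall fun h => ?_
    rcases le_or_gt h 0 with hh | hh
    · exact Eventually.of_forall fun s _ h0 => absurd h0 hh.not_gt
    filter_upwards [hμ.ae_increment hI hf hh, hfg, hfgh h] with s e1 e2 e3 as _ sb
    have hsub : Icc s (s + h) ⊆ I := fun x hx => hsI ⟨by linarith [hx.1], by linarith [hx.2]⟩
    rw [← e1 hsub, e2 (hsub ⟨le_rfl, by linarith⟩), e3 (hsub ⟨by linarith, le_rfl⟩)]
  have hm : MeasurableSet {q : ℝ × ℝ | a < q.2 → 0 < q.1 → q.2 + q.1 < b →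
      g (q.2 + q.1) - g q.2 = μ (Ico q.2 (q.2 + q.1))} := by
    refine (measurableSet_lt measurable_const measurable_snd).imp
      ((measurableSet_lt measurable_const measurable_fst).imp
      ((measurableSet_lt (by fun_prop) measurable_const).imp
      (measurableSet_eq_fun (by fun_prop) ?_)))
    exact (measurable_signedMeasure_Ico μ).comp measurable_swap
  -- The increment formula holds for each `h` at a.e. `s`. Fubini turns this into: for a.e. base
  -- point `s`, at a.e. `h`, which yields a primitive based at one `s₁`. The measurable
  -- representative `g` is used because the exceptional set must be measurable.
  rw [Measure.ae_ae_comm hm] at h1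
  obtain ⟨s₁, hs₁, h2⟩ : ∃ s₁ ∈ Ioo a s₀, ∀ᵐ h : ℝ, a < s₁ → 0 < h → s₁ + h < b →
      g (s₁ + h) - g s₁ = μ (Ico s₁ (s₁ + h)) := by
    by_contra hcon
    have : volume (Ioo a s₀) = 0 := by
      refine measure_mono_null (fun s hs => ?_) (ae_iff.1 h1)
      exact fun h => hcon ⟨s, hs, h⟩
    simp at this
    linarith
  refine ⟨s₁, hs₁, g s₁, ?_⟩
  have h3 : ∀ᵐ t : ℝ, a < s₁ → 0 < t - s₁ → s₁ + (t - s₁) < b →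
      g (s₁ + (t - s₁)) - g s₁ = μ (Ico s₁ (s₁ + (t - s₁))) :=
    (measurePreserving_sub_right volume s₁).quasiMeasurePreserving.ae h2
  filter_upwards [h3, hfg] with t e1 e2 ht
  rw [e2 (hsI ⟨hs₁.1.trans ht.1, ht.2⟩)]
  have := e1 hs₁.1 (by linarith [ht.1]) (by linarith [ht.2])
  rw [add_sub_cancel] at this
  linarith

lemma setLAverage_le_of_ae_le {α : Type*} [MeasurableSpace α] {m : Measure α} {A : Set α}
    {g : α → ℝ≥0∞} {c : ℝ≥0∞} (h : ∀ᵐ y ∂m.restrict A, g y ≤ c) : ⨍⁻ y in A, g y ∂m ≤ c := by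
  rw [setLAverage_eq]
  refine ENNReal.div_le_of_le_mul ?_
  calc ∫⁻ x in A, g x ∂m ≤ ∫⁻ x in A, c ∂m := lintegral_mono_ae h
    _ = c * m A := by simp

lemma signedMeasure_union {α : Type*} [MeasurableSpace α] (s : SignedMeasure α) {A B : Set α}
    (hd : Disjoint A B) (hA : MeasurableSet A) (hB : MeasurableSet B) :
    s (A ∪ B) = s A + s B := VectorMeasure.of_union hd hA hB

/-- One-sided limits, in the essential sense, at every point of the domain. -/
lemma IsDistribDeriv.one_sided {I : Set ℝ} (hI : IsOpen I) {f : ℝ → ℝ}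
    (hf : IntegrableOn f I) {μ : SignedMeasure ℝ} (hμ : IsDistribDeriv I f 1 μ) {s₀ : ℝ}
    (hs : s₀ ∈ I) :
    ∃ (l : ℝ) (τ : ℝ → ℝ≥0∞), Tendsto τ (𝓝[>] 0) (𝓝 0) ∧ ∀ᶠ r in 𝓝[>] (0 : ℝ), ∀ᵐ y,
      (y ∈ Ioo s₀ (s₀ + r) → ‖f y - (l + μ {s₀})‖ₑ ≤ τ r) ∧
      (y ∈ Ioo (s₀ - r) s₀ → ‖f y - l‖ₑ ≤ τ r) := by
  obtain ⟨δ, hδ, hδI⟩ := Metric.isOpen_iff.1 hI s₀ hs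
  rw [Real.ball_eq_Ioo] at hδI
  obtain ⟨s₁, hs₁, c, hc⟩ := hμ.exists_primitive hI hf (by linarith : s₀ - δ < s₀) hδI
  set V := μ.totalVariation with hV
  -- The left limit is the value of the primitive just before `s₀`. The error is the variation of
  -- `μ` on a punctured neighbourhood, and these neighbourhoods shrink to the empty set.
  refine ⟨c + μ (Ico s₁ s₀), fun r => V (Ioo (s₀ - r) (s₀ + r) \ {s₀}), ?_, ?_⟩
  · have h := tendsto_measure_biInter_gt (μ := V) (a := (0 : ℝ))
      (s := fun r => Ioo (s₀ - r) (s₀ + r) \ {s₀})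
      (fun r _ => (measurableSet_Ioo.diff (measurableSet_singleton _)).nullMeasurableSet)
      (fun i j _ hij => sdiff_subset_sdiff_left (Ioo_subset_Ioo (by linarith) (by linarith)))
      ⟨1, by norm_num, by finiteness⟩
    have e : (⋂ r, ⋂ (_ : r > (0 : ℝ)), Ioo (s₀ - r) (s₀ + r) \ {s₀}) = ∅ := by
      refine eq_empty_of_forall_notMem fun x hx => ?_
      simp only [mem_iInter] at hx
      have hne : x ≠ s₀ := fun h => (hx 1 one_pos).2 h
      have := (hx |x - s₀| (abs_pos.2 (sub_ne_zero.2 hne))).1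
      rcases abs_cases (x - s₀) with h | h
      · linarith [this.2]
      · linarith [this.1]
    rw [e, measure_empty] at h
    exact h
  · have hr1 : ∀ᶠ r in 𝓝[>] (0 : ℝ), r < δ :=
      eventually_nhdsWithin_of_eventually_nhds (gt_mem_nhds hδ)
    have hr2 : ∀ᶠ r in 𝓝[>] (0 : ℝ), r < s₀ - s₁ :=
      eventually_nhdsWithin_of_eventually_nhds (gt_mem_nhds (by linarith [hs₁.2]))
    filter_upwards [hr1, hr2, self_mem_nhdsWithin] with r hrδ hrs hr0
    have hr0' : 0 < r := hr0
    filter_upwards [hc] with y hy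
    constructor
    · intro hyr
      rw [hy ⟨by linarith [hs₁.2, hyr.1], by linarith [hyr.2]⟩]
      have e1 : Ico s₁ y = (Ico s₁ s₀ ∪ {s₀}) ∪ Ioo s₀ y := by
        ext x
        simp only [mem_Ico, mem_union, mem_singleton_iff, mem_Ioo]
        constructor
        · rintro ⟨h1, h2⟩
          rcases lt_trichotomy x s₀ with h | h | h
          · exact Or.inl (Or.inl ⟨h1, h⟩)
          · exact Or.inl (Or.inr h)
          · exact Or.inr ⟨h, h2⟩
        · rintro ((⟨h1, h2⟩ | rfl) | ⟨h1, h2⟩)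
          · exact ⟨h1, by linarith [hyr.1]⟩
          · exact ⟨hs₁.2.le, hyr.1⟩
          · exact ⟨by linarith [hs₁.2], h2⟩
      have e2 : μ (Ico s₁ y) = μ (Ico s₁ s₀) + μ {s₀} + μ (Ioo s₀ y) := by
        rw [e1, signedMeasure_union _ ?_ (measurableSet_Ico.union (measurableSet_singleton _))
          measurableSet_Ioo, signedMeasure_union _ ?_ measurableSet_Ico (measurableSet_singleton _)]
        · simp
        · rw [disjoint_left]
          rintro x (h | h) h'
          · exact absurd h'.1 (by linarith [h.2])
          · exact absurd h'.1 (by simp at h; linarith)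
      rw [e2]
      have e3 : c + (μ (Ico s₁ s₀) + μ {s₀} + μ (Ioo s₀ y)) - (c + μ (Ico s₁ s₀) + μ {s₀}) =
        μ (Ioo s₀ y) := by ring
      rw [e3]
      refine (enorm_signedMeasure_le_totalVariation μ measurableSet_Ioo).trans (measure_mono ?_)
      exact fun x hx => ⟨⟨by linarith [hx.1], by linarith [hx.2, hyr.2]⟩, hx.1.ne'⟩
    · intro hyr
      rw [hy ⟨by linarith [hs₁.2, hyr.1], by linarith [hyr.2]⟩]
      have e1 : Ico s₁ s₀ = Ico s₁ y ∪ Ico y s₀ :=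
        (Ico_union_Ico_eq_Ico (by linarith [hyr.1]) hyr.2.le).symm
      rw [e1, signedMeasure_union _ ?_ measurableSet_Ico measurableSet_Ico]
      · have e3 : c + μ (Ico s₁ y) - (c + (μ (Ico s₁ y) + μ (Ico y s₀))) = - μ (Ico y s₀) := by ring
        rw [e3, enorm_neg]
        refine (enorm_signedMeasure_le_totalVariation μ measurableSet_Ico).trans (measure_mono ?_)
        exact fun x hx => ⟨⟨by linarith [hx.1, hyr.1], by linarith [hx.2]⟩, hx.2.ne⟩
      · rw [disjoint_left]
        intro x h h'
        exact absurd h.2 (by linarith [h'.1])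

lemma halfBall_one (x r : ℝ) : halfBall x 1 r ⊆ Ioo x (x + r) := by
  rintro y ⟨h1, h2⟩
  rw [Real.ball_eq_Ioo] at h1
  simp at h2
  exact ⟨h2, h1.2⟩

lemma halfBall_neg_one (x r : ℝ) : halfBall x (-1) r ⊆ Ioo (x - r) x := by
  rintro y ⟨h1, h2⟩
  rw [Real.ball_eq_Ioo] at h1
  simp at h2
  exact ⟨h1.1, h2⟩

lemma measurableSet_halfBall {E : Type*} [NormedAddCommGroup E] [InnerProductSpace ℝ E]
    [MeasurableSpace E] [BorelSpace E] (x ν : E) (r : ℝ) : MeasurableSet (halfBall x ν r) := by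
  have h : Continuous fun y : E => inner ℝ ν (y - x) := by fun_prop
  exact (Metric.isOpen_ball.inter (isOpen_lt continuous_const h)).measurableSet

/-- An atom of the derivative is a jump point. -/
lemma IsDistribDeriv.isApproxJump {I : Set ℝ} (hI : IsOpen I) {f : ℝ → ℝ}
    (hf : IntegrableOn f I) {μ : SignedMeasure ℝ} (hμ : IsDistribDeriv I f 1 μ) {s₀ : ℝ}
    (hs : s₀ ∈ I) (hne : μ {s₀} ≠ 0) : ∃ l, IsApproxJump f s₀ (l + μ {s₀}) l 1 := by
  obtain ⟨l, τ, hτ, h⟩ := hμ.one_sided hI hf hs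
  refine ⟨l, by simpa using hne, by simp, ?_, ?_⟩
  · refine tendsto_of_tendsto_of_tendsto_of_le_of_le' tendsto_const_nhds hτ
      (Eventually.of_forall fun _ => zero_le) ?_
    filter_upwards [h] with r hr
    refine setLAverage_le_of_ae_le ?_
    rw [ae_restrict_iff' (measurableSet_halfBall _ _ _)]
    filter_upwards [hr] with y hy hyr using hy.1 (halfBall_one _ _ hyr)
  · refine tendsto_of_tendsto_of_tendsto_of_le_of_le' tendsto_const_nhds hτ
      (Eventually.of_forall fun _ => zero_le) ?_
    filter_upwards [h] with r hr
    refine setLAverage_le_of_ae_le ?_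
    rw [ae_restrict_iff' (measurableSet_halfBall _ _ _)]
    filter_upwards [hr] with y hy hyr using hy.2 (halfBall_neg_one _ _ hyr)

/-- At a point without an atom the two one-sided limits `l` and `l + μ {s}` coincide, so there is an
approximate limit. -/
lemma IsDistribDeriv.discontinuitySet_subset {I : Set ℝ} (hI : IsOpen I) {f : ℝ → ℝ}
    (hf : IntegrableOn f I) {μ : SignedMeasure ℝ} (hμ : IsDistribDeriv I f 1 μ) :
    discontinuitySet I f ⊆ {s | s ∈ I ∧ μ {s} ≠ 0} := by
  rintro s ⟨hs, hn⟩
  refine ⟨hs, fun h0 => hn ?_⟩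
  obtain ⟨l, τ, hτ, h⟩ := hμ.one_sided hI hf hs
  refine ⟨l, ?_⟩
  refine tendsto_of_tendsto_of_tendsto_of_le_of_le' tendsto_const_nhds hτ
      (Eventually.of_forall fun _ => zero_le) ?_
  filter_upwards [h] with r hr
  refine setLAverage_le_of_ae_le ?_
  rw [ae_restrict_iff' Metric.isOpen_ball.measurableSet]
  filter_upwards [hr, compl_mem_ae_iff.2 (measure_singleton s)] with y hy hne hyr
  rw [Real.ball_eq_Ioo] at hyr
  rw [h0, add_zero] at hy
  rcases lt_or_gt_of_ne (hne : y ≠ s) with h | h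
  · exact hy.2 ⟨hyr.1, h⟩
  · exact hy.1 ⟨h, hyr.2⟩

end OneDim

/-! ### Truncated increments and truncated variation -/

section OneDim

lemma min_add_one_le (a b : ℝ≥0∞) : min (a + b) 1 ≤ a + min b 1 := by
  rcases le_total b 1 with h | h
  · rw [min_eq_left h]; exact min_le_left _ _
  · rw [min_eq_right h]; exact (min_le_right _ _).trans le_add_self

lemma min_tsum_one_le {ι : Type*} (x : ι → ℝ≥0∞) : min (∑' i, x i) 1 ≤ ∑' i, min (x i) 1 := by
  by_cases h : ∃ i, 1 ≤ x i
  · obtain ⟨i, hi⟩ := h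
    refine (min_le_right _ _).trans ?_
    calc (1 : ℝ≥0∞) = min (x i) 1 := (min_eq_right hi).symm
      _ ≤ _ := ENNReal.le_tsum i
  · push Not at h
    simp_rw [fun i => min_eq_left (h i).le]
    exact min_le_left _ _

/-- Tonelli: a point `x` lies in `[s, s + h)` exactly for `s ∈ (x - h, x]`, a set of length `h`. -/
lemma lintegral_measure_Ico (κ : Measure ℝ) [SFinite κ] (h : ℝ) :
    ∫⁻ s, κ (Ico s (s + h)) = ENNReal.ofReal h * κ univ := by
  have e : ∀ s, κ (Ico s (s + h)) =
      ∫⁻ x, {p : ℝ × ℝ | p.1 ≤ p.2 ∧ p.2 < p.1 + h}.indicator 1 (s, x) ∂κ := by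
    intro s
    rw [← lintegral_indicator_one measurableSet_Ico]
    rfl
  simp_rw [e]
  rw [lintegral_lintegral_swap]
  · have e2 : ∀ x : ℝ, ∫⁻ s, {p : ℝ × ℝ | p.1 ≤ p.2 ∧ p.2 < p.1 + h}.indicator
        (1 : ℝ × ℝ → ℝ≥0∞) (s, x) = ENNReal.ofReal h := by
      intro x
      have : ∀ s, {p : ℝ × ℝ | p.1 ≤ p.2 ∧ p.2 < p.1 + h}.indicator (1 : ℝ × ℝ → ℝ≥0∞) (s, x) =
          (Ioc (x - h) x).indicator 1 s := by
        intro s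
        simp only [indicator, mem_Ioc, mem_ofPred_eq, Pi.one_apply]
        refine if_congr ?_ rfl rfl
        constructor <;> rintro ⟨a, b⟩ <;> constructor <;> linarith
      simp_rw [this]
      rw [lintegral_indicator_one measurableSet_Ioc]
      simp
    simp_rw [e2]
    simp
  · exact (measurable_one.indicator measurableSet_setOf_Ico).aemeasurable

/-- The truncated increments of a function of bounded variation are controlled by its truncated
variation. -/
theorem lintegral_min_increment_le {I : Set ℝ} (hI : IsOpen I) {f : ℝ → ℝ} (hf : IsBV I f)
    {h : ℝ} (hh : 0 < h) :
    ∫⁻ s in {s | Icc s (s + h) ⊆ I}, min ‖f (s + h) - f s‖ₑ 1 ≤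
      ENNReal.ofReal h * truncVariation I f := by
  have hμ := hf.isDistribDeriv 1
  set μ := distribDeriv I f 1 with hμdef
  set S := discontinuitySet I f with hS
  have hSA : S ⊆ {s | s ∈ I ∧ μ {s} ≠ 0} := hμ.discontinuitySet_subset hI hf.1
  have hSc : S.Countable := by
    have := Measure.countable_meas_pos_of_disjoint_iUnion (μ := μ.totalVariation)
      (As := fun x : ℝ => {x}) (fun x => measurableSet_singleton x)
      (fun x y hxy => by simpa using hxy)
    refine this.mono fun s hs => ?_
    have : μ.totalVariation {s} ≠ 0 := fun h0 =>
      (hSA hs).2 (SignedMeasure.null_of_totalVariation_zero _ h0)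
    exact pos_iff_ne_zero.2 this
  have hSm : MeasurableSet S := hSc.measurableSet
  have : Countable S := hSc
  set σ := singPart I f 1 with hσ
  set α := acPart I f 1 with hα
  have hdec : μ = σ + α := (SignedMeasure.singularPart_add_withDensity_rnDeriv_eq volume μ).symm
  -- Truncation is moved from the increments to the individual atoms. Unlike `W ↦ min ‖μ W‖ₑ 1`, the
  -- result `κ` is a measure, so Tonelli applies, and it dominates the truncated increment because
  -- truncation at `1` is countably subadditive.
  set κ : Measure ℝ := α.totalVariation.restrict I + σ.totalVariation.restrict (I \ S) +
    Measure.sum (fun t : S => (min ‖μ {(t : ℝ)}‖ₑ 1) • Measure.dirac (t : ℝ)) with hκ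
  -- The absolutely continuous part has no atoms.
  have hatom : ∀ t : ℝ, σ {t} = μ {t} := by
    intro t
    have : α {t} = 0 := Measure.withDensityᵥ_absolutelyContinuous volume _
      (by rw [Measure.toENNRealVectorMeasure_apply_measurable (measurableSet_singleton t)]; simp)
    rw [hdec, add_apply, this, add_zero]
  have hle : ∀ W : Set ℝ, MeasurableSet W → W ⊆ I → min ‖μ W‖ₑ 1 ≤ κ W := by
    intro W hW hWI
    have h1 : ‖μ W‖ₑ ≤ α.totalVariation W + σ.totalVariation (W \ S) +
        ∑' t : S, W.indicator (fun t => ‖μ {t}‖ₑ) t := by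
      have e1 : μ W = α W + σ (W \ S) + σ (W ∩ S) := by
        have : σ W = σ (W \ S) + σ (W ∩ S) := by
          rw [← signedMeasure_union _ disjoint_sdiff_inter (hW.diff hSm) (hW.inter hSm),
            sdiff_union_inter]
        rw [hdec, add_apply, this]
        ring
      rw [e1]
      refine (enorm_add_le _ _).trans (add_le_add ((enorm_add_le _ _).trans (add_le_add ?_ ?_)) ?_)
      · exact enorm_signedMeasure_le_totalVariation _ hW
      · exact enorm_signedMeasure_le_totalVariation _ (hW.diff hSm)
      · refine (enorm_signedMeasure_le_totalVariation _ (hW.inter hSm)).trans ?_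
        have e2 : W ∩ S = ⋃ t : S, W ∩ {(t : ℝ)} := by
          ext x; simp
        rw [e2]
        refine (measure_iUnion_le _).trans (ENNReal.tsum_le_tsum fun t => ?_)
        by_cases ht : (t : ℝ) ∈ W
        · rw [indicator_of_mem ht, inter_eq_right.2 (singleton_subset_iff.2 ht), ← hatom]
          exact totalVariation_singleton _ _
        · rw [indicator_of_notMem ht, inter_singleton_eq_empty.2 ht]
          simp
    have h2 : κ W = α.totalVariation W + σ.totalVariation (W \ S) +
        ∑' t : S, min (W.indicator (fun t => ‖μ {t}‖ₑ) t) 1 := by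
      rw [hκ, Measure.add_apply, Measure.add_apply, Measure.restrict_apply hW,
        Measure.restrict_apply hW, Measure.sum_apply _ hW, inter_eq_left.2 hWI]
      congr 2
      · congr 1
        ext x
        simp only [mem_inter_iff, Set.mem_sdiff]
        exact ⟨fun h => ⟨h.1, h.2.2⟩, fun h => ⟨h.1, hWI h.1, h.2⟩⟩
      · funext t
        by_cases ht : (t : ℝ) ∈ W
        · simp [ht, Measure.dirac_apply' _ hW]
        · simp [ht, Measure.dirac_apply' _ hW]
    rw [h2]
    refine (min_le_min_right _ h1).trans ((min_add_one_le _ _).trans ?_)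
    gcongr
    exact min_tsum_one_le _
  have hκu : κ univ ≤ truncVariation I f := by
    rw [hκ, Measure.add_apply, Measure.add_apply, Measure.restrict_apply_univ,
      Measure.restrict_apply_univ, Measure.sum_apply _ MeasurableSet.univ, truncVariation]
    refine add_le_add le_rfl ?_
    -- A discontinuity is an atom of `μ`, hence a jump point with one-sided limits differing by `μ
    -- {t}`. Only a lower bound for the supremum defining `jumpSize` is needed.
    have hSJ : S ⊆ jumpSet I f := fun t ht => by
      obtain ⟨l, hl⟩ := hμ.isApproxJump hI hf.1 (hSA ht).1 (hSA ht).2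
      exact ⟨(hSA ht).1, _, _, _, hl⟩
    refine le_trans (ENNReal.tsum_le_tsum fun t => ?_)
      (ENNReal.tsum_mono_subtype (fun t => min (jumpSize f t) 1) hSJ)
    simp only [Measure.smul_apply, measure_univ, smul_eq_mul, mul_one]
    refine min_le_min_right _ ?_
    obtain ⟨l, hl⟩ := hμ.isApproxJump hI hf.1 (hSA t.2).1 (hSA t.2).2
    unfold jumpSize
    refine le_trans (le_of_eq (by simp)) (le_iSup_of_le _ (le_iSup_of_le _ (le_iSup_of_le _
      (le_iSup_of_le hl le_rfl))))
  have hUo : IsOpen {s | Icc s (s + h) ⊆ I} := by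
    rw [setOf_Icc_subset_eq]
    exact isOpen_setOf_add_mem isCompact_Icc hI
  calc ∫⁻ s in {s | Icc s (s + h) ⊆ I}, min ‖f (s + h) - f s‖ₑ 1
      ≤ ∫⁻ s in {s | Icc s (s + h) ⊆ I}, κ (Ico s (s + h)) := by
        refine lintegral_mono_ae ?_
        rw [ae_restrict_iff' hUo.measurableSet]
        filter_upwards [hμ.ae_increment hI hf.1 hh] with s hs hsU
        rw [hs hsU]
        exact hle _ measurableSet_Ico (Ico_subset_Icc_self.trans hsU)
    _ ≤ ∫⁻ s, κ (Ico s (s + h)) := setLIntegral_le_lintegral _ _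
    _ = ENNReal.ofReal h * κ univ := lintegral_measure_Ico κ h
    _ ≤ _ := by gcongr

end OneDim

/-! ### Slicing -/

section Slicing

variable {d : ℕ}

lemma finrank_span_orthogonal {ξ : EuclideanSpace ℝ (Fin d)} (hξ : ξ ≠ 0) :
    Module.finrank ℝ (Submodule.span ℝ {ξ})ᗮ = d - 1 := by
  have h := Submodule.finrank_add_finrank_orthogonal (Submodule.span ℝ {ξ})
  rw [finrank_span_singleton hξ, finrank_euclideanSpace_fin] at h
  omega

lemma hausdorff_orthogonal_eq_volume {ξ : EuclideanSpace ℝ (Fin d)} (hξ : ξ ≠ 0) :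
    (μHE[d - 1] : Measure (Submodule.span ℝ {ξ})ᗮ) = volume := by
  rw [← finrank_span_orthogonal hξ]
  exact InnerProductSpace.euclideanHausdorffMeasure_eq_volume

/-- Fubini for the orthogonal splitting into `ℝ ξ` and `ξ^⊥`; the factor `‖ξ‖ₑ` is the speed of the
parametrization `s ↦ s ξ`. -/
lemma lintegral_eq_slices {ξ : EuclideanSpace ℝ (Fin d)} (hξ : ξ ≠ 0)
    {G : EuclideanSpace ℝ (Fin d) → ℝ≥0∞} (hG : Measurable G) :
    ∫⁻ x, G x = ‖ξ‖ₑ * ∫⁻ z : (Submodule.span ℝ {ξ})ᗮ, (∫⁻ s : ℝ, G (z + s • ξ))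
      ∂(μHE[d - 1] : Measure (Submodule.span ℝ {ξ})ᗮ) := by
  set S := Submodule.span ℝ {ξ} with hS
  have hmp := S.measurePreserving_measurableEquivProd (0 : EuclideanSpace ℝ (Fin d))
  rw [InnerProductSpace.euclideanHausdorffMeasure_eq_volume] at hmp
  have hmp' := hmp.symm
  rw [hausdorff_orthogonal_eq_volume hξ, ← hmp'.lintegral_comp hG]
  have hξS : ξ ∈ S := Submodule.mem_span_singleton_self ξ
  set v : S := ⟨ξ, hξS⟩ with hv
  have hv0 : v ≠ 0 := fun h => hξ (congrArg Subtype.val h)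
  have hvol : (volume : Measure S) = ‖v‖ₑ • (volume : Measure ℝ).map (· • v) :=
    volume_eq_of_finrank_eq_one (finrank_span_singleton hξ) hv0
  have hadd : Measurable fun q : S × Sᗮ => G (q.1.val + q.2.val) := by fun_prop
  simp only [Submodule.measurableEquivProd_symm_apply, vadd_eq_add, add_zero]
  change ∫⁻ q : S × Sᗮ, G (q.1.val + q.2.val) ∂((volume : Measure S).prod (volume : Measure Sᗮ)) = _
  rw [lintegral_prod_symm _ hadd.aemeasurable, ← lintegral_const_mul']
  · refine lintegral_congr fun z => ?_
    rw [hvol, lintegral_smul_measure, lintegral_map (by fun_prop) (by fun_prop)]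
    simp only [smul_eq_mul]
    congr 1
    refine lintegral_congr fun s => ?_
    rw [add_comm]
    rfl
  · simp

lemma ae_slice {ξ : EuclideanSpace ℝ (Fin d)} (hξ : ξ ≠ 0)
    {p : EuclideanSpace ℝ (Fin d) → Prop} (hp : ∀ᵐ x, p x) :
    ∀ᵐ z : (Submodule.span ℝ {ξ})ᗮ ∂(μHE[d - 1] : Measure (Submodule.span ℝ {ξ})ᗮ),
      ∀ᵐ s : ℝ, p (z + s • ξ) := by
  obtain ⟨N, hN, hNm, hN0⟩ := exists_measurable_superset_of_null (ae_iff.1 hp)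
  have h := lintegral_eq_slices hξ (G := N.indicator 1) (measurable_one.indicator hNm)
  rw [lintegral_indicator_one hNm, hN0, eq_comm, mul_eq_zero] at h
  have h1 := h.resolve_left (by simpa using hξ)
  rw [hausdorff_orthogonal_eq_volume hξ] at h1 ⊢
  have hm : Measurable fun q : (Submodule.span ℝ {ξ})ᗮ × ℝ =>
      N.indicator (1 : EuclideanSpace ℝ (Fin d) → ℝ≥0∞) (q.1 + q.2 • ξ) :=
    (measurable_one.indicator hNm).comp (by fun_prop)
  rw [lintegral_eq_zero_iff hm.lintegral_prod_right'] at h1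
  filter_upwards [h1] with z hz
  have hm2 : Measurable fun s : ℝ =>
      N.indicator (1 : EuclideanSpace ℝ (Fin d) → ℝ≥0∞) (z + s • ξ) :=
    (measurable_one.indicator hNm).comp (by fun_prop)
  rw [Pi.zero_apply, lintegral_eq_zero_iff hm2] at hz
  filter_upwards [hz] with s hs
  by_contra hcon
  have : (z : EuclideanSpace ℝ (Fin d)) + s • ξ ∈ N := hN hcon
  simp [this] at hs

/-- The points from which the segment in direction `ε ξ` stays in `Ω`. -/
def segmentDomain (Ω : Set (EuclideanSpace ℝ (Fin d))) (ξ : EuclideanSpace ℝ (Fin d)) (ε : ℝ) :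
    Set (EuclideanSpace ℝ (Fin d)) :=
  {x | ∀ t ∈ Icc 0 ε, x + t • ξ ∈ Ω}

lemma isOpen_segmentDomain {Ω : Set (EuclideanSpace ℝ (Fin d))} (hΩ : IsOpen Ω)
    (ξ : EuclideanSpace ℝ (Fin d)) (ε : ℝ) : IsOpen (segmentDomain Ω ξ ε) := by
  have : segmentDomain Ω ξ ε = {x | ∀ k ∈ (fun t : ℝ => t • ξ) '' Icc 0 ε, x + k ∈ Ω} := by
    ext x; simp only [segmentDomain, mem_ofPred_eq, forall_mem_image]
  rw [this]
  exact isOpen_setOf_add_mem (isCompact_Icc.image (by fun_prop)) hΩ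

/-- The truncated increment of `u` in direction `ε ξ`. -/
def truncIncrement (Ω : Set (EuclideanSpace ℝ (Fin d)))
    (u : EuclideanSpace ℝ (Fin d) → EuclideanSpace ℝ (Fin d)) (ε : ℝ)
    (ξ : EuclideanSpace ℝ (Fin d)) : EuclideanSpace ℝ (Fin d) → ℝ≥0∞ :=
  (segmentDomain Ω ξ ε).indicator fun x => min ‖inner ℝ ξ (u (x + ε • ξ) - u x)‖ₑ 1

lemma measurable_truncIncrement {Ω : Set (EuclideanSpace ℝ (Fin d))} (hΩ : IsOpen Ω)
    {u : EuclideanSpace ℝ (Fin d) → EuclideanSpace ℝ (Fin d)} (hu : Measurable u) (ε : ℝ)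
    (ξ : EuclideanSpace ℝ (Fin d)) : Measurable (truncIncrement Ω u ε ξ) := by
  refine Measurable.indicator ?_ (isOpen_segmentDomain hΩ ξ ε).measurableSet
  have h1 : Measurable fun x => u (x + ε • ξ) - u x :=
    (hu.comp (measurable_id.add_const _)).sub hu
  have h2 : Measurable fun x => inner ℝ ξ (u (x + ε • ξ) - u x) :=
    (continuous_const.inner continuous_id).measurable.comp h1
  exact h2.enorm.min measurable_const

/-- On each line parallel to `ξ` the increment is that of a slice over an interval of length `ε`,
where the one-dimensional bound applies. The BV hypothesis concerns slices of `u`, while Fubini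
needs the measurable `v`; on almost every line they agree almost everywhere. -/
theorem lintegral_truncIncrement_le {Ω : Set (EuclideanSpace ℝ (Fin d))} (hΩ : IsOpen Ω)
    {u v : EuclideanSpace ℝ (Fin d) → EuclideanSpace ℝ (Fin d)}
    (hv : Measurable v) (huv : ∀ᵐ x, x ∈ Ω → u x = v x) {ξ : EuclideanSpace ℝ (Fin d)}
    (hξ : ξ ≠ 0)
    (hbv : ∀ᵐ z : (Submodule.span ℝ {ξ})ᗮ ∂(μHE[d - 1] : Measure (Submodule.span ℝ {ξ})ᗮ),
      IsBV (sliceDomain Ω ξ z) (slice u ξ z)) {ε : ℝ} (hε : 0 < ε) :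
    ∫⁻ x, truncIncrement Ω v ε ξ x ≤ ‖ξ‖ₑ * (ENNReal.ofReal ε * sliceEnergy Ω u ξ) := by
  rw [lintegral_eq_slices hξ (measurable_truncIncrement hΩ hv ε ξ)]
  refine mul_le_mul_right ?_ _
  -- A finite constant enters the lower integral without measurability of `truncVariation` in `z`.
  rw [sliceEnergy, ← lintegral_const_mul' _ _ ENNReal.ofReal_ne_top]
  refine lintegral_mono_ae ?_
  filter_upwards [hbv, ae_slice hξ huv] with z hz hz2
  have ho : IsOpen (sliceDomain Ω ξ z) :=
    hΩ.preimage (f := fun s : ℝ => (z : EuclideanSpace ℝ (Fin d)) + s • ξ) (by fun_prop)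
  refine le_trans ?_ (lintegral_min_increment_le ho hz hε)
  have hUo : IsOpen {s | Icc s (s + ε) ⊆ sliceDomain Ω ξ z} := by
    rw [setOf_Icc_subset_eq]
    exact isOpen_setOf_add_mem isCompact_Icc ho
  rw [← lintegral_indicator hUo.measurableSet]
  refine lintegral_mono_ae ?_
  have hz3 : ∀ᵐ s : ℝ, (z : EuclideanSpace ℝ (Fin d)) + (s + ε) • ξ ∈ Ω →
      u (z + (s + ε) • ξ) = v (z + (s + ε) • ξ) :=
    (quasiMeasurePreserving_add_right volume ε).ae hz2
  filter_upwards [hz2, hz3] with s h1 h2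
  by_cases hs : (z : EuclideanSpace ℝ (Fin d)) + s • ξ ∈ segmentDomain Ω ξ ε
  · have hsU : Icc s (s + ε) ⊆ sliceDomain Ω ξ z := by
      intro t ht
      have := hs (t - s) ⟨by linarith [ht.1], by linarith [ht.2]⟩
      rw [add_assoc, ← add_smul, add_sub_cancel] at this
      exact this
    rw [truncIncrement, indicator_of_mem hs, indicator_of_mem (by exact hsU)]
    have e1 := h1 (hsU ⟨le_rfl, by linarith⟩)
    have e2 := h2 (hsU ⟨by linarith, le_rfl⟩)
    rw [slice, slice, ← inner_sub_right, e1, e2, add_assoc, ← add_smul]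
  · rw [truncIncrement, indicator_of_notMem hs]
    exact zero_le

end Slicing

/-! ### Uniqueness of one-sided approximate limits -/

section ApproxLimits

variable {E F : Type*} [NormedAddCommGroup E] [InnerProductSpace ℝ E] [NormedAddCommGroup F]

lemma ball_subset_halfBall {x ν : E} (hν : ‖ν‖ = 1) {r : ℝ} (hr : 0 < r) :
    Metric.ball (x + (r / 2) • ν) (r / 2) ⊆ halfBall x ν r := by
  intro y hy
  rw [Metric.mem_ball, dist_eq_norm] at hy
  have e : y - x = (y - (x + (r / 2) • ν)) + (r / 2) • ν := by abel
  refine ⟨?_, ?_⟩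
  · rw [Metric.mem_ball, dist_eq_norm, e]
    refine (norm_add_le _ _).trans_lt ?_
    rw [norm_smul, hν, Real.norm_of_nonneg (by linarith)]
    linarith
  · rw [e, inner_add_right, inner_smul_right, real_inner_self_eq_norm_sq, hν]
    have := (abs_le.1 (abs_real_inner_le_norm ν (y - (x + (r / 2) • ν)))).1
    rw [hν] at this
    linarith

lemma halfBall_subset_ball (x ν : E) (r : ℝ) : halfBall x ν r ⊆ Metric.ball x r := fun _ h => h.1

variable [MeasureSpace E]

lemma le_setLAverage {α : Type*} [MeasurableSpace α] {m : Measure α} {A : Set α} {g : α → ℝ≥0∞}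
    {c : ℝ≥0∞} (hA : MeasurableSet A) (h0 : m A ≠ 0) (h1 : m A ≠ ⊤) (h : ∀ y ∈ A, c ≤ g y) :
    c ≤ ⨍⁻ y in A, g y ∂m := by
  rw [setLAverage_eq, ENNReal.le_div_iff_mul_le (Or.inl h0) (Or.inl h1)]
  calc c * m A = ∫⁻ _ in A, c ∂m := by simp
    _ ≤ _ := setLIntegral_mono' hA h

variable [(volume : Measure E).IsAddHaarMeasure]

lemma volume_halfBall_pos {x ν : E} (hν : ‖ν‖ = 1) {r : ℝ} (hr : 0 < r) :
    volume (halfBall x ν r) ≠ 0 := by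
  have := (Metric.measure_ball_pos volume (x + (r / 2) • ν) (half_pos hr)).trans_le
    (measure_mono (ball_subset_halfBall hν hr))
  exact this.ne'

variable [FiniteDimensional ℝ E]

lemma volume_halfBall_ne_top (x ν : E) (r : ℝ) : volume (halfBall x ν r) ≠ ⊤ :=
  ((measure_mono (halfBall_subset_ball x ν r)).trans_lt measure_ball_lt_top).ne

variable [BorelSpace E]

/-- The half ball contains a ball of half the radius, which explains the factor `2 ^ dim`. Means
over half balls are thereby controlled by means over balls. -/
lemma volume_ball_le_halfBall {x ν : E} (hν : ‖ν‖ = 1) {r : ℝ} (hr : 0 < r) :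
    volume (Metric.ball x r) ≤ 2 ^ (Module.finrank ℝ E) * volume (halfBall x ν r) := by
  have h1 : volume (Metric.ball (x + (r / 2) • ν) (r / 2)) =
      ENNReal.ofReal ((1 / 2) ^ Module.finrank ℝ E) * volume (Metric.ball x r) := by
    have e : Metric.ball (x + (r / 2) • ν) (r / 2) =
      Metric.ball (x + (r / 2) • ν) ((1 / 2) * r) := by congr 1; ring
    rw [e, Measure.addHaar_ball_mul_of_pos volume _ (by norm_num : (0 : ℝ) < 1 / 2), Measure.addHaar_ball_center,
      Measure.addHaar_ball_center volume x]
  have h2 : volume (Metric.ball x r) = 2 ^ (Module.finrank ℝ E) *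
      volume (Metric.ball (x + (r / 2) • ν) (r / 2)) := by
    rw [h1, ← mul_assoc]
    have : (2 : ℝ≥0∞) ^ Module.finrank ℝ E * ENNReal.ofReal ((1 / 2) ^ Module.finrank ℝ E) = 1 := by
      rw [show (2 : ℝ≥0∞) = ENNReal.ofReal 2 by simp, ← ENNReal.ofReal_pow (by norm_num),
        ← ENNReal.ofReal_mul (by positivity), ← mul_pow]
      norm_num
    rw [this, one_mul]
  rw [h2]
  gcongr
  exact ball_subset_halfBall hν hr

/-- A limit in an open half space determines the approximate limit. -/
lemma eq_of_tendsto_halfBall {u : E → F} {x ν : E} {a b : F} (hν : ‖ν‖ = 1)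
    (hb : Tendsto u (𝓝[{y | 0 < inner ℝ ν (y - x)}] x) (𝓝 b))
    (ha : Tendsto (fun r : ℝ => ⨍⁻ y in halfBall x ν r, ‖u y - a‖ₑ ∂volume) (𝓝[>] 0) (𝓝 0)) :
    a = b := by
  by_contra hne
  have hpos : 0 < ‖a - b‖ := norm_pos_iff.2 (sub_ne_zero.2 hne)
  have h1 : ∀ᶠ y in 𝓝[{y | 0 < inner ℝ ν (y - x)}] x, ‖u y - b‖ < ‖a - b‖ / 2 := by
    have := hb.eventually (Metric.ball_mem_nhds b (half_pos hpos))
    simpa only [Metric.mem_ball, dist_eq_norm] using this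
  rw [eventually_nhdsWithin_iff, Metric.eventually_nhds_iff] at h1
  obtain ⟨δ, hδ, h1⟩ := h1
  have h2 : ∀ᶠ r in 𝓝[>] (0 : ℝ), ENNReal.ofReal (‖a - b‖ / 2) ≤
      ⨍⁻ y in halfBall x ν r, ‖u y - a‖ₑ ∂volume := by
    filter_upwards [self_mem_nhdsWithin, eventually_nhdsWithin_of_eventually_nhds (gt_mem_nhds hδ)]
      with r hr hrδ
    refine le_setLAverage (measurableSet_halfBall _ _ _) (volume_halfBall_pos hν hr)
      (volume_halfBall_ne_top _ _ _) fun y hy => ?_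
    rw [← ofReal_norm]
    refine ENNReal.ofReal_le_ofReal ?_
    have h3 := h1 ((Metric.mem_ball.1 hy.1).trans hrδ) hy.2
    have h4 : ‖a - b‖ ≤ ‖u y - a‖ + ‖u y - b‖ := by
      have : a - b = (u y - b) - (u y - a) := by abel
      rw [this]
      exact (norm_sub_le _ _).trans (by linarith)
    linarith
  have h3 := ge_of_tendsto ha h2
  rw [nonpos_iff_eq_zero, ENNReal.ofReal_eq_zero] at h3
  linarith

lemma HasApproxLimit.halfBall {u : E → F} {x ν : E} {a : F} (hν : ‖ν‖ = 1)
    (ha : HasApproxLimit u x a) :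
    Tendsto (fun r : ℝ => ⨍⁻ y in halfBall x ν r, ‖u y - a‖ₑ ∂volume) (𝓝[>] 0) (𝓝 0) := by
  have h1 : Tendsto (fun r : ℝ => 2 ^ (Module.finrank ℝ E) *
      ⨍⁻ y in Metric.ball x r, ‖u y - a‖ₑ ∂volume) (𝓝[>] 0) (𝓝 0) := by
    have := ENNReal.Tendsto.const_mul (a := 2 ^ (Module.finrank ℝ E)) ha
      (Or.inr (ENNReal.pow_ne_top (by simp)))
    rwa [mul_zero] at this
  refine tendsto_of_tendsto_of_tendsto_of_le_of_le' tendsto_const_nhds h1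
    (Eventually.of_forall fun _ => zero_le) ?_
  filter_upwards [self_mem_nhdsWithin] with r hr
  rw [setLAverage_eq, setLAverage_eq]
  refine ENNReal.div_le_of_le_mul ?_
  have hb0 : volume (Metric.ball x r) ≠ 0 := (Metric.measure_ball_pos volume x hr).ne'
  have hbt : volume (Metric.ball x r) ≠ ⊤ := measure_ball_lt_top.ne
  calc ∫⁻ y in FinDirGBD.halfBall x ν r, ‖u y - a‖ₑ
      ≤ ∫⁻ y in Metric.ball x r, ‖u y - a‖ₑ := lintegral_mono_set (halfBall_subset_ball _ _ _)
    _ = (∫⁻ y in Metric.ball x r, ‖u y - a‖ₑ) / volume (Metric.ball x r) *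
        volume (Metric.ball x r) := (ENNReal.div_mul_cancel hb0 hbt).symm
    _ ≤ (∫⁻ y in Metric.ball x r, ‖u y - a‖ₑ) / volume (Metric.ball x r) *
        (2 ^ (Module.finrank ℝ E) * volume (FinDirGBD.halfBall x ν r)) := by
          gcongr
          exact volume_ball_le_halfBall hν hr
    _ = _ := by ring

lemma notMem_jumpSet_of_continuousAt {Ω : Set E} {u : E → F} {x : E} (h : ContinuousAt u x) :
    x ∉ jumpSet Ω u := by
  rintro ⟨_, a, b, ν, hj⟩
  have h1 := eq_of_tendsto_halfBall hj.norm_eq_one (h.tendsto.mono_left nhdsWithin_le_nhds)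
    hj.tendsto_pos
  have h2 := eq_of_tendsto_halfBall (by rw [norm_neg, hj.norm_eq_one])
    (h.tendsto.mono_left nhdsWithin_le_nhds) hj.tendsto_neg
  exact hj.ne (h1.trans h2.symm)

/-- An approximate limit would also be the limit in mean on both half balls, hence equal to both `a`
and `b`. -/
lemma mem_discontinuitySet {Ω : Set E} {u : E → F} {x ν : E} {a b : F} (hx : x ∈ Ω)
    (hν : ‖ν‖ = 1) (hab : a ≠ b)
    (ha : Tendsto u (𝓝[{y | 0 < inner ℝ ν (y - x)}] x) (𝓝 a))
    (hb : Tendsto u (𝓝[{y | 0 < inner ℝ (-ν) (y - x)}] x) (𝓝 b)) :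
    x ∈ discontinuitySet Ω u := by
  refine ⟨hx, fun ⟨c, hc⟩ => hab ?_⟩
  have hν' : ‖-ν‖ = 1 := by rw [norm_neg, hν]
  rw [← eq_of_tendsto_halfBall hν ha (hc.halfBall hν), eq_of_tendsto_halfBall hν' hb
    (hc.halfBall hν')]

end ApproxLimits

/-! ### Multilinear interpolation on the grid -/

section Interpolation

variable {d : ℕ}

/-- The hat function. -/
def hat (t : ℝ) : ℝ := max 0 (1 - |t|)

lemma hat_nonneg (t : ℝ) : 0 ≤ hat t := le_max_left _ _

lemma hat_le_one (t : ℝ) : hat t ≤ 1 := max_le zero_le_one (by linarith [abs_nonneg t])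

lemma hat_eq_zero {t : ℝ} (h : 1 ≤ |t|) : hat t = 0 := max_eq_left (by linarith)

lemma hat_eq {t : ℝ} (h0 : 0 ≤ t) (h1 : t ≤ 1) : hat t = 1 - t := by
  rw [hat, abs_of_nonneg h0, max_eq_right (by linarith)]

lemma hat_sub_one {t : ℝ} (h0 : 0 ≤ t) (h1 : t ≤ 1) : hat (t - 1) = t := by
  rw [hat, abs_of_nonpos (by linarith), max_eq_right (by linarith)]; ring

lemma abs_hat_sub_le (s t : ℝ) : |hat s - hat t| ≤ |s - t| := by
  have h1 := abs_max_sub_max_le_abs (1 - |s|) (1 - |t|) 0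
  have h2 := abs_abs_sub_abs_le s t
  unfold hat
  rw [max_comm 0, max_comm 0]
  refine h1.trans (le_trans (le_of_eq ?_) h2)
  rw [← abs_neg]
  congr 1
  ring

lemma abs_prod_sub_prod_le {ι : Type*} (A : Finset ι) (a b : ι → ℝ) (ha : ∀ i, 0 ≤ a i ∧ a i ≤ 1)
    (hb : ∀ i, 0 ≤ b i ∧ b i ≤ 1) :
    |∏ i ∈ A, a i - ∏ i ∈ A, b i| ≤ ∑ i ∈ A, |a i - b i| := by
  classical
  induction A using Finset.induction_on with
  | empty => simp
  | insert j A hj ih =>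
    rw [Finset.prod_insert hj, Finset.prod_insert hj, Finset.sum_insert hj]
    have e : a j * ∏ i ∈ A, a i - b j * ∏ i ∈ A, b i =
      (a j - b j) * ∏ i ∈ A, a i + b j * (∏ i ∈ A, a i - ∏ i ∈ A, b i) := by ring
    have hp0 : 0 ≤ ∏ i ∈ A, a i := Finset.prod_nonneg fun i _ => (ha i).1
    have hp1 : ∏ i ∈ A, a i ≤ 1 := Finset.prod_le_one (fun i _ => (ha i).1) fun i _ => (ha i).2
    rw [e]
    refine (abs_add_le _ _).trans (add_le_add ?_ ?_)
    · rw [abs_mul, abs_of_nonneg hp0]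
      exact mul_le_of_le_one_right (abs_nonneg _) hp1
    · rw [abs_mul, abs_of_nonneg (hb j).1]
      exact (mul_le_of_le_one_left (abs_nonneg _) (hb j).2).trans ih

/-- The interpolation weight of the vertex `s` at the point with relative coordinates `c`. -/
def weight (c : Fin d → ℝ) (s : Finset (Fin d)) : ℝ := ∏ i, if i ∈ s then c i else 1 - c i

lemma weight_nonneg {c : Fin d → ℝ} (hc : ∀ i, c i ∈ Icc (0 : ℝ) 1) (s : Finset (Fin d)) :
    0 ≤ weight c s :=
  Finset.prod_nonneg fun i _ => by split_ifs; exacts [(hc i).1, by linarith [(hc i).2]]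

/-- Expansion of the product of the factors `c i + (1 - c i) = 1`. -/
lemma sum_weight (c : Fin d → ℝ) : ∑ s, weight c s = 1 := by
  have h := Finset.prod_add c (fun i => 1 - c i) Finset.univ
  simp only [add_sub_cancel, Finset.prod_const_one, Finset.powerset_univ] at h
  rw [h]
  refine Finset.sum_congr rfl fun s _ => ?_
  rw [weight, Finset.prod_ite]
  congr 1
  · congr 1; ext i; simp
  · congr 1; ext i; simp

/-- The lattice point `ε (y + n)`. -/
def latticePoint (e : OrthonormalBasis (Fin d) ℝ (EuclideanSpace ℝ (Fin d))) (ε : ℝ)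
    (y : Fin d → ℝ) (n : Fin d → ℤ) : EuclideanSpace ℝ (Fin d) :=
  ∑ i, (ε * (y i + n i)) • e i

/-- The coordinates of a vertex of the cube `k`. -/
def vertexIndex (k : Fin d → ℤ) (s : Finset (Fin d)) : Fin d → ℤ :=
  fun i => k i + if i ∈ s then 1 else 0

lemma gridVertex_eq (e : OrthonormalBasis (Fin d) ℝ (EuclideanSpace ℝ (Fin d))) (ε : ℝ)
    (y : Fin d → ℝ) (k : Fin d → ℤ) (s : Finset (Fin d)) :
    gridVertex e ε y k s = latticePoint e ε y (vertexIndex k s) := by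
  unfold gridVertex latticePoint vertexIndex
  refine Finset.sum_congr rfl fun i _ => ?_
  congr 2
  push_cast
  ring

lemma vertexIndex_injective (k : Fin d → ℤ) : Function.Injective (vertexIndex k) := by
  intro s t h
  ext i
  have := congrFun h i
  unfold vertexIndex at this
  by_cases h1 : i ∈ s <;> by_cases h2 : i ∈ t <;> simp_all

/-- The coordinates of `x` relative to the cube `k`, in units of `ε`. -/
def relCoord (e : OrthonormalBasis (Fin d) ℝ (EuclideanSpace ℝ (Fin d))) (ε : ℝ)
    (y : Fin d → ℝ) (k : Fin d → ℤ) (x : EuclideanSpace ℝ (Fin d)) (i : Fin d) : ℝ :=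
  inner ℝ (e i) x / ε - y i - k i

lemma multilinearInterp_eq (e : OrthonormalBasis (Fin d) ℝ (EuclideanSpace ℝ (Fin d))) (ε : ℝ)
    (y : Fin d → ℝ) (k : Fin d → ℤ)
    (u : EuclideanSpace ℝ (Fin d) → EuclideanSpace ℝ (Fin d)) (x : EuclideanSpace ℝ (Fin d)) :
    multilinearInterp e ε y k u x =
      ∑ s, weight (relCoord e ε y k x) s • u (gridVertex e ε y k s) := rfl

/-- The interpolation on the whole space of the values of `u` at finitely many lattice points. -/
def hatInterp (e : OrthonormalBasis (Fin d) ℝ (EuclideanSpace ℝ (Fin d))) (ε : ℝ)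
    (y : Fin d → ℝ) (N : Finset (Fin d → ℤ))
    (u : EuclideanSpace ℝ (Fin d) → EuclideanSpace ℝ (Fin d)) (x : EuclideanSpace ℝ (Fin d)) :
    EuclideanSpace ℝ (Fin d) :=
  ∑ n ∈ N, (∏ i, hat (relCoord e ε y n x i)) • u (latticePoint e ε y n)

/-- The closed grid cube. -/
def closedCube (e : OrthonormalBasis (Fin d) ℝ (EuclideanSpace ℝ (Fin d))) (ε : ℝ)
    (y : Fin d → ℝ) (k : Fin d → ℤ) : Set (EuclideanSpace ℝ (Fin d)) :=
  {x | ∀ i, inner ℝ (e i) x ∈ Icc (ε * (y i + k i)) (ε * (y i + k i + 1))}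

lemma relCoord_mem {e : OrthonormalBasis (Fin d) ℝ (EuclideanSpace ℝ (Fin d))} {ε : ℝ} (hε : 0 < ε)
    {y : Fin d → ℝ} {k : Fin d → ℤ} {x : EuclideanSpace ℝ (Fin d)} (hx : x ∈ closedCube e ε y k)
    (i : Fin d) : relCoord e ε y k x i ∈ Icc (0 : ℝ) 1 := by
  have h := hx i
  unfold relCoord
  have h1 : y i + k i ≤ inner ℝ (e i) x / ε := (le_div_iff₀ hε).2 (by linarith [h.1])
  have h2 : inner ℝ (e i) x / ε ≤ y i + k i + 1 := (div_le_iff₀ hε).2 (by linarith [h.2])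
  constructor <;> linarith

/-- On the closed cube, the product of hats centred at a lattice point that is not a vertex
vanishes, and at a vertex it is the multilinear weight. One formula on the whole space thus glues
the local interpolations, faces included, into a Lipschitz map. -/
lemma hatInterp_eq {e : OrthonormalBasis (Fin d) ℝ (EuclideanSpace ℝ (Fin d))} {ε : ℝ} (hε : 0 < ε)
    {y : Fin d → ℝ} {N : Finset (Fin d → ℤ)}
    (u : EuclideanSpace ℝ (Fin d) → EuclideanSpace ℝ (Fin d)) {k : Fin d → ℤ}
    (hN : ∀ s, vertexIndex k s ∈ N) {x : EuclideanSpace ℝ (Fin d)}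
    (hx : x ∈ closedCube e ε y k) :
    hatInterp e ε y N u x = multilinearInterp e ε y k u x := by
  classical
  have hc := relCoord_mem hε hx
  set c := relCoord e ε y k x with hcdef
  have hrel : ∀ n i, relCoord e ε y n x i = c i - ((n i - k i : ℤ) : ℝ) := by
    intro n i
    simp only [hcdef, relCoord]
    push_cast
    ring
  have hsub : Finset.univ.image (vertexIndex k) ⊆ N := by
    intro n hn
    obtain ⟨s, _, rfl⟩ := Finset.mem_image.1 hn
    exact hN s
  rw [hatInterp, ← Finset.sum_subset hsub]
  · rw [Finset.sum_image fun s _ t _ h => vertexIndex_injective k h, multilinearInterp_eq]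
    refine Finset.sum_congr rfl fun s _ => ?_
    rw [gridVertex_eq, weight]
    congr 1
    refine Finset.prod_congr rfl fun i _ => ?_
    rw [hrel]
    unfold vertexIndex
    split_ifs with hi
    · refine Eq.trans ?_ (hat_sub_one (hc i).1 (hc i).2)
      simp [hcdef]
    · refine Eq.trans ?_ (hat_eq (hc i).1 (hc i).2)
      simp [hcdef]
  · intro n _ hn
    -- A lattice point all of whose offsets from `k` are `0` or `1` is a vertex; any other offset
    -- puts the point at distance at least one from the support of a hat factor's interior.
    have : ∃ i, n i - k i ≠ 0 ∧ n i - k i ≠ 1 := by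
      by_contra! hcon
      refine hn (Finset.mem_image.2 ⟨Finset.univ.filter fun i => n i - k i ≠ 0, Finset.mem_univ _, ?_⟩)
      funext i
      unfold vertexIndex
      by_cases h0 : n i - k i = 0
      · simp [h0]; omega
      · have := hcon i h0
        simp [h0]; omega
    obtain ⟨i, h0, h1⟩ := this
    rw [Finset.prod_eq_zero (Finset.mem_univ i), zero_smul]
    rw [hrel]
    refine hat_eq_zero ?_
    have hi := hc i
    rcases lt_or_ge (n i - k i) 0 with h | h
    · have : ((n i - k i : ℤ) : ℝ) ≤ -1 := by exact_mod_cast (by omega : n i - k i ≤ -1)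
      rw [abs_of_nonneg (by linarith [hi.1])]
      linarith [hi.1]
    · have : (2 : ℝ) ≤ ((n i - k i : ℤ) : ℝ) := by exact_mod_cast (by omega : 2 ≤ n i - k i)
      rw [abs_of_nonpos (by linarith [hi.2])]
      linarith [hi.2]

lemma exists_lipschitz_hatInterp (e : OrthonormalBasis (Fin d) ℝ (EuclideanSpace ℝ (Fin d))) {ε : ℝ}
    (hε : 0 < ε) (y : Fin d → ℝ) (N : Finset (Fin d → ℤ))
    (u : EuclideanSpace ℝ (Fin d) → EuclideanSpace ℝ (Fin d)) :
    ∃ C, LipschitzWith C (hatInterp e ε y N u) := by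
  have h1 : ∀ n : Fin d → ℤ, ∀ x x', |(∏ i, hat (relCoord e ε y n x i)) -
      ∏ i, hat (relCoord e ε y n x' i)| ≤ (d / ε) * ‖x - x'‖ := by
    intro n x x'
    refine (abs_prod_sub_prod_le _ _ _ (fun i => ⟨hat_nonneg _, hat_le_one _⟩)
      fun i => ⟨hat_nonneg _, hat_le_one _⟩).trans ?_
    have : ∀ i ∈ (Finset.univ : Finset (Fin d)), |hat (relCoord e ε y n x i) -
        hat (relCoord e ε y n x' i)| ≤ ‖x - x'‖ / ε := by
      intro i _
      refine (abs_hat_sub_le _ _).trans ?_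
      have e1 : relCoord e ε y n x i - relCoord e ε y n x' i = inner ℝ (e i) (x - x') / ε := by
        unfold relCoord
        rw [inner_sub_right]
        ring
      rw [e1, abs_div, abs_of_pos hε]
      gcongr
      refine (abs_real_inner_le_norm _ _).trans ?_
      rw [e.norm_eq_one, one_mul]
    refine (Finset.sum_le_sum this).trans (le_of_eq ?_)
    simp
    ring
  set C : ℝ := ∑ n ∈ N, (d / ε) * ‖u (latticePoint e ε y n)‖ with hC
  have hC0 : 0 ≤ C := Finset.sum_nonneg fun n _ => by positivity
  refine ⟨⟨C, hC0⟩, LipschitzWith.of_dist_le_mul fun x x' => ?_⟩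
  rw [dist_eq_norm, dist_eq_norm, hatInterp, hatInterp, ← Finset.sum_sub_distrib]
  refine (norm_sum_le _ _).trans ?_
  change _ ≤ C * ‖x - x'‖
  rw [hC, Finset.sum_mul]
  refine Finset.sum_le_sum fun n _ => ?_
  rw [← sub_smul, norm_smul, Real.norm_eq_abs]
  calc _ ≤ ((d / ε) * ‖x - x'‖) * ‖u (latticePoint e ε y n)‖ := by
        gcongr
        exact h1 n x x'
    _ = _ := by ring

lemma norm_hatInterp_le (e : OrthonormalBasis (Fin d) ℝ (EuclideanSpace ℝ (Fin d))) (ε : ℝ)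
    (y : Fin d → ℝ) (N : Finset (Fin d → ℤ))
    (u : EuclideanSpace ℝ (Fin d) → EuclideanSpace ℝ (Fin d)) (x : EuclideanSpace ℝ (Fin d)) :
    ‖hatInterp e ε y N u x‖ ≤ ∑ n ∈ N, ‖u (latticePoint e ε y n)‖ := by
  refine (norm_sum_le _ _).trans (Finset.sum_le_sum fun n _ => ?_)
  rw [norm_smul, Real.norm_of_nonneg (Finset.prod_nonneg fun i _ => hat_nonneg _)]
  exact mul_le_of_le_one_left (norm_nonneg _)
    (Finset.prod_le_one (fun i _ => hat_nonneg _) fun i _ => hat_le_one _)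

end Interpolation

/-! ### Slopes and symmetrized gradient of the interpolation -/

section Interpolation

variable {d : ℕ}

lemma sum_finset_split {M : Type*} [AddCommMonoid M] (a : Fin d) (f : Finset (Fin d) → M) :
    ∑ s, f s = ∑ s ∈ Finset.univ.filter (fun s => a ∉ s), (f s + f (insert a s)) := by
  rw [← Finset.sum_filter_add_sum_filter_not Finset.univ (fun s => a ∉ s) f,
    Finset.sum_add_distrib]
  congr 1
  symm
  refine Finset.sum_bij' (fun s _ => insert a s) (fun s _ => s.erase a) ?_ ?_ ?_ ?_ ?_
  · intro s _; simp
  · intro s _; simp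
  · intro s hs; simp at hs; simp [hs]
  · intro s hs; simp at hs; simp [hs]
  · intro s _; rfl

lemma sum_finset_split_pair {M : Type*} [AddCommMonoid M] {a b : Fin d} (hab : a ≠ b)
    (f : Finset (Fin d) → M) :
    ∑ s ∈ Finset.univ.filter (fun s => a ∉ s), f s =
      ∑ s ∈ Finset.univ.filter (fun s => a ∉ s ∧ b ∉ s), (f s + f (insert b s)) := by
  rw [Finset.sum_filter, sum_finset_split b, Finset.sum_filter, Finset.sum_filter]
  refine Finset.sum_congr rfl fun s _ => ?_
  by_cases h1 : a ∈ s <;> by_cases h2 : b ∈ s <;> simp [h1, h2, hab]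

/-- The interpolation weight in the coordinates belonging to `A`. -/
def partialWeight (A : Finset (Fin d)) (c : Fin d → ℝ) (s : Finset (Fin d)) : ℝ :=
  ∏ i ∈ A, if i ∈ s then c i else 1 - c i

lemma partialWeight_mem {c : Fin d → ℝ} (hc : ∀ i, c i ∈ Icc (0 : ℝ) 1) (A s : Finset (Fin d)) :
    partialWeight A c s ∈ Icc (0 : ℝ) 1 := by
  have h : ∀ i, (0 : ℝ) ≤ (if i ∈ s then c i else 1 - c i) ∧
      (if i ∈ s then c i else 1 - c i) ≤ 1 := by
    intro i
    have := hc i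
    split_ifs
    · exact ⟨this.1, this.2⟩
    · exact ⟨by linarith [this.2], by linarith [this.1]⟩
  exact ⟨Finset.prod_nonneg fun i _ => (h i).1,
    Finset.prod_le_one (fun i _ => (h i).1) fun i _ => (h i).2⟩

lemma partialWeight_of_notMem {A : Finset (Fin d)} {a : Fin d} (ha : a ∈ A) (c : Fin d → ℝ)
    {s : Finset (Fin d)} (hs : a ∉ s) :
    partialWeight A c s = (1 - c a) * partialWeight (A.erase a) c s := by
  rw [partialWeight, ← Finset.mul_prod_erase A _ ha, if_neg hs, partialWeight]

lemma partialWeight_insert {A : Finset (Fin d)} {a : Fin d} (ha : a ∈ A) (c : Fin d → ℝ)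
    (s : Finset (Fin d)) :
    partialWeight A c (insert a s) = c a * partialWeight (A.erase a) c s := by
  rw [partialWeight, ← Finset.mul_prod_erase A _ ha, if_pos (Finset.mem_insert_self a s),
    partialWeight]
  congr 1
  refine Finset.prod_congr rfl fun i hi => ?_
  simp [Finset.ne_of_mem_erase hi]

lemma partialWeight_congr {A : Finset (Fin d)} {c c' : Fin d → ℝ} (h : ∀ i ∈ A, c i = c' i)
    (s : Finset (Fin d)) : partialWeight A c s = partialWeight A c' s :=
  Finset.prod_congr rfl fun i hi => by rw [h i hi]

/-- `ε` times the derivative of the interpolation in direction `e a`. -/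
def interpSlope (e : OrthonormalBasis (Fin d) ℝ (EuclideanSpace ℝ (Fin d))) (ε : ℝ)
    (y : Fin d → ℝ) (k : Fin d → ℤ)
    (u : EuclideanSpace ℝ (Fin d) → EuclideanSpace ℝ (Fin d)) (a : Fin d)
    (x : EuclideanSpace ℝ (Fin d)) : EuclideanSpace ℝ (Fin d) :=
  ∑ s ∈ Finset.univ.filter (fun s => a ∉ s),
    partialWeight (Finset.univ.erase a) (relCoord e ε y k x) s •
      (u (gridVertex e ε y k (insert a s)) - u (gridVertex e ε y k s))

variable (e : OrthonormalBasis (Fin d) ℝ (EuclideanSpace ℝ (Fin d))) (ε : ℝ)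
    (y : Fin d → ℝ) (k : Fin d → ℤ)
    (u : EuclideanSpace ℝ (Fin d) → EuclideanSpace ℝ (Fin d))

lemma multilinearInterp_split (a : Fin d) (x : EuclideanSpace ℝ (Fin d)) :
    multilinearInterp e ε y k u x =
      ∑ s ∈ Finset.univ.filter (fun s => a ∉ s),
        partialWeight (Finset.univ.erase a) (relCoord e ε y k x) s •
          ((1 - relCoord e ε y k x a) • u (gridVertex e ε y k s) +
            relCoord e ε y k x a • u (gridVertex e ε y k (insert a s))) := by
  rw [multilinearInterp_eq, sum_finset_split a]
  refine Finset.sum_congr rfl fun s hs => ?_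
  have h1 : weight (relCoord e ε y k x) s = _ :=
    partialWeight_of_notMem (Finset.mem_univ a) _ (Finset.mem_filter.1 hs).2
  have h2 : weight (relCoord e ε y k x) (insert a s) = _ :=
    partialWeight_insert (Finset.mem_univ a) _ s
  rw [h1, h2, smul_add, smul_smul, smul_smul]
  congr 2 <;> ring

/-- The interpolation is affine in each coordinate separately: the weights in `interpSlope` omit the
coordinate `a`. -/
lemma multilinearInterp_add_smul (a : Fin d) (x : EuclideanSpace ℝ (Fin d)) (h : ℝ) :
    multilinearInterp e ε y k u (x + h • e a) =
      multilinearInterp e ε y k u x + h • (ε⁻¹ • interpSlope e ε y k u a x) := by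
  have hrel : ∀ i, relCoord e ε y k (x + h • e a) i =
      relCoord e ε y k x i + if i = a then h * ε⁻¹ else 0 := by
    intro i
    unfold relCoord
    rw [inner_add_right, inner_smul_right, orthonormal_iff_ite.1 e.orthonormal]
    split_ifs <;> ring
  rw [multilinearInterp_split e ε y k u a, multilinearInterp_split e ε y k u a, interpSlope,
    Finset.smul_sum, Finset.smul_sum, ← Finset.sum_add_distrib]
  refine Finset.sum_congr rfl fun s _ => ?_
  rw [partialWeight_congr (c := relCoord e ε y k (x + h • e a)) (c' := relCoord e ε y k x)
    fun i hi => by rw [hrel, if_neg (Finset.ne_of_mem_erase hi), add_zero], hrel, if_pos rfl]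
  module

lemma contDiff_multilinearInterp : ContDiff ℝ (⊤ : ℕ∞) (multilinearInterp e ε y k u) := by
  unfold multilinearInterp
  refine ContDiff.sum fun s _ => ?_
  refine ContDiff.smul (f := fun x : EuclideanSpace ℝ (Fin d) => ∏ i, if i ∈ s
    then inner ℝ (e i) x / ε - y i - k i else 1 - (inner ℝ (e i) x / ε - y i - k i))
    (contDiff_prod fun i _ => ?_) contDiff_const
  have h : ContDiff ℝ (⊤ : ℕ∞) fun x : EuclideanSpace ℝ (Fin d) =>
      inner ℝ (e i) x / ε - y i - k i :=
    (((contDiff_const.inner ℝ contDiff_id).div_const ε).sub contDiff_const).sub contDiff_const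
  split_ifs
  · exact h
  · exact contDiff_const.sub h

lemma fderiv_multilinearInterp (a : Fin d) (x : EuclideanSpace ℝ (Fin d)) :
    fderiv ℝ (multilinearInterp e ε y k u) x (e a) = ε⁻¹ • interpSlope e ε y k u a x := by
  have hd : DifferentiableAt ℝ (multilinearInterp e ε y k u) x :=
    (contDiff_multilinearInterp e ε y k u).differentiable (by simp) x
  rw [← hd.lineDeriv_eq_fderiv]
  refine HasLineDerivAt.lineDeriv ?_
  unfold HasLineDerivAt
  have e1 : (fun t : ℝ => multilinearInterp e ε y k u (x + t • e a)) = fun t : ℝ =>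
      multilinearInterp e ε y k u x + t • (ε⁻¹ • interpSlope e ε y k u a x) := by
    funext t
    exact multilinearInterp_add_smul e ε y k u a x t
  rw [e1]
  have := ((hasDerivAt_id (0 : ℝ)).smul_const (ε⁻¹ • interpSlope e ε y k u a x)).const_add
    (multilinearInterp e ε y k u x)
  simpa using this

lemma gridVertex_insert {a : Fin d} {s : Finset (Fin d)} (hs : a ∉ s) :
    gridVertex e ε y k (insert a s) = gridVertex e ε y k s + ε • e a := by
  have : ε • e a = ∑ i, (if i = a then ε else 0) • e i := by
    simp
  rw [gridVertex, gridVertex, this, ← Finset.sum_add_distrib]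
  refine Finset.sum_congr rfl fun i _ => ?_
  rw [← add_smul]
  congr 1
  by_cases h : i = a
  · subst h; simp [hs]; ring
  · simp [h]

lemma mem_directions (a : Fin d) : e a ∈ directions e := by
  classical
  unfold directions
  exact Finset.mem_union_left _ (Finset.mem_image_of_mem _ (Finset.mem_univ a))

lemma add_mem_directions {a b : Fin d} (hab : a ≠ b) : e a + e b ∈ directions e := by
  classical
  unfold directions
  refine Finset.mem_union_right _ (Finset.mem_image.2 ?_)
  rcases lt_or_gt_of_ne hab with h | h
  · exact ⟨(a, b), by simp [h], rfl⟩
  · exact ⟨(b, a), by simp [h], add_comm _ _⟩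

variable {e ε y k u}

/-- The vertices are grouped into two-dimensional faces spanned by `e a`, `e b`. The increment of `e
b · u` along an edge in direction `e a` is not controlled alone, but the symmetric sum is: on each
face it combines one diagonal increment in direction `e a + e b` with four edge increments, each
bounded by `M`. This explains the `5`; `2 ^ d` bounds the number of faces. For `a = b` only edge
increments occur. -/
lemma abs_inner_interpSlope_le {M : ℝ}
    (hM : ∀ ξ ∈ directions e, ∀ s t, gridVertex e ε y k t = gridVertex e ε y k s + ε • ξ →
      |inner ℝ ξ (u (gridVertex e ε y k t) - u (gridVertex e ε y k s))| ≤ M)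
    {x : EuclideanSpace ℝ (Fin d)} (hc : ∀ i, relCoord e ε y k x i ∈ Icc (0 : ℝ) 1)
    (a b : Fin d) :
    |inner ℝ (e b) (interpSlope e ε y k u a x) + inner ℝ (e a) (interpSlope e ε y k u b x)| ≤
      2 ^ d * (5 * M) := by
  set c := relCoord e ε y k x with hcdef
  set v := fun s => u (gridVertex e ε y k s) with hv
  have hM0 : 0 ≤ M := (abs_nonneg _).trans
    (hM (e a) (mem_directions e a) ∅ (insert a ∅) (gridVertex_insert e ε y k (by simp)))
  have h1 : ∀ a s, a ∉ s → |inner ℝ (e a) (v (insert a s) - v s)| ≤ M := fun a s hs =>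
    hM (e a) (mem_directions e a) s (insert a s) (gridVertex_insert e ε y k hs)
  have hcard : ∀ p : Finset (Fin d) → Prop, [DecidablePred p] →
      (((Finset.univ.filter p).card : ℕ) : ℝ) ≤ 2 ^ d := by
    intro p _
    have := Finset.card_filter_le (Finset.univ : Finset (Finset (Fin d))) p
    rw [Finset.card_univ, Fintype.card_finset, Fintype.card_fin] at this
    exact_mod_cast this
  have hinner : ∀ a b, inner ℝ (e b) (interpSlope e ε y k u a x) =
      ∑ s ∈ Finset.univ.filter (fun s => a ∉ s), partialWeight (Finset.univ.erase a) c s *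
        inner ℝ (e b) (v (insert a s) - v s) := by
    intro a b
    rw [interpSlope, inner_sum]
    refine Finset.sum_congr rfl fun s _ => ?_
    rw [inner_smul_right]
  by_cases hab : a = b
  · subst hab
    have h2 : |inner ℝ (e a) (interpSlope e ε y k u a x)| ≤ 2 ^ d * M := by
      rw [hinner]
      refine (Finset.abs_sum_le_sum_abs _ _).trans ?_
      refine (Finset.sum_le_card_nsmul _ _ M fun s hs => ?_).trans ?_
      · have hw := partialWeight_mem hc (Finset.univ.erase a) s
        rw [abs_mul, abs_of_nonneg hw.1]
        exact (mul_le_of_le_one_left (abs_nonneg _) hw.2).trans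
          (h1 a s (Finset.mem_filter.1 hs).2)
      · rw [nsmul_eq_mul]
        exact mul_le_mul_of_nonneg_right (hcard _) hM0
    have h3 : (0 : ℝ) ≤ 2 ^ d * M := by positivity
    refine (abs_add_le _ _).trans ?_
    linarith
  · have hba : b ≠ a := fun h => hab h.symm
    rw [hinner, hinner, sum_finset_split_pair hab, sum_finset_split_pair hba]
    have e1 : (Finset.univ.filter fun s : Finset (Fin d) => b ∉ s ∧ a ∉ s) =
        Finset.univ.filter fun s : Finset (Fin d) => a ∉ s ∧ b ∉ s := by
      ext s; simp [and_comm]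
    rw [e1, ← Finset.sum_add_distrib]
    refine (Finset.abs_sum_le_sum_abs _ _).trans ?_
    refine (Finset.sum_le_card_nsmul _ _ (5 * M) fun s hs => ?_).trans ?_
    swap
    · rw [nsmul_eq_mul]
      exact mul_le_mul_of_nonneg_right (hcard _) (by positivity)
    obtain ⟨has, hbs⟩ := (Finset.mem_filter.1 hs).2
    set W := partialWeight ((Finset.univ.erase a).erase b) c s with hW
    have w1 : partialWeight (Finset.univ.erase a) c s = (1 - c b) * W :=
      partialWeight_of_notMem (by simp [hba]) c hbs
    have w2 : partialWeight (Finset.univ.erase a) c (insert b s) = c b * W :=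
      partialWeight_insert (by simp [hba]) c s
    have w3 : partialWeight (Finset.univ.erase b) c s = (1 - c a) * W := by
      rw [hW, Finset.erase_right_comm]
      exact partialWeight_of_notMem (by simp [hab]) c has
    have w4 : partialWeight (Finset.univ.erase b) c (insert a s) = c a * W := by
      rw [hW, Finset.erase_right_comm]
      exact partialWeight_insert (by simp [hab]) c s
    have hWm : W ∈ Icc (0 : ℝ) 1 := partialWeight_mem hc _ s
    have hcomm : insert b (insert a s) = insert a (insert b s) := Finset.insert_comm b a s
    rw [w1, w2, w3, w4, hcomm]
    have g0 : |inner ℝ (e a + e b) (v (insert a (insert b s)) - v s)| ≤ M := by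
      refine hM _ (add_mem_directions e hab) s _ ?_
      rw [gridVertex_insert e ε y k (by simp [hab, has]), gridVertex_insert e ε y k hbs, smul_add]
      abel
    have g1 := h1 a s has
    have g2 := h1 a (insert b s) (by simp [hab, has])
    have g3 := h1 b s hbs
    have g4 := h1 b (insert a s) (by simp [hba, hbs])
    rw [hcomm] at g4
    rw [inner_add_left] at g0
    simp only [inner_sub_right] at g0 g1 g2 g3 g4 ⊢
    -- The algebraic core: the diagonal increment minus weighted longitudinal edge increments, with
    -- coefficients in `[0, 1]`, leaves the weighted cross increments.
    have key : (1 - c b) * W * (inner ℝ (e b) (v (insert a s)) - inner ℝ (e b) (v s)) +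
          c b * W * (inner ℝ (e b) (v (insert a (insert b s))) - inner ℝ (e b) (v (insert b s))) +
          ((1 - c a) * W * (inner ℝ (e a) (v (insert b s)) - inner ℝ (e a) (v s)) +
          c a * W * (inner ℝ (e a) (v (insert a (insert b s))) - inner ℝ (e a) (v (insert a s)))) =
        W * ((inner ℝ (e a) (v (insert a (insert b s))) - inner ℝ (e a) (v s) +
          (inner ℝ (e b) (v (insert a (insert b s))) - inner ℝ (e b) (v s))) -
          c a * (inner ℝ (e a) (v (insert a s)) - inner ℝ (e a) (v s)) -
          (1 - c a) * (inner ℝ (e a) (v (insert a (insert b s))) -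
            inner ℝ (e a) (v (insert b s))) -
          c b * (inner ℝ (e b) (v (insert b s)) - inner ℝ (e b) (v s)) -
          (1 - c b) * (inner ℝ (e b) (v (insert a (insert b s))) -
            inner ℝ (e b) (v (insert a s)))) := by ring
    rw [key, abs_mul, abs_of_nonneg hWm.1]
    refine (mul_le_of_le_one_left (abs_nonneg _) hWm.2).trans ?_
    have hm : ∀ t z : ℝ, t ∈ Icc (0 : ℝ) 1 → |z| ≤ M → |t * z| ≤ M := by
      intro t z ht hz
      rw [abs_mul, abs_of_nonneg ht.1]
      exact (mul_le_of_le_one_left (abs_nonneg _) ht.2).trans hz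
    have hc' : ∀ i, 1 - c i ∈ Icc (0 : ℝ) 1 := fun i =>
      ⟨by linarith [(hc i).2], by linarith [(hc i).1]⟩
    have k1 := abs_le.1 g0
    have k2 := abs_le.1 (hm _ _ (hc a) g1)
    have k3 := abs_le.1 (hm _ _ (hc' a) g2)
    have k4 := abs_le.1 (hm _ _ (hc b) g3)
    have k5 := abs_le.1 (hm _ _ (hc' b) g4)
    rw [abs_le]
    constructor <;> linarith [k1.1, k1.2, k2.1, k2.2, k3.1, k3.2, k4.1, k4.2, k5.1, k5.2]

/-- Bound for the entries of the symmetrized gradient of the interpolation in the standard basis. -/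
lemma abs_symGrad_interp_le (hε : 0 < ε) {M : ℝ}
    (hM : ∀ ξ ∈ directions e, ∀ s t, gridVertex e ε y k t = gridVertex e ε y k s + ε • ξ →
      |inner ℝ ξ (u (gridVertex e ε y k t) - u (gridVertex e ε y k s))| ≤ M)
    {x : EuclideanSpace ℝ (Fin d)} (hx : x ∈ closedCube e ε y k) (i j : Fin d) :
    |(fderiv ℝ (multilinearInterp e ε y k u) x (EuclideanSpace.single j 1) i +
      fderiv ℝ (multilinearInterp e ε y k u) x (EuclideanSpace.single i 1) j) / 2| ≤
      d ^ 2 * (2 ^ d * (5 * M)) / ε := by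
  set P := fderiv ℝ (multilinearInterp e ε y k u) x with hP
  set m := fun a b => inner ℝ (e b) (interpSlope e ε y k u a x) with hm
  have hcoord : ∀ (z : EuclideanSpace ℝ (Fin d)) (i : Fin d), z i =
      ∑ b, inner ℝ (e b) z * e b i := by
    intro z i
    conv_lhs => rw [← e.sum_repr' z]
    simp
  have hsingle : ∀ b j, inner ℝ (e b) (EuclideanSpace.single j (1 : ℝ)) = e b j := by
    intro b j
    rw [EuclideanSpace.inner_single_right]
    simp
  -- Change of basis from the standard basis, in which `gradEntry` is defined, to `e`.
  -- Symmetrization commutes with it, and the `d ^ 2` coefficients have modulus at most one.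
  have hent : ∀ i j, P (EuclideanSpace.single j 1) i = ε⁻¹ * ∑ a, ∑ b, e a j * e b i * m a b := by
    intro i j
    have h1 : P (EuclideanSpace.single j 1) = ∑ a, e a j • (ε⁻¹ • interpSlope e ε y k u a x) := by
      conv_lhs => rw [← e.sum_repr' (EuclideanSpace.single j (1 : ℝ))]
      rw [map_sum]
      refine Finset.sum_congr rfl fun a _ => ?_
      rw [map_smul, fderiv_multilinearInterp, hsingle]
    rw [hcoord, h1, Finset.sum_comm, Finset.mul_sum]
    refine Finset.sum_congr rfl fun b _ => ?_
    rw [inner_sum, Finset.sum_mul, Finset.mul_sum]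
    refine Finset.sum_congr rfl fun a _ => ?_
    rw [inner_smul_right, inner_smul_right]
    ring
  have hle1 : ∀ b i, |e b i| ≤ 1 := by
    intro b i
    rw [← hsingle]
    refine (abs_real_inner_le_norm _ _).trans ?_
    simp
  have hM0 : 0 ≤ 2 ^ d * (5 * M) :=
    (abs_nonneg _).trans (abs_inner_interpSlope_le hM (relCoord_mem hε hx) i i)
  have hsum : (P (EuclideanSpace.single j 1) i + P (EuclideanSpace.single i 1) j) / 2 =
      ε⁻¹ * ∑ a, ∑ b, e a j * e b i * ((m a b + m b a) / 2) := by
    rw [hent i j, hent j i, Finset.sum_comm (f := fun a b => e a i * e b j * m a b), ← mul_add,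
      ← Finset.sum_add_distrib, mul_div_assoc, Finset.sum_div]
    congr 1
    refine Finset.sum_congr rfl fun a _ => ?_
    rw [← Finset.sum_add_distrib, Finset.sum_div]
    refine Finset.sum_congr rfl fun b _ => ?_
    ring
  rw [hsum, abs_mul, abs_of_pos (inv_pos.2 hε), div_eq_inv_mul]
  refine mul_le_mul_of_nonneg_left ?_ (inv_pos.2 hε).le
  refine (Finset.abs_sum_le_sum_abs _ _).trans ?_
  refine (Finset.sum_le_card_nsmul _ _ (d * (2 ^ d * (5 * M))) fun a _ => ?_).trans ?_
  · refine (Finset.abs_sum_le_sum_abs _ _).trans ?_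
    refine (Finset.sum_le_card_nsmul _ _ (2 ^ d * (5 * M)) fun b _ => ?_).trans ?_
    · rw [abs_mul, abs_mul, abs_div]
      have h2 := abs_inner_interpSlope_le hM (relCoord_mem hε hx) a b
      have h3 : |e a j| * |e b i| ≤ 1 := mul_le_one₀ (hle1 _ _) (abs_nonneg _) (hle1 _ _)
      refine (mul_le_of_le_one_left (by positivity) h3).trans ?_
      rw [abs_of_pos (by norm_num : (0 : ℝ) < 2)]
      have : |m a b + m b a| ≤ 2 ^ d * (5 * M) := h2
      linarith
    · simp
  · simp
    apply le_of_eq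
    ring

end Interpolation

/-! ### Coordinates with respect to an orthonormal basis -/

section Coordinates

variable {d : ℕ} (e : OrthonormalBasis (Fin d) ℝ (EuclideanSpace ℝ (Fin d)))

/-- The point with coordinates `c` in the basis `e`. -/
def fromCoords (c : Fin d → ℝ) : EuclideanSpace ℝ (Fin d) := ∑ i, c i • e i

lemma inner_fromCoords (c : Fin d → ℝ) (j : Fin d) : inner ℝ (e j) (fromCoords e c) = c j := by
  unfold fromCoords
  rw [inner_sum]
  simp_rw [inner_smul_right, orthonormal_iff_ite.1 e.orthonormal]
  simp

lemma fromCoords_inner (x : EuclideanSpace ℝ (Fin d)) :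
    fromCoords e (fun i => inner ℝ (e i) x) = x := e.sum_repr' x

lemma fromCoords_add (c c' : Fin d → ℝ) :
    fromCoords e (c + c') = fromCoords e c + fromCoords e c' := by
  simp [fromCoords, add_smul, Finset.sum_add_distrib]

lemma fromCoords_smul (r : ℝ) (c : Fin d → ℝ) : fromCoords e (r • c) = r • fromCoords e c := by
  simp [fromCoords, smul_smul, Finset.smul_sum]

lemma continuous_fromCoords : Continuous (fromCoords e) := by
  unfold fromCoords
  fun_prop

lemma injective_fromCoords : Function.Injective (fromCoords e) := by
  intro c c' h
  funext j
  rw [← inner_fromCoords e c, h, inner_fromCoords]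

lemma measurableEmbedding_fromCoords : MeasurableEmbedding (fromCoords e) :=
  (continuous_fromCoords e).measurableEmbedding (injective_fromCoords e)

lemma fromCoords_eq (c : Fin d → ℝ) : fromCoords e c = e.repr.symm (WithLp.toLp 2 c) := by
  rw [← e.sum_repr_symm]
  rfl

lemma measurePreserving_fromCoords : MeasurePreserving (fromCoords e) volume volume := by
  have := e.measurePreserving_repr_symm.comp (PiLp.volume_preserving_toLp (Fin d))
  have h : fromCoords e = e.repr.symm ∘ WithLp.toLp 2 := funext fun c => fromCoords_eq e c
  rw [h]
  exact this

lemma preimage_gridCube (ε : ℝ) (y : Fin d → ℝ) (k : Fin d → ℤ) :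
    fromCoords e ⁻¹' gridCube e ε y k =
      univ.pi fun i => Ico (ε * (y i + k i)) (ε * (y i + k i + 1)) := by
  ext c
  simp only [gridCube, mem_preimage, mem_ofPred_eq, inner_fromCoords, mem_univ_pi]

lemma measurableSet_gridCube (ε : ℝ) (y : Fin d → ℝ) (k : Fin d → ℤ) :
    MeasurableSet (gridCube e ε y k) := by
  have : gridCube e ε y k = ⋂ i, (fun x => inner ℝ (e i) x) ⁻¹'
      Ico (ε * (y i + k i)) (ε * (y i + k i + 1)) := by
    ext x; simp [gridCube]
  rw [this]
  exact MeasurableSet.iInter fun i => (by fun_prop : Measurable fun x => inner ℝ (e i) x)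
    measurableSet_Ico

lemma volume_gridCube (ε : ℝ) (y : Fin d → ℝ) (k : Fin d → ℤ) :
    volume (gridCube e ε y k) = ENNReal.ofReal ε ^ d := by
  rw [← (measurePreserving_fromCoords e).measure_preimage_emb (measurableEmbedding_fromCoords e),
    preimage_gridCube, Real.volume_pi_Ico]
  have : ∀ i : Fin d, ε * (y i + k i + 1) - ε * (y i + k i) = ε := fun i => by ring
  simp [this]

lemma gridCube_subset_closedCube (ε : ℝ) (y : Fin d → ℝ) (k : Fin d → ℤ) :
    gridCube e ε y k ⊆ closedCube e ε y k := fun _ hx i => Ico_subset_Icc_self (hx i)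

lemma isClosed_closedCube (ε : ℝ) (y : Fin d → ℝ) (k : Fin d → ℤ) :
    IsClosed (closedCube e ε y k) := by
  have : closedCube e ε y k = ⋂ i, (fun x => inner ℝ (e i) x) ⁻¹'
      Icc (ε * (y i + k i)) (ε * (y i + k i + 1)) := by
    ext x; simp [closedCube]
  rw [this]
  exact isClosed_iInter fun i => isClosed_Icc.preimage (by fun_prop)

lemma closure_gridCube {ε : ℝ} (hε : 0 < ε) (y : Fin d → ℝ) (k : Fin d → ℤ) :
    closure (gridCube e ε y k) = closedCube e ε y k := by
  refine (closure_minimal (gridCube_subset_closedCube e ε y k)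
    (isClosed_closedCube e ε y k)).antisymm ?_
  intro x hx
  have h1 : closure (univ.pi fun i => Ico (ε * (y i + k i)) (ε * (y i + k i + 1))) =
      univ.pi fun i => Icc (ε * (y i + k i)) (ε * (y i + k i + 1)) := by
    rw [closure_pi_set]
    congr 1
    funext i
    exact closure_Ico (by nlinarith)
  have h2 : (fun i => inner ℝ (e i) x) ∈
      closure (univ.pi fun i => Ico (ε * (y i + k i)) (ε * (y i + k i + 1))) := by
    rw [h1]
    exact fun i _ => hx i
  rw [← fromCoords_inner e x]
  refine map_mem_closure (continuous_fromCoords e) h2 fun c hc => ?_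
  rw [← preimage_gridCube] at hc
  exact hc

/-- The open grid cube. -/
def openCube (ε : ℝ) (y : Fin d → ℝ) (k : Fin d → ℤ) : Set (EuclideanSpace ℝ (Fin d)) :=
  {x | ∀ i, inner ℝ (e i) x ∈ Ioo (ε * (y i + k i)) (ε * (y i + k i + 1))}

lemma isOpen_openCube (ε : ℝ) (y : Fin d → ℝ) (k : Fin d → ℤ) : IsOpen (openCube e ε y k) := by
  have : openCube e ε y k = ⋂ i, (fun x => inner ℝ (e i) x) ⁻¹'
      Ioo (ε * (y i + k i)) (ε * (y i + k i + 1)) := by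
    ext x; simp [openCube]
  rw [this]
  exact isOpen_iInter_of_finite fun i => isOpen_Ioo.preimage (by fun_prop)

lemma openCube_subset_gridCube (ε : ℝ) (y : Fin d → ℝ) (k : Fin d → ℤ) :
    openCube e ε y k ⊆ gridCube e ε y k := fun _ hx i => Ioo_subset_Ico_self (hx i)

lemma volume_hyperplane (i : Fin d) (c : ℝ) :
    volume {x : EuclideanSpace ℝ (Fin d) | inner ℝ (e i) x = c} = 0 := by
  rw [← (measurePreserving_fromCoords e).measure_preimage_emb (measurableEmbedding_fromCoords e)]
  have : fromCoords e ⁻¹' {x | inner ℝ (e i) x = c} = {x : Fin d → ℝ | x i = c} := by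
    ext x; simp [inner_fromCoords]
  rw [this]
  exact Measure.pi_hyperplane (α := fun _ : Fin d => ℝ) (fun _ => volume) i c

lemma ae_mem_openCube (ε : ℝ) (y : Fin d → ℝ) (k : Fin d → ℤ) :
    ∀ᵐ x : EuclideanSpace ℝ (Fin d), x ∈ gridCube e ε y k → x ∈ openCube e ε y k := by
  have : ∀ᵐ x : EuclideanSpace ℝ (Fin d), ∀ i, inner ℝ (e i) x ≠ ε * (y i + k i) := by
    rw [ae_all_iff]
    intro i
    rw [ae_iff]
    simpa using volume_hyperplane e i (ε * (y i + k i))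
  filter_upwards [this] with x hx hxk i
  exact ⟨lt_of_le_of_ne (hxk i).1 (hx i).symm, (hxk i).2⟩

lemma disjoint_gridCube {ε : ℝ} (hε : 0 < ε) (y : Fin d → ℝ) {k l : Fin d → ℤ} (hkl : k ≠ l) :
    Disjoint (gridCube e ε y k) (gridCube e ε y l) := by
  rw [disjoint_left]
  intro x hk hl
  refine hkl (funext fun i => ?_)
  have h1 := hk i
  have h2 := hl i
  have a1 := lt_of_mul_lt_mul_left (h1.1.trans_lt h2.2) hε.le
  have a2 := lt_of_mul_lt_mul_left (h2.1.trans_lt h1.2) hε.le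
  have b1 : (k i : ℝ) < l i + 1 := by linarith
  have b2 : (l i : ℝ) < k i + 1 := by linarith
  have c1 : k i < l i + 1 := by exact_mod_cast b1
  have c2 : l i < k i + 1 := by exact_mod_cast b2
  omega

lemma exists_mem_gridCube {ε : ℝ} (hε : 0 < ε) (y : Fin d → ℝ) (x : EuclideanSpace ℝ (Fin d)) :
    ∃ k, x ∈ gridCube e ε y k := by
  refine ⟨fun i => ⌊inner ℝ (e i) x / ε - y i⌋, fun i => ?_⟩
  have h1 := Int.floor_le (inner ℝ (e i) x / ε - y i)
  have h2 := Int.lt_floor_add_one (inner ℝ (e i) x / ε - y i)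
  have h3 : ε * (inner ℝ (e i) x / ε) = inner ℝ (e i) x := by field_simp
  constructor
  · nlinarith
  · nlinarith

end Coordinates

/-! ### Faces and the divergence theorem on a cube -/

section Faces

variable {n : ℕ} (e : OrthonormalBasis (Fin (n + 1)) ℝ (EuclideanSpace ℝ (Fin (n + 1))))

/-- The surface measure on the lower face of the cube `k` in direction `a`. -/
def faceMeasure (ε : ℝ) (y : Fin (n + 1) → ℝ) (a : Fin (n + 1)) (k : Fin (n + 1) → ℤ) :
    Measure (EuclideanSpace ℝ (Fin (n + 1))) :=
  ((volume : Measure (Fin n → ℝ)).restrict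
    (Icc (fun j => ε * (y (a.succAbove j) + k (a.succAbove j)))
      fun j => ε * (y (a.succAbove j) + k (a.succAbove j) + 1))).map
    fun z => fromCoords e (a.insertNth (α := fun _ => ℝ) (ε * (y a + k a)) z)

lemma continuous_faceMap (a : Fin (n + 1)) (c : ℝ) :
    Continuous fun z : Fin n → ℝ => fromCoords e (a.insertNth (α := fun _ => ℝ) c z) :=
  (continuous_fromCoords e).comp
    (Continuous.finInsertNth (A := fun _ => ℝ) a continuous_const continuous_id)

instance isFiniteMeasure_faceMeasure (ε : ℝ) (y : Fin (n + 1) → ℝ) (a : Fin (n + 1))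
    (k : Fin (n + 1) → ℤ) : IsFiniteMeasure (faceMeasure e ε y a k) := by
  unfold faceMeasure
  have : IsFiniteMeasure ((volume : Measure (Fin n → ℝ)).restrict
    (Icc (fun j => ε * (y (a.succAbove j) + k (a.succAbove j)))
      fun j => ε * (y (a.succAbove j) + k (a.succAbove j) + 1))) :=
    ⟨by simpa using isCompact_Icc.measure_lt_top⟩
  infer_instance

/-- The relative interior of the lower face of the cube `k` in direction `a`. -/
def openFace (ε : ℝ) (y : Fin (n + 1) → ℝ) (a : Fin (n + 1)) (k : Fin (n + 1) → ℤ) :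
    Set (EuclideanSpace ℝ (Fin (n + 1))) :=
  {x | inner ℝ (e a) x = ε * (y a + k a) ∧
    ∀ j, j ≠ a → inner ℝ (e j) x ∈ Ioo (ε * (y j + k j)) (ε * (y j + k j + 1))}

lemma measurableSet_openFace (ε : ℝ) (y : Fin (n + 1) → ℝ) (a : Fin (n + 1))
    (k : Fin (n + 1) → ℤ) : MeasurableSet (openFace e ε y a k) := by
  have : openFace e ε y a k = (fun x => inner ℝ (e a) x) ⁻¹' {ε * (y a + k a)} ∩
      ⋂ j, ⋂ (_ : j ≠ a), (fun x => inner ℝ (e j) x) ⁻¹'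
        Ioo (ε * (y j + k j)) (ε * (y j + k j + 1)) := by
    ext x; simp [openFace]
  rw [this]
  refine MeasurableSet.inter ((by fun_prop : Measurable fun x => inner ℝ (e a) x)
    (measurableSet_singleton _)) ?_
  exact MeasurableSet.iInter fun j => MeasurableSet.iInter fun _ =>
    (by fun_prop : Measurable fun x => inner ℝ (e j) x) measurableSet_Ioo

lemma ae_mem_openFace (ε : ℝ) (y : Fin (n + 1) → ℝ) (a : Fin (n + 1)) (k : Fin (n + 1) → ℤ) :
    ∀ᵐ x ∂faceMeasure e ε y a k, x ∈ openFace e ε y a k := by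
  unfold faceMeasure
  refine (ae_map_iff (p := fun x => x ∈ openFace e ε y a k)
    (continuous_faceMap e a _).aemeasurable (measurableSet_openFace e ε y a k)).2 ?_
  have h1 := Measure.univ_pi_Ioo_ae_eq_Icc (μ := fun _ : Fin n => (volume : Measure ℝ))
    (f := fun j => ε * (y (a.succAbove j) + k (a.succAbove j)))
    (g := fun j => ε * (y (a.succAbove j) + k (a.succAbove j) + 1))
  rw [volume_pi, ← Measure.restrict_congr_set h1]
  rw [ae_restrict_iff' (MeasurableSet.univ_pi fun _ => measurableSet_Ioo)]
  refine Eventually.of_forall fun z hz => ?_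
  refine ⟨?_, fun j hj => ?_⟩
  · rw [inner_fromCoords]; simp
  · obtain ⟨i, rfl⟩ := Fin.exists_succAbove_eq hj
    rw [inner_fromCoords]
    simpa using hz i (mem_univ i)

/-- The divergence theorem for the field with components `(e a · v) G` in the coordinates of `e`,
whose divergence is the derivative of `G` along `v`. The upper face of `k` in direction `a` is
indexed as the lower face of the next cube. -/
lemma setIntegral_fderiv_gridCube {ε : ℝ} (hε : 0 < ε) (y : Fin (n + 1) → ℝ)
    (k : Fin (n + 1) → ℤ) {G : EuclideanSpace ℝ (Fin (n + 1)) → ℝ} (hG : ContDiff ℝ 1 G)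
    (v : EuclideanSpace ℝ (Fin (n + 1))) :
    ∫ x in gridCube e ε y k, fderiv ℝ G x v =
      ∑ a, inner ℝ (e a) v * ((∫ x, G x ∂faceMeasure e ε y a (k + Pi.single a 1)) -
        ∫ x, G x ∂faceMeasure e ε y a k) := by
  set lo : Fin (n + 1) → ℝ := fun i => ε * (y i + k i) with hlo
  set hi : Fin (n + 1) → ℝ := fun i => ε * (y i + k i + 1) with hhi
  rw [← (measurePreserving_fromCoords e).setIntegral_preimage_emb
    (measurableEmbedding_fromCoords e), preimage_gridCube, volume_pi,
    setIntegral_congr_set Measure.univ_pi_Ico_ae_eq_Icc, ← volume_pi]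
  set T : (Fin (n + 1) → ℝ) →L[ℝ] EuclideanSpace ℝ (Fin (n + 1)) :=
    LinearMap.toContinuousLinearMap
      { toFun := fromCoords e, map_add' := fromCoords_add e, map_smul' := fromCoords_smul e } with hT
  have hTa : ∀ c, T c = fromCoords e c := fun c => rfl
  have hTs : ∀ a, T (Pi.single a 1) = e a := by
    intro a
    rw [hTa, fromCoords, Finset.sum_eq_single a]
    · simp
    · intro b _ hb; simp [hb]
    · simp
  have hcont : Continuous fun x => fderiv ℝ G x := hG.continuous_fderiv one_ne_zero
  have hsum : ∀ c, ∑ a, (inner ℝ (e a) v • (fderiv ℝ G (fromCoords e c)).comp T) (Pi.single a 1) =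
      fderiv ℝ G (fromCoords e c) v := by
    intro c
    conv_rhs => rw [← e.sum_repr' v]
    rw [map_sum]
    refine Finset.sum_congr rfl fun a _ => ?_
    rw [map_smul]
    simp [hTs]
  have key := integral_divergence_of_hasFDerivAt_off_countable' lo hi
    (fun i => by simp only [hlo, hhi]; nlinarith)
    (fun a c => inner ℝ (e a) v • G (fromCoords e c))
    (fun a c => inner ℝ (e a) v • (fderiv ℝ G (fromCoords e c)).comp T) ∅ countable_empty
    (fun a => (continuous_const.mul
      (hG.continuous.comp (continuous_fromCoords e))).continuousOn)
    (fun c _ a => by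
      have h1 : HasFDerivAt G (fderiv ℝ G (fromCoords e c)) (T c) :=
        (hG.differentiable one_ne_zero _).hasFDerivAt
      exact (h1.comp c T.hasFDerivAt).const_smul (inner ℝ (e a) v))
    (by
      simp_rw [hsum]
      refine ContinuousOn.integrableOn_compact isCompact_Icc (Continuous.continuousOn ?_)
      exact (hcont.comp (continuous_fromCoords e)).clm_apply continuous_const)
  simp_rw [hsum] at key
  refine key.trans (Finset.sum_congr rfl fun a _ => ?_)
  have e1 : ∫ x, G x ∂faceMeasure e ε y a k =
      ∫ z in Icc (lo ∘ a.succAbove) (hi ∘ a.succAbove),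
        G (fromCoords e (a.insertNth (α := fun _ => ℝ) (lo a) z)) := by
    unfold faceMeasure
    rw [integral_map (continuous_faceMap e a _).aemeasurable
      hG.continuous.aestronglyMeasurable]
    rfl
  have e2 : ∫ x, G x ∂faceMeasure e ε y a (k + Pi.single a 1) =
      ∫ z in Icc (lo ∘ a.succAbove) (hi ∘ a.succAbove),
        G (fromCoords e (a.insertNth (α := fun _ => ℝ) (hi a) z)) := by
    unfold faceMeasure
    rw [integral_map (continuous_faceMap e a _).aemeasurable
      hG.continuous.aestronglyMeasurable]
    have h1 : ∀ j, (k + Pi.single a 1 : Fin (n + 1) → ℤ) (a.succAbove j) = k (a.succAbove j) := by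
      intro j; simp
    have h2 : ε * (y a + ((k + Pi.single a 1 : Fin (n + 1) → ℤ) a : ℤ)) = hi a := by
      simp only [hhi, Pi.add_apply, Pi.single_eq_same]
      push_cast
      ring
    simp_rw [h1, h2]
    rfl
  rw [e1, e2, mul_sub, ← integral_const_mul, ← integral_const_mul]
  rfl

end Faces

/-! ### The derivative of a Lipschitz function set to zero on finitely many cubes -/

section CutDerivative

variable {n : ℕ} (e : OrthonormalBasis (Fin (n + 1)) ℝ (EuclideanSpace ℝ (Fin (n + 1)))) (ε : ℝ)
  (y : Fin (n + 1) → ℝ) (bad : Finset (Fin (n + 1) → ℤ))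

/-- The union of the cubes in `bad`. -/
def cubeUnion : Set (EuclideanSpace ℝ (Fin (n + 1))) := ⋃ k ∈ bad, gridCube e ε y k

lemma measurableSet_cubeUnion : MeasurableSet (cubeUnion e ε y bad) :=
  bad.measurableSet_biUnion fun k _ => measurableSet_gridCube e ε y k

/-- The sign of the jump of the complement of the cubes in `bad` across the lower face of the cube
`k` in direction `a`. -/
def faceCoeff (a : Fin (n + 1)) (k : Fin (n + 1) → ℤ) : ℝ :=
  (if k - Pi.single a 1 ∈ bad then 1 else 0) - if k ∈ bad then 1 else 0

/-- The cubes whose lower face in direction `a` is a face of a cube in `bad`. -/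
def faceIndices (a : Fin (n + 1)) : Finset (Fin (n + 1) → ℤ) :=
  bad ∪ bad.image (· + Pi.single a 1)

/-- Summation by parts over the faces: a face shared by two bad cubes occurs with opposite signs and
cancels, so jumps remain only between a bad cube and one that is not. -/
lemma sum_faceCoeff (a : Fin (n + 1)) (m : (Fin (n + 1) → ℤ) → ℝ) :
    ∑ k ∈ faceIndices bad a, faceCoeff bad a k * m k =
      ∑ k ∈ bad, (m (k + Pi.single a 1) - m k) := by
  simp only [faceCoeff, sub_mul, ite_mul, one_mul, zero_mul, Finset.sum_sub_distrib]
  rw [← Finset.sum_filter, ← Finset.sum_filter]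
  have e1 : (faceIndices bad a).filter (fun k => k ∈ bad) = bad := by
    ext k; simp [faceIndices]
  have e2 : (faceIndices bad a).filter (fun k => k - Pi.single a 1 ∈ bad) =
      bad.image (· + Pi.single a 1) := by
    ext k
    simp only [faceIndices, Finset.mem_filter, Finset.mem_union, Finset.mem_image]
    constructor
    · rintro ⟨_, h⟩
      exact ⟨_, h, by simp⟩
    · rintro ⟨l, hl, rfl⟩
      exact ⟨Or.inr ⟨l, hl, rfl⟩, by simpa using hl⟩
  rw [e1, e2, Finset.sum_image fun k _ l _ h => by simpa using h]

variable (Ω : Set (EuclideanSpace ℝ (Fin (n + 1)))) (w : EuclideanSpace ℝ (Fin (n + 1)) → ℝ)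
  (v : EuclideanSpace ℝ (Fin (n + 1)))

/-- The jump part of the derivative. -/
def cutJumpPart : SignedMeasure (EuclideanSpace ℝ (Fin (n + 1))) :=
  ∑ a, ∑ k ∈ faceIndices bad a, ((faceMeasure e ε y a k).restrict Ω).withDensityᵥ
    fun x => inner ℝ (e a) v * (faceCoeff bad a k * w x)

/-- The density of the absolutely continuous part of the derivative. -/
def cutDensity : EuclideanSpace ℝ (Fin (n + 1)) → ℝ :=
  (Ω \ cubeUnion e ε y bad).indicator fun x => lineDeriv ℝ w x v

variable {e ε y bad Ω w}

lemma integrable_faceDensity (hw : Continuous w) {M : ℝ} (hM : ∀ x, |w x| ≤ M)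
    (a : Fin (n + 1)) (k : Fin (n + 1) → ℤ) :
    Integrable (fun x => inner ℝ (e a) v * (faceCoeff bad a k * w x))
      ((faceMeasure e ε y a k).restrict Ω) :=
  ((integrable_of_measurable_of_le hw.measurable hM).const_mul _).const_mul _

lemma abs_cutDensity_le {C : NNReal} (hw : LipschitzWith C w)
    (x : EuclideanSpace ℝ (Fin (n + 1))) : |cutDensity e ε y bad Ω w v x| ≤ C * ‖v‖ := by
  unfold cutDensity
  by_cases hx : x ∈ Ω \ cubeUnion e ε y bad
  · rw [indicator_of_mem hx]
    exact norm_lineDeriv_le_of_lipschitz ℝ hw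
  · rw [indicator_of_notMem hx, abs_zero]
    positivity

lemma measurable_cutDensity (hΩ : IsOpen Ω) (hw : Continuous w) :
    Measurable (cutDensity e ε y bad Ω w v) :=
  (measurable_lineDeriv hw).indicator (hΩ.measurableSet.diff (measurableSet_cubeUnion e ε y bad))

lemma integrable_cutDensity (hΩ : IsOpen Ω) (hΩv : volume Ω ≠ ⊤) {C : NNReal}
    (hw : LipschitzWith C w) : Integrable (cutDensity e ε y bad Ω w v) := by
  have h : IntegrableOn (fun _ => (C : ℝ) * ‖v‖) Ω :=
    integrableOn_const hΩv
  refine ((integrable_indicator_iff hΩ.measurableSet).2 h).mono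
    (measurable_cutDensity v hΩ hw.continuous).aestronglyMeasurable (Eventually.of_forall fun x => ?_)
  by_cases hx : x ∈ Ω
  · rw [indicator_of_mem hx, Real.norm_eq_abs, Real.norm_of_nonneg (by positivity)]
    exact abs_cutDensity_le v hw x
  · have : x ∉ Ω \ cubeUnion e ε y bad := fun h => hx h.1
    rw [cutDensity, indicator_of_notMem this]
    simp

lemma totalVariation_cutJumpPart {A : Set (EuclideanSpace ℝ (Fin (n + 1)))} (hA : MeasurableSet A)
    (hw : Continuous w) {M : ℝ} (hM : ∀ x, |w x| ≤ M)
    (h : ∀ a, ∀ k ∈ faceIndices bad a, ∀ᵐ x ∂(faceMeasure e ε y a k).restrict Ω,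
      x ∈ A → faceCoeff bad a k * w x = 0) :
    (cutJumpPart e ε y bad Ω w v).totalVariation A = 0 := by
  refine totalVariation_sum_eq_zero _ _ hA fun a _ => totalVariation_sum_eq_zero _ _ hA fun k hk => ?_
  refine totalVariation_withDensity_eq_zero (integrable_faceDensity v hw hM a k) hA ?_
  filter_upwards [h a k hk] with x hx hxA
  rw [hx hxA, mul_zero]

/-- The jump part lives on finitely many hyperplanes, which are Lebesgue null. -/
lemma cutJumpPart_mutuallySingular (hw : Continuous w) {M : ℝ} (hM : ∀ x, |w x| ≤ M) :
    cutJumpPart e ε y bad Ω w v ⟂ᵥ (volume : Measure _).toENNRealVectorMeasure := by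
  set H : Set (EuclideanSpace ℝ (Fin (n + 1))) :=
    ⋃ a, ⋃ k ∈ faceIndices bad a, {x | inner ℝ (e a) x = ε * (y a + k a)} with hH
  have hHm : MeasurableSet H := MeasurableSet.iUnion fun a =>
    Finset.measurableSet_biUnion _ fun k _ =>
      (by fun_prop : Measurable fun x => inner ℝ (e a) x) (measurableSet_singleton _)
  have hH0 : volume H = 0 := by
    simp only [hH, measure_iUnion_null_iff]
    intro a k _
    exact volume_hyperplane e a _
  have hT : (cutJumpPart e ε y bad Ω w v).totalVariation Hᶜ = 0 := by
    refine totalVariation_cutJumpPart v hHm.compl hw hM fun a k hk => ?_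
    filter_upwards [ae_restrict_of_ae (ae_mem_openFace e ε y a k)] with x hx hxH
    refine absurd ?_ hxH
    exact mem_iUnion.2 ⟨a, mem_iUnion₂.2 ⟨k, hk, hx.1⟩⟩
  refine VectorMeasure.MutuallySingular.mk Hᶜ hHm.compl (fun t ht _ => ?_) fun t ht htm => ?_
  · exact SignedMeasure.null_of_totalVariation_zero _ (measure_mono_null ht hT)
  · rw [Measure.toENNRealVectorMeasure_apply_measurable htm]
    exact measure_mono_null (by rwa [compl_compl] at ht) hH0

lemma lineDeriv_eq_of_openCube {k : Fin (n + 1) → ℤ} {p : EuclideanSpace ℝ (Fin (n + 1)) → ℝ}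
    (hp : ContDiff ℝ 1 p) (hpw : ∀ x ∈ closedCube e ε y k, w x = p x)
    {x : EuclideanSpace ℝ (Fin (n + 1))} (hx : x ∈ openCube e ε y k) :
    lineDeriv ℝ w x v = fderiv ℝ p x v := by
  have h : w =ᶠ[𝓝 x] p := by
    filter_upwards [(isOpen_openCube e ε y k).mem_nhds hx] with z hz
    exact hpw z (gridCube_subset_closedCube e ε y k (openCube_subset_gridCube e ε y k hz))
  rw [h.lineDeriv_eq, (hp.differentiable one_ne_zero x).lineDeriv_eq_fderiv]

lemma openFace_subset_closedCube (hε : 0 < ε) (a : Fin (n + 1)) (k : Fin (n + 1) → ℤ) :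
    openFace e ε y a k ⊆ closedCube e ε y k := by
  rintro x ⟨h1, h2⟩ i
  by_cases hi : i = a
  · subst hi
    rw [h1]
    exact ⟨le_rfl, by nlinarith⟩
  · exact Ioo_subset_Icc_self (h2 i hi)

lemma openFace_succ_subset_closedCube (hε : 0 < ε) (a : Fin (n + 1)) (k : Fin (n + 1) → ℤ) :
    openFace e ε y a (k + Pi.single a 1) ⊆ closedCube e ε y k := by
  rintro x ⟨h1, h2⟩ i
  by_cases hi : i = a
  · subst hi
    rw [h1]
    simp only [Pi.add_apply, Pi.single_eq_same]
    push_cast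
    constructor <;> nlinarith
  · have := h2 i hi
    simp only [Pi.add_apply, Pi.single_eq_of_ne hi, add_zero] at this
    exact Ioo_subset_Icc_self this

/-- Integration by parts on one cube. The divergence theorem is applied to the `C¹` product `p φ`,
where `p` represents `w` on the closed cube and in particular on its faces. -/
lemma setIntegral_cube_mul_fderiv (hε : 0 < ε) {k : Fin (n + 1) → ℤ}
    {p : EuclideanSpace ℝ (Fin (n + 1)) → ℝ} (hp : ContDiff ℝ 1 p)
    (hpw : ∀ x ∈ closedCube e ε y k, w x = p x)
    {φ : EuclideanSpace ℝ (Fin (n + 1)) → ℝ} (hφ : ContDiff ℝ 1 φ) (hφc : HasCompactSupport φ) :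
    ∫ x in gridCube e ε y k, w x * fderiv ℝ φ x v =
      (∑ a, inner ℝ (e a) v * ((∫ x, w x * φ x ∂faceMeasure e ε y a (k + Pi.single a 1)) -
        ∫ x, w x * φ x ∂faceMeasure e ε y a k)) -
      ∫ x in gridCube e ε y k, lineDeriv ℝ w x v * φ x := by
  have hdiv := setIntegral_fderiv_gridCube e hε y k (hp.mul hφ) v
  have f1 : ∀ a, ∫ x, (p * φ) x ∂faceMeasure e ε y a k =
      ∫ x, w x * φ x ∂faceMeasure e ε y a k := by
    intro a
    refine integral_congr_ae ?_
    filter_upwards [ae_mem_openFace e ε y a k] with x hx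
    rw [Pi.mul_apply, hpw x (openFace_subset_closedCube hε a k hx)]
  have f2 : ∀ a, ∫ x, (p * φ) x ∂faceMeasure e ε y a (k + Pi.single a 1) =
      ∫ x, w x * φ x ∂faceMeasure e ε y a (k + Pi.single a 1) := by
    intro a
    refine integral_congr_ae ?_
    filter_upwards [ae_mem_openFace e ε y a (k + Pi.single a 1)] with x hx
    rw [Pi.mul_apply, hpw x (openFace_succ_subset_closedCube hε a k hx)]
  have hpf : (fun x => p x * φ x) = p * φ := rfl
  simp only [hpf, f1, f2] at hdiv
  have hφd : Continuous fun x => fderiv ℝ φ x v :=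
    (hφ.continuous_fderiv one_ne_zero).clm_apply continuous_const
  have hpd : Continuous fun x => fderiv ℝ p x v :=
    (hp.continuous_fderiv one_ne_zero).clm_apply continuous_const
  have hφdc : HasCompactSupport fun x => fderiv ℝ φ x v := hφc.fderiv_apply (𝕜 := ℝ) v
  have i1 : Integrable fun x => p x * fderiv ℝ φ x v :=
    (hp.continuous.mul hφd).integrable_of_hasCompactSupport hφdc.mul_left
  have i2 : Integrable fun x => fderiv ℝ p x v * φ x :=
    (hpd.mul hφ.continuous).integrable_of_hasCompactSupport hφc.mul_left
  have g1 : ∫ x in gridCube e ε y k, w x * fderiv ℝ φ x v =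
      ∫ x in gridCube e ε y k, p x * fderiv ℝ φ x v :=
    setIntegral_congr_fun (measurableSet_gridCube e ε y k) fun x hx => by
      simp only [hpw x (gridCube_subset_closedCube e ε y k hx)]
  have g2 : ∫ x in gridCube e ε y k, lineDeriv ℝ w x v * φ x =
      ∫ x in gridCube e ε y k, fderiv ℝ p x v * φ x := by
    refine setIntegral_congr_ae (measurableSet_gridCube e ε y k) ?_
    filter_upwards [ae_mem_openCube e ε y k] with x hx hxk
    rw [lineDeriv_eq_of_openCube v hp hpw (hx hxk)]
  rw [← hdiv, g1, g2, ← integral_sub ?_ i2.integrableOn]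
  · refine integral_congr_ae (Eventually.of_forall fun x => ?_)
    simp only
    rw [fderiv_mul (hp.differentiable one_ne_zero x) (hφ.differentiable one_ne_zero x)]
    simp only [add_apply, smul_apply, smul_eq_mul]
    ring
  · have : (fun x => fderiv ℝ (p * φ) x v) =
        fun x => p x * fderiv ℝ φ x v + fderiv ℝ p x v * φ x := by
      funext x
      rw [fderiv_mul (hp.differentiable one_ne_zero x) (hφ.differentiable one_ne_zero x)]
      simp only [add_apply, smul_apply, smul_eq_mul]
      ring
    rw [this]
    exact (i1.add i2).integrableOn

end CutDerivative

/-! ### Integration by parts and Lebesgue decomposition for the cut function -/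

section CutDerivative

variable {n : ℕ} {e : OrthonormalBasis (Fin (n + 1)) ℝ (EuclideanSpace ℝ (Fin (n + 1)))} {ε : ℝ}
  {y : Fin (n + 1) → ℝ} {bad : Finset (Fin (n + 1) → ℤ)}
  {Ω : Set (EuclideanSpace ℝ (Fin (n + 1)))} {w : EuclideanSpace ℝ (Fin (n + 1)) → ℝ}
  (v : EuclideanSpace ℝ (Fin (n + 1)))

lemma setIntegral_cubeUnion (hε : 0 < ε) {g : EuclideanSpace ℝ (Fin (n + 1)) → ℝ}
    (hg : Integrable g) :
    ∫ x in cubeUnion e ε y bad, g x = ∑ k ∈ bad, ∫ x in gridCube e ε y k, g x :=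
  integral_biUnion_finset bad (fun k _ => measurableSet_gridCube e ε y k)
    (fun _ _ _ _ hkl => disjoint_gridCube e hε y hkl) fun _ _ => hg.integrableOn

lemma integral_mul_fderiv_eq {C : NNReal} (hw : LipschitzWith C w)
    {φ : EuclideanSpace ℝ (Fin (n + 1)) → ℝ} (hφ : ContDiff ℝ 1 φ) (hφc : HasCompactSupport φ) :
    ∫ x, w x * fderiv ℝ φ x v = -∫ x, lineDeriv ℝ w x v * φ x := by
  obtain ⟨D, hD⟩ := hφ.lipschitzWith_of_hasCompactSupport hφc one_ne_zero
  rw [hw.integral_lineDeriv_mul_eq hD hφc, ← integral_neg]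
  refine integral_congr_ae (Eventually.of_forall fun x => ?_)
  simp only
  rw [(hφ.differentiable one_ne_zero x).lineDeriv_eq_fderiv, map_neg]
  ring

/-- Integration by parts for the Lipschitz function `w` on the whole space has no boundary term;
subtracting the formula on each bad cube leaves exactly the surface terms on the faces. Smoothness
of `w` up to the boundary is therefore needed on the bad cubes only. -/
lemma isDistribDeriv_cut (hε : 0 < ε) (hΩ : IsOpen Ω) (hΩv : volume Ω ≠ ⊤) {C : NNReal}
    (hw : LipschitzWith C w) {M : ℝ} (hM : ∀ x, |w x| ≤ M)
    {p : (Fin (n + 1) → ℤ) → EuclideanSpace ℝ (Fin (n + 1)) → ℝ}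
    (hp : ∀ k ∈ bad, ContDiff ℝ 1 (p k)) (hpw : ∀ k ∈ bad, ∀ x ∈ closedCube e ε y k, w x = p k x) :
    IsDistribDeriv Ω ((cubeUnion e ε y bad)ᶜ.indicator w) v
      (cutJumpPart e ε y bad Ω w v +
        (volume : Measure _).withDensityᵥ (cutDensity e ε y bad Ω w v)) := by
  have hcd := integrable_cutDensity (e := e) (ε := ε) (y := y) (bad := bad) v hΩ hΩv hw
  have hBm := measurableSet_cubeUnion e ε y bad
  constructor
  · refine totalVariation_add_eq_zero hΩ.measurableSet.compl
      (totalVariation_cutJumpPart v hΩ.measurableSet.compl hw.continuous hM fun a k _ => ?_)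
      (totalVariation_withDensity_eq_zero hcd hΩ.measurableSet.compl
        (Eventually.of_forall fun x hx => ?_))
    · filter_upwards [ae_restrict_mem hΩ.measurableSet] with x hx hx'
      exact absurd hx hx'
    · exact indicator_of_notMem (fun h => hx h.1) _
  · intro φ hφ hφc hφΩ
    have hφ1 : ContDiff ℝ 1 φ := hφ.of_le (by exact_mod_cast le_top)
    obtain ⟨K, hK⟩ := bounded_of_hasCompactSupport hφ.continuous hφc
    have hφm := hφ.continuous.measurable
    have hφd : Continuous fun x => fderiv ℝ φ x v :=
      (hφ1.continuous_fderiv one_ne_zero).clm_apply continuous_const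
    have hφdc : HasCompactSupport fun x => fderiv ℝ φ x v := hφc.fderiv_apply (𝕜 := ℝ) v
    have i1 : Integrable fun x => w x * fderiv ℝ φ x v :=
      (hw.continuous.mul hφd).integrable_of_hasCompactSupport hφdc.mul_left
    have i2 : Integrable fun x => lineDeriv ℝ w x v * φ x :=
      (hφ.continuous.integrable_of_hasCompactSupport hφc).bdd_mul (c := C * ‖v‖)
        (measurable_lineDeriv hw.continuous).aestronglyMeasurable
        (Eventually.of_forall fun x => norm_lineDeriv_le_of_lipschitz ℝ hw)
    have hφ0 : ∀ x ∉ Ω, φ x = 0 := fun x hx => image_eq_zero_of_notMem_tsupport fun h => hx (hφΩ h)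
    have hφd0 : ∀ x ∉ Ω, fderiv ℝ φ x = 0 := fun x hx =>
      image_eq_zero_of_notMem_tsupport fun h => hx (hφΩ (tsupport_fderiv_subset ℝ h))
    have l1 : ∫ x in Ω, (cubeUnion e ε y bad)ᶜ.indicator w x * fderiv ℝ φ x v =
        ∫ x in (cubeUnion e ε y bad)ᶜ, w x * fderiv ℝ φ x v := by
      rw [setIntegral_eq_integral_of_forall_compl_eq_zero, ← integral_indicator hBm.compl]
      · refine integral_congr_ae (Eventually.of_forall fun x => ?_)
        simp only [indicator]
        split_ifs <;> simp
      · intro x hx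
        rw [hφd0 x hx]
        simp
    have l2 : ∫ x in (cubeUnion e ε y bad)ᶜ, w x * fderiv ℝ φ x v =
        -(∫ x in (cubeUnion e ε y bad)ᶜ, lineDeriv ℝ w x v * φ x) -
        ∑ a, inner ℝ (e a) v * ∑ k ∈ faceIndices bad a,
          faceCoeff bad a k * ∫ x, w x * φ x ∂faceMeasure e ε y a k := by
      have t1 := integral_add_compl hBm i1
      have t2 := integral_add_compl hBm i2
      have t3 : ∫ x in cubeUnion e ε y bad, w x * fderiv ℝ φ x v =
          (∑ a, inner ℝ (e a) v * ∑ k ∈ faceIndices bad a,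
            faceCoeff bad a k * ∫ x, w x * φ x ∂faceMeasure e ε y a k) -
          ∫ x in cubeUnion e ε y bad, lineDeriv ℝ w x v * φ x := by
        rw [setIntegral_cubeUnion hε i1, setIntegral_cubeUnion hε i2,
          Finset.sum_congr rfl fun k hk =>
            setIntegral_cube_mul_fderiv v hε (hp k hk) (hpw k hk) hφ1 hφc,
          Finset.sum_sub_distrib, Finset.sum_comm]
        congr 1
        refine Finset.sum_congr rfl fun a _ => ?_
        rw [sum_faceCoeff bad a fun k => ∫ x, w x * φ x ∂faceMeasure e ε y a k, Finset.mul_sum]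
      have t4 := integral_mul_fderiv_eq v hw hφ1 hφc
      linarith
    have r1 : pairing (cutJumpPart e ε y bad Ω w v) φ =
        ∑ a, inner ℝ (e a) v * ∑ k ∈ faceIndices bad a,
          faceCoeff bad a k * ∫ x, w x * φ x ∂faceMeasure e ε y a k := by
      unfold cutJumpPart
      rw [pairing_sum _ _ hφm hK]
      refine Finset.sum_congr rfl fun a _ => ?_
      rw [pairing_sum _ _ hφm hK, Finset.mul_sum]
      refine Finset.sum_congr rfl fun k _ => ?_
      rw [pairing_withDensity (integrable_faceDensity v hw.continuous hM a k) hφm hK,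
        setIntegral_eq_integral_of_forall_compl_eq_zero, ← integral_const_mul, ← integral_const_mul]
      · refine integral_congr_ae (Eventually.of_forall fun x => ?_)
        simp only
        ring
      · intro x hx
        rw [hφ0 x hx, zero_mul]
    have r2 : pairing ((volume : Measure _).withDensityᵥ (cutDensity e ε y bad Ω w v)) φ =
        ∫ x in (cubeUnion e ε y bad)ᶜ, lineDeriv ℝ w x v * φ x := by
      rw [pairing_withDensity hcd hφm hK, ← integral_indicator hBm.compl]
      refine integral_congr_ae (Eventually.of_forall fun x => ?_)
      simp only [cutDensity]
      by_cases hxB : x ∈ cubeUnion e ε y bad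
      · have h1 : x ∉ Ω \ cubeUnion e ε y bad := fun h => h.2 hxB
        have h2 : x ∉ (cubeUnion e ε y bad)ᶜ := fun h => h hxB
        rw [indicator_of_notMem h1, indicator_of_notMem h2, mul_zero]
      · rw [indicator_of_mem (mem_compl hxB)]
        by_cases hx : x ∈ Ω
        · rw [indicator_of_mem (show x ∈ Ω \ cubeUnion e ε y bad from ⟨hx, hxB⟩), mul_comm]
        · rw [hφ0 x hx, zero_mul, mul_zero]
    change _ = -pairing _ φ
    rw [pairing_add _ _ hφm hK, r1, r2, l1, l2]
    ring

section Decomposition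

variable (hε : 0 < ε) (hΩ : IsOpen Ω) (hΩv : volume Ω ≠ ⊤) {C : NNReal}
    (hw : LipschitzWith C w) {M : ℝ} (hM : ∀ x, |w x| ≤ M)
    {p : (Fin (n + 1) → ℤ) → EuclideanSpace ℝ (Fin (n + 1)) → ℝ}
    (hp : ∀ k ∈ bad, ContDiff ℝ 1 (p k)) (hpw : ∀ k ∈ bad, ∀ x ∈ closedCube e ε y k, w x = p k x)
include hε hΩ hΩv hw hM hp hpw

/-- The explicit derivative is a singular measure plus one with integrable density, so uniqueness of
the Lebesgue decomposition identifies the parts. -/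
lemma acDensity_cut : acDensity Ω ((cubeUnion e ε y bad)ᶜ.indicator w) v =ᵐ[volume]
    cutDensity e ε y bad Ω w v := by
  rw [acDensity, distribDeriv_eq hΩ (isDistribDeriv_cut v hε hΩ hΩv hw hM hp hpw)]
  exact (SignedMeasure.eq_rnDeriv _ _ (integrable_cutDensity v hΩ hΩv hw)
    (cutJumpPart_mutuallySingular v hw.continuous hM) rfl).symm

lemma singPart_cut : singPart Ω ((cubeUnion e ε y bad)ᶜ.indicator w) v =
    cutJumpPart e ε y bad Ω w v := by
  rw [singPart, distribDeriv_eq hΩ (isDistribDeriv_cut v hε hΩ hΩv hw hM hp hpw)]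
  exact (SignedMeasure.eq_singularPart _ _
    (cutJumpPart_mutuallySingular v hw.continuous hM) rfl).symm

end Decomposition

end CutDerivative

/-! ### Hausdorff measure of the boundary of a union of cubes -/

section Faces

variable {n : ℕ} (e : OrthonormalBasis (Fin (n + 1)) ℝ (EuclideanSpace ℝ (Fin (n + 1))))

/-- The closed lower face in direction `a` of the cube `k`. -/
def closedFace (ε : ℝ) (y : Fin (n + 1) → ℝ) (a : Fin (n + 1)) (k : Fin (n + 1) → ℤ) :
    Set (EuclideanSpace ℝ (Fin (n + 1))) :=
  {x | inner ℝ (e a) x = ε * (y a + k a) ∧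
    ∀ j, j ≠ a → inner ℝ (e j) x ∈ Icc (ε * (y j + k j)) (ε * (y j + k j + 1))}

lemma isometry_faceMap (a : Fin (n + 1)) (c : ℝ) :
    Isometry fun z : EuclideanSpace ℝ (Fin n) =>
      fromCoords e (a.insertNth (α := fun _ => ℝ) c z.ofLp) := by
  refine Isometry.of_dist_eq fun z z' => ?_
  rw [fromCoords_eq, fromCoords_eq, LinearIsometryEquiv.dist_map, EuclideanSpace.dist_eq,
    EuclideanSpace.dist_eq, Fin.sum_univ_succAbove _ a]
  simp

/-- A face is covered by the isometric image of an `n`-dimensional cube of side `ε`, on which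
`μHE[n]` is Lebesgue measure. -/
lemma hausdorff_closedFace_le (ε : ℝ) (y : Fin (n + 1) → ℝ) (a : Fin (n + 1))
    (k : Fin (n + 1) → ℤ) : μHE[n] (closedFace e ε y a k) ≤ ENNReal.ofReal ε ^ n := by
  set R : Set (EuclideanSpace ℝ (Fin n)) := WithLp.ofLp ⁻¹'
    Icc (fun j => ε * (y (a.succAbove j) + k (a.succAbove j)))
      fun j => ε * (y (a.succAbove j) + k (a.succAbove j) + 1) with hR
  have hsub : closedFace e ε y a k ⊆ (fun z : EuclideanSpace ℝ (Fin n) =>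
      fromCoords e (a.insertNth (α := fun _ => ℝ) (ε * (y a + k a)) z.ofLp)) '' R := by
    rintro x ⟨h1, h2⟩
    refine ⟨WithLp.toLp 2 fun j => inner ℝ (e (a.succAbove j)) x, ?_, ?_⟩
    · refine ⟨fun j => (h2 _ (Fin.succAbove_ne a j)).1, fun j => (h2 _ (Fin.succAbove_ne a j)).2⟩
    · simp only
      rw [← h1]
      conv_rhs => rw [← fromCoords_inner e x]
      congr 1
      exact Fin.insertNth_self_removeNth a (fun i => inner ℝ (e i) x)
  refine (measure_mono hsub).trans ?_
  rw [(isometry_faceMap e a _).euclideanHausdorffMeasure_image,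
    EuclideanSpace.euclideanHausdorffMeasure_eq_volume, hR,
    (PiLp.volume_preserving_ofLp (Fin n)).measure_preimage
      measurableSet_Icc.nullMeasurableSet, Real.volume_Icc_pi]
  have : ∀ j : Fin n, ε * (y (a.succAbove j) + k (a.succAbove j) + 1) -
      ε * (y (a.succAbove j) + k (a.succAbove j)) = ε := fun j => by ring
  simp [this]

lemma frontier_gridCube_subset {ε : ℝ} (hε : 0 < ε) (y : Fin (n + 1) → ℝ) (k : Fin (n + 1) → ℤ) :
    frontier (gridCube e ε y k) ⊆
      ⋃ a, closedFace e ε y a k ∪ closedFace e ε y a (k + Pi.single a 1) := by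
  intro x hx
  have h1 : x ∈ closedCube e ε y k := closure_gridCube e hε y k ▸ hx.1
  have h2 : x ∉ openCube e ε y k := fun h => hx.2
    (interior_maximal (openCube_subset_gridCube e ε y k) (isOpen_openCube e ε y k) h)
  simp only [openCube, mem_ofPred_eq, not_forall] at h2
  obtain ⟨a, ha⟩ := h2
  refine mem_iUnion.2 ⟨a, ?_⟩
  by_cases hlo : inner ℝ (e a) x = ε * (y a + k a)
  · exact Or.inl ⟨hlo, fun j _ => h1 j⟩
  · have hhi : inner ℝ (e a) x = ε * (y a + k a + 1) := by
      by_contra hhi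
      exact ha ⟨lt_of_le_of_ne (h1 a).1 (Ne.symm hlo), lt_of_le_of_ne (h1 a).2 hhi⟩
    refine Or.inr ⟨?_, fun j hj => ?_⟩
    · rw [hhi]; simp only [Pi.add_apply, Pi.single_eq_same]; push_cast; ring
    · simpa [Pi.single_eq_of_ne hj] using h1 j

lemma frontier_finset_biUnion_subset {X ι : Type*} [TopologicalSpace X] (S : Finset ι)
    (A : ι → Set X) : frontier (⋃ i ∈ S, A i) ⊆ ⋃ i ∈ S, frontier (A i) := by
  intro x hx
  rw [frontier, Finset.closure_biUnion] at hx
  obtain ⟨i, hi, hxi⟩ := mem_iUnion₂.1 hx.1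
  exact mem_iUnion₂.2 ⟨i, hi, hxi, fun h => hx.2
    (interior_mono (subset_biUnion_of_mem (u := A) hi) h)⟩

lemma hausdorff_frontier_cubeUnion_le {ε : ℝ} (hε : 0 < ε) (y : Fin (n + 1) → ℝ)
    (bad : Finset (Fin (n + 1) → ℤ)) :
    μHE[n] (frontier (cubeUnion e ε y bad)) ≤
      bad.card * (2 * (n + 1) * ENNReal.ofReal ε ^ n) := by
  have h1 : ∀ k, μHE[n] (frontier (gridCube e ε y k)) ≤ 2 * (n + 1) * ENNReal.ofReal ε ^ n := by
    intro k
    refine (measure_mono (frontier_gridCube_subset e hε y k)).trans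
      ((measure_iUnion_fintype_le _ _).trans ?_)
    calc ∑ a, μHE[n] (closedFace e ε y a k ∪ closedFace e ε y a (k + Pi.single a 1))
        ≤ ∑ _a : Fin (n + 1), 2 * ENNReal.ofReal ε ^ n := by
          refine Finset.sum_le_sum fun a _ => (measure_union_le _ _).trans ?_
          rw [two_mul]
          exact add_le_add (hausdorff_closedFace_le e ε y a k) (hausdorff_closedFace_le e ε y a _)
      _ = _ := by
          simp only [Finset.sum_const, Finset.card_univ, Fintype.card_fin, nsmul_eq_mul]
          push_cast
          ring
  refine (measure_mono (frontier_finset_biUnion_subset bad _)).trans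
    ((measure_biUnion_finset_le _ _).trans ((Finset.sum_le_sum fun k _ => h1 k).trans ?_))
  simp

lemma essentialBoundary_subset_frontier {E : Type*} [NormedAddCommGroup E] [InnerProductSpace ℝ E]
    [FiniteDimensional ℝ E] [MeasurableSpace E] [BorelSpace E] (A : Set E) :
    essentialBoundary A ⊆ frontier A := by
  intro x hx
  by_contra hxf
  rw [← mem_compl_iff, compl_frontier_eq_union_interior] at hxf
  rcases hxf with hxi | hxi
  · refine hx.2 (tendsto_const_nhds.congr' ?_)
    obtain ⟨r, hr, hrA⟩ := Metric.isOpen_iff.1 isOpen_interior x hxi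
    filter_upwards [Ioo_mem_nhdsGT hr] with s hs
    have : A ∩ Metric.ball x s = Metric.ball x s := inter_eq_right.2
      ((Metric.ball_subset_ball hs.2.le).trans (hrA.trans interior_subset))
    rw [this, ENNReal.div_self (Metric.measure_ball_pos volume x hs.1).ne' measure_ball_lt_top.ne]
  · refine hx.1 (tendsto_const_nhds.congr' ?_)
    obtain ⟨r, hr, hrA⟩ := Metric.isOpen_iff.1 isOpen_interior x hxi
    filter_upwards [Ioo_mem_nhdsGT hr] with s hs
    have : A ∩ Metric.ball x s = ∅ := by
      rw [inter_comm, ← disjoint_iff_inter_eq_empty, ← subset_compl_iff_disjoint_right]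
      exact (Metric.ball_subset_ball hs.2.le).trans (hrA.trans interior_subset)
    rw [this, measure_empty, ENNReal.zero_div]

end Faces

/-! ### A Lipschitz map set to zero on finitely many cubes is in `SBV^∞` -/

section Cut

variable {n : ℕ} {e : OrthonormalBasis (Fin (n + 1)) ℝ (EuclideanSpace ℝ (Fin (n + 1)))} {ε : ℝ}
  {y : Fin (n + 1) → ℝ} {bad : Finset (Fin (n + 1) → ℤ)}
  {Ω : Set (EuclideanSpace ℝ (Fin (n + 1)))}
  {w : EuclideanSpace ℝ (Fin (n + 1)) → EuclideanSpace ℝ (Fin (n + 1))}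

lemma indicator_coord (B : Set (EuclideanSpace ℝ (Fin (n + 1)))) (i : Fin (n + 1)) :
    (fun x => B.indicator w x i) = B.indicator fun x => w x i := by
  funext x
  by_cases hx : x ∈ B
  · rw [indicator_of_mem hx, indicator_of_mem hx]
  · rw [indicator_of_notMem hx, indicator_of_notMem hx]; rfl

/-- Near a relatively interior point of a face, the two sides of its hyperplane lie in the two
adjacent cubes. The one-sided limits of the cut function follow. -/
lemma eventually_mem_gridCube_of_openFace {a : Fin (n + 1)} {k : Fin (n + 1) → ℤ}
    {x : EuclideanSpace ℝ (Fin (n + 1))} (hε : 0 < ε) (hx : x ∈ openFace e ε y a k) :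
    (∀ᶠ z in 𝓝[{z | 0 < inner ℝ (e a) (z - x)}] x, z ∈ gridCube e ε y k) ∧
    ∀ᶠ z in 𝓝[{z | 0 < inner ℝ (-e a) (z - x)}] x,
      z ∈ gridCube e ε y (k - Pi.single a 1) := by
  have hc : ∀ i, ContinuousAt (fun z => inner ℝ (e i) z) x := fun i => by fun_prop
  have h1 : ∀ᶠ z in 𝓝 x, ∀ i, i ≠ a → inner ℝ (e i) z ∈
      Ioo (ε * (y i + k i)) (ε * (y i + k i + 1)) :=
    eventually_all.2 fun i => by
      by_cases hi : i = a
      · exact Eventually.of_forall fun z h => absurd hi h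
      · filter_upwards [(hc i).eventually (isOpen_Ioo.mem_nhds (hx.2 i hi))] with z hz _ using hz
  have h2 : ∀ᶠ z in 𝓝 x, inner ℝ (e a) z ∈ Ioo (ε * (y a + k a - 1)) (ε * (y a + k a + 1)) :=
    (hc a).eventually (isOpen_Ioo.mem_nhds (by simp only [hx.1]; constructor <;> nlinarith))
  constructor
  · filter_upwards [nhdsWithin_le_nhds h1, nhdsWithin_le_nhds h2, self_mem_nhdsWithin]
      with z z1 z2 z3 i
    by_cases hi : i = a
    · subst hi
      rw [inner_sub_right, hx.1] at z3
      exact ⟨by linarith, z2.2⟩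
    · exact Ioo_subset_Ico_self (z1 i hi)
  · filter_upwards [nhdsWithin_le_nhds h1, nhdsWithin_le_nhds h2, self_mem_nhdsWithin]
      with z z1 z2 z3 i
    by_cases hi : i = a
    · subst hi
      rw [inner_neg_left, inner_sub_right, hx.1] at z3
      simp only [Pi.sub_apply, Pi.single_eq_same]
      push_cast
      have := z2.1
      constructor <;> nlinarith
    · simpa [Pi.single_eq_of_ne hi] using Ioo_subset_Ico_self (z1 i hi)

lemma notMem_cubeUnion (hε : 0 < ε) {k : Fin (n + 1) → ℤ} (hk : k ∉ bad)
    {x : EuclideanSpace ℝ (Fin (n + 1))} (hx : x ∈ gridCube e ε y k) :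
    x ∉ cubeUnion e ε y bad := by
  intro h
  obtain ⟨l, hl, hxl⟩ := mem_iUnion₂.1 h
  exact (disjoint_left.1 (disjoint_gridCube e hε y (fun h => hk (h ▸ hl) : k ≠ l)) hx) hxl

lemma tendsto_cut_of_bad {k : Fin (n + 1) → ℤ} (hk : k ∈ bad)
    {l : Filter (EuclideanSpace ℝ (Fin (n + 1)))} (h : ∀ᶠ z in l, z ∈ gridCube e ε y k) :
    Tendsto ((cubeUnion e ε y bad)ᶜ.indicator w) l (𝓝 0) := by
  refine tendsto_const_nhds.congr' ?_
  filter_upwards [h] with z hz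
  exact (indicator_of_notMem (notMem_compl_iff.2 (mem_iUnion₂.2 ⟨k, hk, hz⟩)) _).symm

lemma tendsto_cut_of_good (hε : 0 < ε) (hw : Continuous w) {k : Fin (n + 1) → ℤ} (hk : k ∉ bad)
    {x : EuclideanSpace ℝ (Fin (n + 1))} {S : Set (EuclideanSpace ℝ (Fin (n + 1)))}
    (h : ∀ᶠ z in 𝓝[S] x, z ∈ gridCube e ε y k) :
    Tendsto ((cubeUnion e ε y bad)ᶜ.indicator w) (𝓝[S] x) (𝓝 (w x)) := by
  refine (hw.continuousAt.tendsto.mono_left nhdsWithin_le_nhds).congr' ?_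
  filter_upwards [h] with z hz
  exact (indicator_of_mem (mem_compl (notMem_cubeUnion hε hk hz)) _).symm

/-- A nonzero coefficient means that exactly one adjacent cube is bad, so the one-sided limits are
`0` and `w x`. -/
lemma openFace_subset_discontinuitySet (hε : 0 < ε) (hw : Continuous w) {a : Fin (n + 1)}
    {k : Fin (n + 1) → ℤ} {x : EuclideanSpace ℝ (Fin (n + 1))} (hxΩ : x ∈ Ω)
    (hx : x ∈ openFace e ε y a k) (hk : faceCoeff bad a k ≠ 0) (hwx : w x ≠ 0) :
    x ∈ discontinuitySet Ω ((cubeUnion e ε y bad)ᶜ.indicator w) := by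
  obtain ⟨h1, h2⟩ := eventually_mem_gridCube_of_openFace hε hx
  have hν : ‖e a‖ = 1 := e.orthonormal.1 a
  by_cases hb : k ∈ bad
  · have hb' : k - Pi.single a 1 ∉ bad := fun h => hk (by simp [faceCoeff, hb, h])
    exact mem_discontinuitySet hxΩ hν hwx.symm (tendsto_cut_of_bad hb h1)
      (tendsto_cut_of_good hε hw hb' h2)
  · have hb' : k - Pi.single a 1 ∈ bad := by
      by_contra h
      exact hk (by simp [faceCoeff, hb, h])
    exact mem_discontinuitySet hxΩ hν hwx (tendsto_cut_of_good hε hw hb h1)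
      (tendsto_cut_of_bad hb' h2)

lemma jumpSet_cut_subset (hw : Continuous w) :
    jumpSet Ω ((cubeUnion e ε y bad)ᶜ.indicator w) ⊆ frontier (cubeUnion e ε y bad) := by
  intro x hx
  by_contra hxf
  refine notMem_jumpSet_of_continuousAt ?_ hx
  rw [← mem_compl_iff, compl_frontier_eq_union_interior] at hxf
  rcases hxf with hxi | hxi
  · refine ContinuousAt.congr (f := fun _ => 0) continuousAt_const ?_
    filter_upwards [isOpen_interior.mem_nhds hxi] with z hz
    exact (indicator_of_notMem (notMem_compl_iff.2 (interior_subset hz)) _).symm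
  · refine hw.continuousAt.congr ?_
    filter_upwards [isOpen_interior.mem_nhds hxi] with z hz
    exact (indicator_of_mem (interior_subset hz) _).symm

section Decomposition

variable (hε : 0 < ε) (hΩ : IsOpen Ω) (hΩv : volume Ω ≠ ⊤) {C : NNReal}
    (hw : LipschitzWith C w) {M : ℝ} (hM : ∀ x, ‖w x‖ ≤ M)
    {p : (Fin (n + 1) → ℤ) → EuclideanSpace ℝ (Fin (n + 1)) → EuclideanSpace ℝ (Fin (n + 1))}
    (hp : ∀ k ∈ bad, ContDiff ℝ 1 (p k)) (hpw : ∀ k ∈ bad, ∀ x ∈ closedCube e ε y k, w x = p k x)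
include hε hΩ hΩv hw hM hp hpw

omit hε hΩ hΩv hM hp hpw in
lemma lipschitzWith_coord (i : Fin (n + 1)) : LipschitzWith C fun x => w x i :=
  LipschitzWith.of_dist_le_mul fun x z => by
    refine le_trans ?_ (hw.dist_le_mul x z)
    rw [dist_eq_norm, dist_eq_norm, ← PiLp.sub_apply]
    exact PiLp.norm_apply_le _ i

lemma gradEntry_cut (i j : Fin (n + 1)) :
    gradEntry Ω ((cubeUnion e ε y bad)ᶜ.indicator w) i j =ᵐ[volume]
      cutDensity e ε y bad Ω (fun x => w x i) (EuclideanSpace.single j 1) := by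
  have h := acDensity_cut (w := fun x => w x i) (p := fun k x => p k x i)
    (EuclideanSpace.single j 1) hε hΩ hΩv (lipschitzWith_coord hw i)
    (fun x => (PiLp.norm_apply_le (w x) i).trans (hM x))
    (fun k hk => contDiff_euclidean.1 (hp k hk) i) (fun k hk x hx => by rw [hpw k hk x hx])
  rw [← indicator_coord] at h
  exact h

lemma isSBVInfty_cut : IsSBVInfty Ω ((cubeUnion e ε y bad)ᶜ.indicator w) := by
  have hBm := measurableSet_cubeUnion e ε y bad
  have hMi : ∀ i x, |w x i| ≤ M := fun i x => (PiLp.norm_apply_le (w x) i).trans (hM x)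
  have hpi : ∀ i, ∀ k ∈ bad, ContDiff ℝ 1 fun x => p k x i :=
    fun i k hk => contDiff_euclidean.1 (hp k hk) i
  have hpwi : ∀ i, ∀ k ∈ bad, ∀ x ∈ closedCube e ε y k, w x i = p k x i :=
    fun i k hk x hx => by rw [hpw k hk x hx]
  have hfin : IsFiniteMeasure (volume.restrict Ω) := ⟨by
    rw [Measure.restrict_apply_univ]; exact hΩv.lt_top⟩
  have hum : Measurable ((cubeUnion e ε y bad)ᶜ.indicator w) :=
    hw.continuous.measurable.indicator hBm.compl
  have hub : ∀ x, ‖(cubeUnion e ε y bad)ᶜ.indicator w x‖ ≤ M :=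
    fun x => (norm_indicator_le_norm_self _ _).trans (hM x)
  constructor
  · intro i
    refine ⟨?_, fun v => ?_⟩
    · refine Integrable.of_bound (C := M) ?_ (Eventually.of_forall fun x => ?_)
      · exact (by fun_prop : Measurable fun x => (cubeUnion e ε y bad)ᶜ.indicator w x i)
          |>.aestronglyMeasurable
      · exact (PiLp.norm_apply_le _ i).trans (hub x)
    · rw [indicator_coord]
      exact ⟨_, isDistribDeriv_cut v hε hΩ hΩv (lipschitzWith_coord hw i) (hMi i) (hpi i) (hpwi i)⟩
  · intro i j
    rw [indicator_coord, singPart_cut _ hε hΩ hΩv (lipschitzWith_coord hw i) (hMi i) (hpi i)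
      (hpwi i)]
    -- The part of the open faces in `Ω` where the density of the jump part is nonzero. It carries
    -- the whole singular part and consists of discontinuity points of the vector-valued function,
    -- so no Cantor part remains.
    set S : Set (EuclideanSpace ℝ (Fin (n + 1))) := ⋃ a, ⋃ k ∈ faceIndices bad a,
      Ω ∩ openFace e ε y a k ∩ {x | faceCoeff bad a k * w x i ≠ 0} with hS
    have hSm : MeasurableSet S := MeasurableSet.iUnion fun a =>
      Finset.measurableSet_biUnion _ fun k _ =>
        (hΩ.measurableSet.inter (measurableSet_openFace e ε y a k)).inter
          (((lipschitzWith_coord hw i).continuous.measurable.const_mul _)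
            (measurableSet_singleton 0).compl)
    refine measure_mono_null (t := Sᶜ) ?_ (totalVariation_cutJumpPart _ hSm.compl
      (lipschitzWith_coord hw i).continuous (hMi i) fun a k hk => ?_)
    · rintro x ⟨hxΩ, hxd⟩ hxS
      simp only [hS, mem_iUnion] at hxS
      obtain ⟨a, k, hk, ⟨_, hxo⟩, hne⟩ := hxS
      have hne' : faceCoeff bad a k * w x i ≠ 0 := hne
      refine hxd (openFace_subset_discontinuitySet hε hw.continuous hxΩ hxo
        (left_ne_zero_of_mul hne') fun h => right_ne_zero_of_mul hne' ?_)
      rw [h]; rfl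
    · filter_upwards [ae_restrict_mem hΩ.measurableSet,
        ae_restrict_of_ae (ae_mem_openFace e ε y a k)] with x hxΩ hxo hxS
      by_contra hne
      exact hxS (mem_iUnion.2 ⟨a, mem_iUnion₂.2 ⟨k, hk, ⟨hxΩ, hxo⟩, hne⟩⟩)
  · exact memLp_top_of_bound hum.aestronglyMeasurable M (Eventually.of_forall hub)
  · intro i j
    have h := gradEntry_cut hε hΩ hΩv hw hM hp hpw i j
    refine (memLp_congr_ae (ae_restrict_of_ae h)).2 ?_
    exact memLp_top_of_bound (measurable_cutDensity _ hΩ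
      (lipschitzWith_coord hw i).continuous).aestronglyMeasurable _
      (Eventually.of_forall fun x => abs_cutDensity_le _ (lipschitzWith_coord hw i) x)
  · rw [Nat.add_sub_cancel]
    refine ((measure_mono (jumpSet_cut_subset hw.continuous)).trans
      (hausdorff_frontier_cubeUnion_le e hε y bad)).trans_lt ?_
    finiteness

end Decomposition

end Cut

/-! ### Cubes inside the domain -/

section Inside

variable {d : ℕ} {e : OrthonormalBasis (Fin d) ℝ (EuclideanSpace ℝ (Fin d))} {ε : ℝ}
  {y : Fin d → ℝ} {k : Fin d → ℤ} {Ω : Set (EuclideanSpace ℝ (Fin d))}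

lemma inner_gridVertex (e : OrthonormalBasis (Fin d) ℝ (EuclideanSpace ℝ (Fin d))) (ε : ℝ)
    (y : Fin d → ℝ) (k : Fin d → ℤ) (s : Finset (Fin d)) (i : Fin d) :
    inner ℝ (e i) (gridVertex e ε y k s) = ε * (y i + k i + if i ∈ s then 1 else 0) :=
  inner_fromCoords e (fun i => ε * (y i + k i + if i ∈ s then 1 else 0)) i

lemma gridVertex_mem_closedCube (hε : 0 < ε) (s : Finset (Fin d)) :
    gridVertex e ε y k s ∈ closedCube e ε y k := by
  intro i
  rw [inner_gridVertex]
  split_ifs <;> constructor <;> nlinarith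

lemma convex_closedCube : Convex ℝ (closedCube e ε y k) := by
  intro x hx z hz a b ha hb hab i
  rw [inner_add_right, inner_smul_right, inner_smul_right]
  exact (convex_Icc _ _) (hx i) (hz i) ha hb hab

lemma dist_le_of_mem_closedCube (hε : 0 < ε) {x z : EuclideanSpace ℝ (Fin d)}
    (hx : x ∈ closedCube e ε y k) (hz : z ∈ closedCube e ε y k) : dist x z ≤ √d * ε := by
  rw [dist_eq_norm, ← e.repr.norm_map, EuclideanSpace.norm_eq]
  refine Real.sqrt_le_iff.2 ⟨by positivity, ?_⟩
  rw [mul_pow, Real.sq_sqrt (Nat.cast_nonneg d)]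
  calc ∑ i, ‖e.repr (x - z) i‖ ^ 2 ≤ ∑ _i : Fin d, ε ^ 2 := by
        refine Finset.sum_le_sum fun i _ => ?_
        rw [e.repr_apply_apply, inner_sub_right, Real.norm_eq_abs, sq_abs]
        have h1 := hx i
        have h2 := hz i
        refine sq_le_sq' ?_ ?_ <;> linarith [h1.1, h1.2, h2.1, h2.2]
    _ = d * ε ^ 2 := by simp

/-- The indices of the cubes whose closure lies in `Ω`. -/
def insideCubes (Ω : Set (EuclideanSpace ℝ (Fin d)))
    (e : OrthonormalBasis (Fin d) ℝ (EuclideanSpace ℝ (Fin d))) (ε : ℝ) (y : Fin d → ℝ) :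
    Set (Fin d → ℤ) :=
  {k | closedCube e ε y k ⊆ Ω}

lemma finite_insideCubes (hε : 0 < ε) (hΩ : Bornology.IsBounded Ω) :
    (insideCubes Ω e ε y).Finite := by
  obtain ⟨R, hR⟩ := hΩ.exists_norm_le
  refine (Set.finite_Icc (fun i => ⌊-(R / ε) - y i⌋) fun i => ⌈R / ε - y i⌉).subset fun k hk => ?_
  have h1 : ∀ i, |y i + k i| ≤ R / ε := by
    intro i
    have h := abs_real_inner_le_norm (e i) (gridVertex e ε y k ∅)
    rw [e.orthonormal.1 i, one_mul, inner_gridVertex, abs_mul, abs_of_pos hε] at h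
    replace h := h.trans (hR _ (hk (gridVertex_mem_closedCube hε ∅)))
    rw [le_div_iff₀ hε, mul_comm]
    simpa using h
  refine ⟨fun i => Int.floor_le_iff.2 ?_, fun i => Int.le_ceil_iff.2 ?_⟩
  · linarith [(abs_le.1 (h1 i)).1]
  · linarith [(abs_le.1 (h1 i)).2]

/-- The closed cube has diameter at most `√d ε`, so it misses `∂Ω`; being connected and meeting `Ω`,
it lies in `Ω`. -/
lemma mem_insideCubes_of_innerDomain (hε : 0 < ε) {x : EuclideanSpace ℝ (Fin d)}
    (hx : x ∈ innerDomain Ω ε) (hxk : x ∈ gridCube e ε y k) : k ∈ insideCubes Ω e ε y := by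
  intro z hz
  by_contra hzΩ
  have hxk' := gridCube_subset_closedCube e ε y k hxk
  have hpre : IsPreconnected (closedCube e ε y k) := convex_closedCube.isPreconnected
  have hno : closedCube e ε y k ⊆ interior Ω ∪ interior Ωᶜ := fun t ht => by
    rw [← compl_frontier_eq_union_interior]
    intro htf
    have := Metric.infDist_le_dist_of_mem (x := x) htf
    linarith [hx.2, dist_le_of_mem_closedCube hε hxk' ht]
  obtain ⟨t, _, ht1, ht2⟩ := hpre _ _ isOpen_interior isOpen_interior hno
    ⟨x, hxk', (hno hxk').resolve_right fun h => interior_subset h hx.1⟩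
    ⟨z, hz, (hno hz).resolve_left fun h => hzΩ (interior_subset h)⟩
  exact interior_subset ht2 (interior_subset ht1)

lemma mem_segmentDomain (hε : 0 < ε) (hk : k ∈ insideCubes Ω e ε y)
    {ξ : EuclideanSpace ℝ (Fin d)} {s t : Finset (Fin d)}
    (h : gridVertex e ε y k t = gridVertex e ε y k s + ε • ξ) :
    gridVertex e ε y k s ∈ segmentDomain Ω ξ ε := by
  intro r hr
  refine hk ?_
  have h1 := convex_closedCube (gridVertex_mem_closedCube (e := e) (y := y) (k := k) hε s)
    (gridVertex_mem_closedCube hε t) (a := 1 - r / ε) (b := r / ε)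
    (by rw [sub_nonneg, div_le_one hε]; exact hr.2) (div_nonneg hr.1 hε.le) (by ring)
  convert h1 using 1
  rw [h, smul_add, smul_smul, div_mul_cancel₀ _ hε.ne', sub_smul, one_smul]
  abel

/-- The sum of the truncated increments of `u` from the vertices of the cube `k`. -/
def vertexEnergy (Ω : Set (EuclideanSpace ℝ (Fin d)))
    (e : OrthonormalBasis (Fin d) ℝ (EuclideanSpace ℝ (Fin d)))
    (u : EuclideanSpace ℝ (Fin d) → EuclideanSpace ℝ (Fin d)) (ε : ℝ) (y : Fin d → ℝ)
    (k : Fin d → ℤ) : ℝ≥0∞ :=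
  ∑ ξ ∈ directions e, ∑ s, truncIncrement Ω u ε ξ (gridVertex e ε y k s)

/-- The sum of the truncated increments of `u` from all points of the lattice. -/
def latticeEnergy (Ω : Set (EuclideanSpace ℝ (Fin d)))
    (e : OrthonormalBasis (Fin d) ℝ (EuclideanSpace ℝ (Fin d)))
    (u : EuclideanSpace ℝ (Fin d) → EuclideanSpace ℝ (Fin d)) (ε : ℝ) (y : Fin d → ℝ) : ℝ≥0∞ :=
  ∑ ξ ∈ directions e, ∑' m, truncIncrement Ω u ε ξ (latticePoint e ε y m)

variable {u : EuclideanSpace ℝ (Fin d) → EuclideanSpace ℝ (Fin d)}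

lemma vertexEnergy_ne_top : vertexEnergy Ω e u ε y k ≠ ⊤ := by
  refine (ENNReal.sum_lt_top.2 fun ξ _ => ENNReal.sum_lt_top.2 fun s _ => ?_).ne
  refine lt_of_le_of_lt (b := 1) ?_ ENNReal.one_lt_top
  refine (indicator_le_self' (fun _ _ => zero_le) _).trans (min_le_right _ _)

lemma min_le_vertexEnergy (hε : 0 < ε) (hk : k ∈ insideCubes Ω e ε y)
    {ξ : EuclideanSpace ℝ (Fin d)} (hξ : ξ ∈ directions e) {s t : Finset (Fin d)}
    (h : gridVertex e ε y k t = gridVertex e ε y k s + ε • ξ) :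
    min ‖inner ℝ ξ (u (gridVertex e ε y k t) - u (gridVertex e ε y k s))‖ₑ 1 ≤
      vertexEnergy Ω e u ε y k := by
  refine le_trans (le_trans (le_of_eq ?_) (Finset.single_le_sum
    (f := fun s => truncIncrement Ω u ε ξ (gridVertex e ε y k s)) (fun _ _ => zero_le)
    (Finset.mem_univ s))) (Finset.single_le_sum
    (f := fun ξ => ∑ s, truncIncrement Ω u ε ξ (gridVertex e ε y k s)) (fun _ _ => zero_le) hξ)
  rw [truncIncrement, indicator_of_mem (mem_segmentDomain hε hk h), h]

lemma badCubes_subset_insideCubes (hε : 0 < ε) :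
    badCubes Ω e u ε y ⊆ insideCubes Ω e ε y := fun k hk => by
  have := hk.1
  rwa [closure_gridCube e hε] at this

lemma one_le_vertexEnergy (hε : 0 < ε) (hk : k ∈ badCubes Ω e u ε y) :
    1 ≤ vertexEnergy Ω e u ε y k := by
  have hk' := badCubes_subset_insideCubes hε hk
  obtain ⟨_, ξ, hξ, s, t, h, h1⟩ := hk
  refine le_trans (le_of_eq ?_) (min_le_vertexEnergy hε hk' hξ h)
  rw [min_eq_right]
  rw [Real.enorm_eq_ofReal_abs, ← ENNReal.ofReal_one]
  exact ENNReal.ofReal_le_ofReal h1.le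

/-- In a cube that is not bad all these increments are at most `1`, so truncation does not change
them. -/
lemma abs_inner_le_vertexEnergy (hε : 0 < ε) (hk : k ∈ insideCubes Ω e ε y)
    (hkb : k ∉ badCubes Ω e u ε y) {ξ : EuclideanSpace ℝ (Fin d)} (hξ : ξ ∈ directions e)
    (s t : Finset (Fin d)) (h : gridVertex e ε y k t = gridVertex e ε y k s + ε • ξ) :
    |inner ℝ ξ (u (gridVertex e ε y k t) - u (gridVertex e ε y k s))| ≤
      (vertexEnergy Ω e u ε y k).toReal := by
  have h1 : |inner ℝ ξ (u (gridVertex e ε y k t) - u (gridVertex e ε y k s))| ≤ 1 := by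
    by_contra h1
    push Not at h1
    exact hkb ⟨by rw [closure_gridCube e hε]; exact hk, ξ, hξ, s, t, h, h1⟩
  have h2 := min_le_vertexEnergy (u := u) hε hk hξ h
  rw [min_eq_left, Real.enorm_eq_ofReal_abs] at h2
  · exact (ENNReal.ofReal_le_iff_le_toReal vertexEnergy_ne_top).1 h2
  · rw [Real.enorm_eq_ofReal_abs, ← ENNReal.ofReal_one]
    exact ENNReal.ofReal_le_ofReal h1

lemma vertexIndex_injective_left (s : Finset (Fin d)) :
    Function.Injective fun k => vertexIndex k s := by
  intro k l h
  funext i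
  have := congrFun h i
  simpa [vertexIndex] using this

/-- For each of the `2 ^ d` vertex labels, different cubes have different vertices, so each lattice
point is counted at most `2 ^ d` times. -/
lemma sum_vertexEnergy_le (A : Finset (Fin d → ℤ)) :
    ∑ k ∈ A, vertexEnergy Ω e u ε y k ≤ 2 ^ d * latticeEnergy Ω e u ε y := by
  unfold vertexEnergy latticeEnergy
  rw [Finset.sum_comm, Finset.mul_sum]
  refine Finset.sum_le_sum fun ξ _ => ?_
  rw [Finset.sum_comm]
  calc ∑ s, ∑ k ∈ A, truncIncrement Ω u ε ξ (gridVertex e ε y k s)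
      ≤ ∑ _s : Finset (Fin d), ∑' m, truncIncrement Ω u ε ξ (latticePoint e ε y m) := by
        refine Finset.sum_le_sum fun s _ => (ENNReal.sum_le_tsum A).trans ?_
        simp_rw [gridVertex_eq]
        exact ENNReal.tsum_comp_le_tsum_of_injective (vertexIndex_injective_left s)
          fun m => truncIncrement Ω u ε ξ (latticePoint e ε y m)
    _ = _ := by simp

end Inside

/-! ### The approximation for a given shift of the grid -/

section FixedShift

variable {n : ℕ} {e : OrthonormalBasis (Fin (n + 1)) ℝ (EuclideanSpace ℝ (Fin (n + 1)))} {ε : ℝ}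
  {y : Fin (n + 1) → ℝ} {Ω : Set (EuclideanSpace ℝ (Fin (n + 1)))}

lemma symGradNorm_le {d : ℕ} {Ω : Set (EuclideanSpace ℝ (Fin d))}
    {u : EuclideanSpace ℝ (Fin d) → EuclideanSpace ℝ (Fin d)} {x : EuclideanSpace ℝ (Fin d)}
    {b : ℝ} (hb : 0 ≤ b)
    (h : ∀ i j, |(gradEntry Ω u i j x + gradEntry Ω u j i x) / 2| ≤ b) :
    symGradNorm Ω u x ≤ d * b := by
  refine Real.sqrt_le_iff.2 ⟨by positivity, ?_⟩
  calc ∑ i, ∑ j, ((gradEntry Ω u i j x + gradEntry Ω u j i x) / 2) ^ 2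
      ≤ ∑ _i : Fin d, ∑ _j : Fin d, b ^ 2 :=
        Finset.sum_le_sum fun i _ => Finset.sum_le_sum fun j _ => by
          rw [← sq_abs]
          exact pow_le_pow_left₀ (abs_nonneg _) (h i j) 2
    _ = (d * b) ^ 2 := by
        simp only [Finset.sum_const, Finset.card_univ, Fintype.card_fin, nsmul_eq_mul]
        ring

lemma lintegral_innerDomain_le (hε : 0 < ε) {I : Finset (Fin (n + 1) → ℤ)}
    (hI : insideCubes Ω e ε y ⊆ I) (f : EuclideanSpace ℝ (Fin (n + 1)) → ℝ≥0∞) :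
    ∫⁻ x in innerDomain Ω ε, f x ≤ ∑ k ∈ I, ∫⁻ x in gridCube e ε y k, f x := by
  rw [← lintegral_biUnion_finset (fun k _ l _ hkl => disjoint_gridCube e hε y hkl)
    fun k _ => measurableSet_gridCube e ε y k]
  refine lintegral_mono_set fun x hx => ?_
  obtain ⟨k, hk⟩ := exists_mem_gridCube e hε y x
  exact mem_iUnion₂.2 ⟨k, hI (mem_insideCubes_of_innerDomain hε hx hk), hk⟩

variable {w : EuclideanSpace ℝ (Fin (n + 1)) → EuclideanSpace ℝ (Fin (n + 1))}

lemma cutDensity_eq_fderiv {bad : Finset (Fin (n + 1) → ℤ)} (hε : 0 < ε) {k : Fin (n + 1) → ℤ}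
    (hkb : k ∉ bad) (hkΩ : closedCube e ε y k ⊆ Ω)
    {p : EuclideanSpace ℝ (Fin (n + 1)) → EuclideanSpace ℝ (Fin (n + 1))}
    (hp : ContDiff ℝ 1 p) (hpw : ∀ x ∈ closedCube e ε y k, w x = p x)
    {x : EuclideanSpace ℝ (Fin (n + 1))} (hx : x ∈ openCube e ε y k) (i : Fin (n + 1))
    (v : EuclideanSpace ℝ (Fin (n + 1))) :
    cutDensity e ε y bad Ω (fun x => w x i) v x = fderiv ℝ p x v i := by
  have hxq := openCube_subset_gridCube e ε y k hx
  have hmem : x ∈ Ω \ cubeUnion e ε y bad :=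
    ⟨hkΩ (gridCube_subset_closedCube e ε y k hxq), notMem_cubeUnion hε hkb hxq⟩
  rw [cutDensity, indicator_of_mem hmem,
    lineDeriv_eq_of_openCube (p := fun x => p x i) v (contDiff_euclidean.1 hp i)
      (fun x hx => by rw [hpw x hx]) hx]
  have h := (hp.differentiable one_ne_zero x).hasFDerivAt
  have h' := (EuclideanSpace.proj (𝕜 := ℝ) i).hasFDerivAt.comp x h
  exact congrArg (fun L => L v) h'.fderiv

/-- The deterministic half of the argument: for an arbitrary shift the energy and the perimeter are
bounded by the lattice energy, and no regularity of `u` is involved. -/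
theorem exists_gridApprox (hε : 0 < ε) (hΩ : IsOpen Ω) (hΩb : Bornology.IsBounded Ω)
    (e : OrthonormalBasis (Fin (n + 1)) ℝ (EuclideanSpace ℝ (Fin (n + 1))))
    (u : EuclideanSpace ℝ (Fin (n + 1)) → EuclideanSpace ℝ (Fin (n + 1)))
    (y : Fin (n + 1) → ℝ) :
    ∃ w : EuclideanSpace ℝ (Fin (n + 1)) → EuclideanSpace ℝ (Fin (n + 1)),
      IsSBVInfty Ω w ∧
      jumpSet Ω w ⊆ frontier (⋃ k ∈ badCubes Ω e u ε y, gridCube e ε y k) ∧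
      (∀ x ∈ ⋃ k ∈ badCubes Ω e u ε y, gridCube e ε y k, w x = 0) ∧
      (∀ k ∈ insideCubes Ω e ε y, k ∉ badCubes Ω e u ε y → ∀ x ∈ gridCube e ε y k,
        w x = multilinearInterp e ε y k u x) ∧
      (∫⁻ x in innerDomain Ω ε, ENNReal.ofReal (symGradNorm Ω w x)) +
        μHE[n] (essentialBoundary (⋃ k ∈ badCubes Ω e u ε y, gridCube e ε y k) ∩
          innerDomain Ω ε) ≤
        ENNReal.ofReal (5 * (n + 1) ^ 3 * 2 ^ (n + 1) + 2 * (n + 1)) *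
          (ENNReal.ofReal ε ^ n * (2 ^ (n + 1) * latticeEnergy Ω e u ε y)) := by
  classical
  have hfin := finite_insideCubes (e := e) (y := y) hε hΩb
  have hbfin : (badCubes Ω e u ε y).Finite := hfin.subset (badCubes_subset_insideCubes hε)
  set I := hfin.toFinset with hI
  set bad := hbfin.toFinset with hbad
  have hmI : ∀ k, k ∈ I ↔ k ∈ insideCubes Ω e ε y := fun k => hfin.mem_toFinset
  have hmb : ∀ k, k ∈ bad ↔ k ∈ badCubes Ω e u ε y := fun k => hbfin.mem_toFinset
  have hbI : ∀ k ∈ bad, k ∈ I := fun k hk =>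
    (hmI k).2 (badCubes_subset_insideCubes hε ((hmb k).1 hk))
  -- Only vertices of cubes inside `Ω` are used. This makes the sum of hats finite, hence bounded
  -- and Lipschitz.
  set N : Finset (Fin (n + 1) → ℤ) := I.biUnion fun k => Finset.univ.image (vertexIndex k) with hN
  have hNI : ∀ k ∈ I, ∀ s, vertexIndex k s ∈ N := fun k hk s =>
    Finset.mem_biUnion.2 ⟨k, hk, Finset.mem_image_of_mem _ (Finset.mem_univ s)⟩
  set h := hatInterp e ε y N u with hh
  have hheq : ∀ k ∈ I, ∀ x ∈ closedCube e ε y k, h x = multilinearInterp e ε y k u x :=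
    fun k hk x hx => hatInterp_eq hε u (hNI k hk) hx
  obtain ⟨C, hC⟩ := exists_lipschitz_hatInterp e hε y N u
  have hM := norm_hatInterp_le e ε y N u
  have hp : ∀ k, ContDiff ℝ 1 (multilinearInterp e ε y k u) := fun k =>
    (contDiff_multilinearInterp e ε y k u).of_le (by exact_mod_cast le_top)
  have hΩv : volume Ω ≠ ⊤ := hΩb.measure_lt_top.ne
  have hpw : ∀ k ∈ bad, ∀ x ∈ closedCube e ε y k, h x = multilinearInterp e ε y k u x :=
    fun k hk => hheq k (hbI k hk)
  have hB : (⋃ k ∈ badCubes Ω e u ε y, gridCube e ε y k) = cubeUnion e ε y bad := by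
    simp only [cubeUnion, hmb]
  rw [hB]
  refine ⟨(cubeUnion e ε y bad)ᶜ.indicator h,
    isSBVInfty_cut hε hΩ hΩv hC hM (fun k _ => hp k) hpw, jumpSet_cut_subset hC.continuous,
    fun x hx => indicator_of_notMem (notMem_compl_iff.2 hx) _, fun k hk hkb x hx => ?_, ?_⟩
  · rw [indicator_of_mem (mem_compl (notMem_cubeUnion hε (fun h => hkb ((hmb k).1 h)) hx))]
    exact hheq k ((hmI k).2 hk) x (gridCube_subset_closedCube e ε y k hx)
  -- With `d = n + 1`: `d ^ 2 * 2 ^ d * 5` bounds an entry of the symmetrized gradient, and one more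
  -- factor `d` passes to the Frobenius norm.
  set K : ℝ := 5 * (n + 1) ^ 3 * 2 ^ (n + 1) with hK
  have hK0 : 0 ≤ K := by positivity
  have hae : ∀ᵐ x : EuclideanSpace ℝ (Fin (n + 1)), ∀ i j,
      gradEntry Ω ((cubeUnion e ε y bad)ᶜ.indicator h) i j x =
        cutDensity e ε y bad Ω (fun x => h x i) (EuclideanSpace.single j 1) x :=
    ae_all_iff.2 fun i => ae_all_iff.2 fun j =>
      gradEntry_cut hε hΩ hΩv hC hM (fun k _ => hp k) hpw i j
  have hcube : ∀ k ∈ I, ∫⁻ x in gridCube e ε y k,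
      ENNReal.ofReal (symGradNorm Ω ((cubeUnion e ε y bad)ᶜ.indicator h) x) ≤
      ENNReal.ofReal K * (ENNReal.ofReal ε ^ n * vertexEnergy Ω e u ε y k) := by
    intro k hk
    have hkΩ := (hmI k).1 hk
    set m := (vertexEnergy Ω e u ε y k).toReal with hm
    have hpt : ∀ᵐ x ∂volume.restrict (gridCube e ε y k),
        ENNReal.ofReal (symGradNorm Ω ((cubeUnion e ε y bad)ᶜ.indicator h) x) ≤
          ENNReal.ofReal (K * m / ε) := by
      filter_upwards [ae_restrict_of_ae hae, ae_restrict_of_ae (ae_mem_openCube e ε y k),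
        ae_restrict_mem (measurableSet_gridCube e ε y k)] with x hx hxo hxq
      refine ENNReal.ofReal_le_ofReal ?_
      have hb : 0 ≤ ((n + 1 : ℕ) : ℝ) ^ 2 * (2 ^ (n + 1) * (5 * m)) / ε := by positivity
      refine (symGradNorm_le hb fun i j => ?_).trans (le_of_eq ?_)
      · rw [hx i j, hx j i]
        by_cases hkb : k ∈ bad
        · have : x ∉ Ω \ cubeUnion e ε y bad := fun h => h.2 (mem_iUnion₂.2 ⟨k, hkb, hxq⟩)
          simp only [cutDensity, indicator_of_notMem this]
          simpa using hb
        · rw [cutDensity_eq_fderiv hε hkb hkΩ (hp k) (hheq k hk) (hxo hxq),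
            cutDensity_eq_fderiv hε hkb hkΩ (hp k) (hheq k hk) (hxo hxq)]
          exact abs_symGrad_interp_le hε (fun ξ hξ s t hst =>
            abs_inner_le_vertexEnergy hε hkΩ (fun h => hkb ((hmb k).2 h)) hξ s t hst)
            (gridCube_subset_closedCube e ε y k hxq) i j
      · rw [hK]
        push_cast
        ring
    refine (lintegral_mono_ae hpt).trans (le_of_eq ?_)
    rw [lintegral_const, Measure.restrict_apply_univ, volume_gridCube,
      ← ENNReal.ofReal_toReal (vertexEnergy_ne_top (Ω := Ω) (e := e) (u := u) (ε := ε) (y := y)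
        (k := k)), ← hm, ← ENNReal.ofReal_pow hε.le, ← ENNReal.ofReal_pow hε.le,
      ← ENNReal.ofReal_mul (by positivity), ← ENNReal.ofReal_mul (by positivity),
      ← ENNReal.ofReal_mul (by positivity)]
    congr 1
    field_simp
    ring
  have hper : μHE[n] (essentialBoundary (cubeUnion e ε y bad) ∩ innerDomain Ω ε) ≤
      ENNReal.ofReal (2 * (n + 1)) * (ENNReal.ofReal ε ^ n *
        ∑ k ∈ I, vertexEnergy Ω e u ε y k) := by
    refine (measure_mono (inter_subset_left.trans (essentialBoundary_subset_frontier _))).trans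
      ((hausdorff_frontier_cubeUnion_le e hε y bad).trans ?_)
    -- Each bad cube contributes at least `1`, since one of its truncated increments equals `1`.
    have hcard : (bad.card : ℝ≥0∞) ≤ ∑ k ∈ I, vertexEnergy Ω e u ε y k := by
      refine le_trans ?_ (Finset.sum_le_sum_of_subset (fun k hk => hbI k hk))
      calc (bad.card : ℝ≥0∞) = ∑ _k ∈ bad, 1 := by simp
        _ ≤ _ := Finset.sum_le_sum fun k hk => one_le_vertexEnergy hε ((hmb k).1 hk)
    have h2 : ENNReal.ofReal (2 * (n + 1)) = 2 * (n + 1) := by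
      rw [ENNReal.ofReal_mul zero_le_two, ENNReal.ofReal_add (by positivity) zero_le_one]
      simp
    rw [h2]
    calc (bad.card : ℝ≥0∞) * (2 * (n + 1) * ENNReal.ofReal ε ^ n)
        ≤ (∑ k ∈ I, vertexEnergy Ω e u ε y k) * (2 * (n + 1) * ENNReal.ofReal ε ^ n) := by gcongr
      _ = _ := by ring
  calc (∫⁻ x in innerDomain Ω ε,
          ENNReal.ofReal (symGradNorm Ω ((cubeUnion e ε y bad)ᶜ.indicator h) x)) +
        μHE[n] (essentialBoundary (cubeUnion e ε y bad) ∩ innerDomain Ω ε)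
      ≤ ENNReal.ofReal K * (ENNReal.ofReal ε ^ n * ∑ k ∈ I, vertexEnergy Ω e u ε y k) +
        ENNReal.ofReal (2 * (n + 1)) * (ENNReal.ofReal ε ^ n *
          ∑ k ∈ I, vertexEnergy Ω e u ε y k) := by
        refine add_le_add ?_ hper
        refine (lintegral_innerDomain_le hε (fun k hk => (hmI k).2 hk) _).trans ?_
        rw [Finset.mul_sum, Finset.mul_sum]
        exact Finset.sum_le_sum hcube
    _ = ENNReal.ofReal (K + 2 * (n + 1)) * (ENNReal.ofReal ε ^ n *
          ∑ k ∈ I, vertexEnergy Ω e u ε y k) := by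
        rw [ENNReal.ofReal_add hK0 (by positivity), add_mul]
    _ ≤ _ := by
        gcongr
        exact sum_vertexEnergy_le I

end FixedShift

/-! ### Continuity of translations in measure -/

section Translation

variable {E F : Type*} [NormedAddCommGroup E] [InnerProductSpace ℝ E] [FiniteDimensional ℝ E]
  [MeasurableSpace E] [BorelSpace E] [NormedAddCommGroup F]

lemma tendsto_lintegral_translate_of_continuous {g : E → F} (hg : Continuous g)
    (hc : HasCompactSupport g) :
    Tendsto (fun z => ∫⁻ x, ‖g (x + z) - g x‖ₑ) (𝓝 0) (𝓝 0) := by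
  obtain ⟨M, hM⟩ := hg.bounded_above_of_compact_support hc
  set K := Metric.cthickening 1 (tsupport g) with hK
  have hKc : IsCompact K := hc.isCompact.cthickening
  have h0 : ∫⁻ _ : E, (0 : ℝ≥0∞) = 0 := by simp
  rw [← h0]
  refine tendsto_lintegral_filter_of_dominated_convergence
    (bound := K.indicator fun _ => ENNReal.ofReal (M + M)) ?_ ?_ ?_ ?_
  · exact Eventually.of_forall fun z =>
      (by fun_prop : Continuous fun x => ‖g (x + z) - g x‖ₑ).measurable
  · filter_upwards [Metric.closedBall_mem_nhds (0 : E) one_pos] with z hz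
    refine Eventually.of_forall fun x => ?_
    by_cases hx : x ∈ K
    · rw [indicator_of_mem hx, ← ofReal_norm]
      exact ENNReal.ofReal_le_ofReal ((norm_sub_le _ _).trans (add_le_add (hM _) (hM _)))
    · have h1 : x ∉ tsupport g := fun h => hx (Metric.self_subset_cthickening _ h)
      have h2 : x + z ∉ tsupport g := fun h => hx
        (Metric.mem_cthickening_of_dist_le x (x + z) 1 _ h (by simpa [dist_eq_norm] using hz))
      rw [image_eq_zero_of_notMem_tsupport h1, image_eq_zero_of_notMem_tsupport h2]
      simp
  · rw [lintegral_indicator hKc.measurableSet, setLIntegral_const]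
    exact ENNReal.mul_ne_top ENNReal.ofReal_ne_top hKc.measure_lt_top.ne
  · refine Eventually.of_forall fun x => ?_
    have : Tendsto (fun z => ‖g (x + z) - g x‖ₑ) (𝓝 0) (𝓝 ‖g (x + 0) - g x‖ₑ) :=
      (by fun_prop : Continuous fun z => ‖g (x + z) - g x‖ₑ).tendsto 0
    simpa using this

/-- Approximation in `L¹` by continuous compactly supported functions, for which dominated
convergence applies, together with translation invariance. -/
lemma tendsto_lintegral_translate [NormedSpace ℝ F] {f : E → F} (hf : Integrable f) :
    Tendsto (fun z => ∫⁻ x, ‖f (x + z) - f x‖ₑ) (𝓝 0) (𝓝 0) := by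
  rw [ENNReal.tendsto_nhds_zero]
  intro η hη
  obtain ⟨g, hgc, hfg, hg, -⟩ :=
    hf.exists_hasCompactSupport_lintegral_sub_le (ε := η / 3) (ENNReal.div_pos hη.ne' (by simp)).ne'
  have h1 := ENNReal.tendsto_nhds_zero.1 (tendsto_lintegral_translate_of_continuous hg hgc)
    (η / 3) (ENNReal.div_pos hη.ne' (by simp))
  filter_upwards [h1] with z hz
  have h2 : ∫⁻ x, ‖f (x + z) - g (x + z)‖ₑ = ∫⁻ x, ‖f x - g x‖ₑ :=
    lintegral_add_right_eq_self (fun x => ‖f x - g x‖ₑ) z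
  have hm : AEMeasurable fun x => ‖f x - g x‖ₑ :=
    (hf.1.sub hg.aestronglyMeasurable).enorm
  calc ∫⁻ x, ‖f (x + z) - f x‖ₑ
      ≤ ∫⁻ x, (‖g (x + z) - g x‖ₑ + ‖f (x + z) - g (x + z)‖ₑ) + ‖f x - g x‖ₑ := by
        refine lintegral_mono fun x => ?_
        have e1 : f (x + z) - f x =
            (g (x + z) - g x) + (f (x + z) - g (x + z)) - (f x - g x) := by abel
        rw [e1]
        exact (enorm_sub_le).trans (add_le_add (enorm_add_le _ _) le_rfl)
    _ = ((∫⁻ x, ‖g (x + z) - g x‖ₑ) + ∫⁻ x, ‖f (x + z) - g (x + z)‖ₑ) +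
          ∫⁻ x, ‖f x - g x‖ₑ := by
        rw [lintegral_add_right' _ hm, lintegral_add_left
          (by fun_prop : Continuous fun x => ‖g (x + z) - g x‖ₑ).measurable]
    _ ≤ (η / 3 + η / 3) + η / 3 := by
        rw [h2]
        gcongr
    _ = η := ENNReal.add_thirds η

/-- Since the support has finite measure, the set where `‖f‖ > M` is small for large `M`, and
cutting `f` off there leaves an integrable function. Truncation makes the error at most the measure
of that set and of its translate. -/
lemma tendsto_lintegral_min_translate [NormedSpace ℝ F] [MeasurableSpace F] [BorelSpace F]
    [SecondCountableTopology F] {f : E → F} (hf : Measurable f)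
    (hs : volume (Function.support f) ≠ ⊤) :
    Tendsto (fun z => ∫⁻ x, min ‖f (x + z) - f x‖ₑ 1) (𝓝 0) (𝓝 0) := by
  rw [ENNReal.tendsto_nhds_zero]
  intro η hη
  have hη3 : 0 < η / 3 := ENNReal.div_pos hη.ne' (by simp)
  set A : ℕ → Set E := fun M => {x | (M : ℝ) < ‖f x‖} with hA
  have hAm : ∀ M, MeasurableSet (A M) := fun M => measurableSet_lt measurable_const hf.norm
  have hlim : Tendsto (fun M => volume (A M)) atTop (𝓝 0) := by
    have hanti : Antitone A := fun M N hMN x hx =>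
      lt_of_le_of_lt (by exact_mod_cast hMN : (M : ℝ) ≤ N) hx
    have := tendsto_measure_iInter_atTop (μ := volume) (fun M => (hAm M).nullMeasurableSet) hanti
      ⟨0, ((measure_mono fun x (hx : ((0 : ℕ) : ℝ) < ‖f x‖) => by
        simpa using hx).trans_lt hs.lt_top).ne⟩
    have hI : ⋂ M, A M = ∅ := by
      ext x
      simp only [mem_iInter, mem_empty_iff_false, iff_false, not_forall]
      obtain ⟨M, hM⟩ := exists_nat_ge ‖f x‖
      exact ⟨M, fun h => absurd h (not_lt.2 hM)⟩
    rwa [hI, measure_empty] at this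
  obtain ⟨M, hM⟩ := (ENNReal.tendsto_nhds_zero.1 hlim _ hη3).exists
  set g := (A M)ᶜ.indicator f with hg
  have hgi : Integrable g := by
    have hfin : IsFiniteMeasure (volume.restrict (Function.support f)) := ⟨by
      rw [Measure.restrict_apply_univ]; exact hs.lt_top⟩
    have h1 : IntegrableOn g (Function.support f) := by
      refine Integrable.of_bound (C := M) (hf.indicator (hAm M).compl).aestronglyMeasurable
        (Eventually.of_forall fun x => ?_)
      by_cases hx : x ∈ A M
      · rw [hg, indicator_of_notMem (notMem_compl_iff.2 hx)]; simp
      · rw [hg, indicator_of_mem (mem_compl hx)]; exact not_lt.1 hx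
    refine (integrableOn_iff_integrable_of_support_subset fun x hx => ?_).1 h1
    simp only [hg, Function.mem_support, ne_eq, indicator_apply_eq_zero, not_forall] at hx ⊢
    exact hx.2
  have h1 := ENNReal.tendsto_nhds_zero.1 (tendsto_lintegral_translate hgi) _ hη3
  filter_upwards [h1] with z hz
  have hAz : ∫⁻ x, (A M).indicator (1 : E → ℝ≥0∞) (x + z) = volume (A M) := by
    rw [lintegral_add_right_eq_self (fun x => (A M).indicator (1 : E → ℝ≥0∞) x) z,
      lintegral_indicator_one (hAm M)]
  have hm : Measurable ((A M).indicator (1 : E → ℝ≥0∞)) := measurable_one.indicator (hAm M)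
  calc ∫⁻ x, min ‖f (x + z) - f x‖ₑ 1
      ≤ ∫⁻ x, (‖g (x + z) - g x‖ₑ + (A M).indicator (1 : E → ℝ≥0∞) (x + z)) +
          (A M).indicator (1 : E → ℝ≥0∞) x := by
        refine lintegral_mono fun x => ?_
        by_cases hx : x ∈ A M
        · refine (min_le_right _ _).trans ?_
          rw [indicator_of_mem hx]
          exact le_add_self
        by_cases hxz : x + z ∈ A M
        · refine (min_le_right _ _).trans ?_
          rw [indicator_of_mem hxz]
          exact le_add_self.trans le_self_add
        · refine (min_le_left _ _).trans ?_
          rw [hg, indicator_of_mem (mem_compl hx), indicator_of_mem (mem_compl hxz)]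
          exact le_self_add.trans le_self_add
    _ = ((∫⁻ x, ‖g (x + z) - g x‖ₑ) + volume (A M)) + volume (A M) := by
        have hmz : Measurable fun x => (A M).indicator (1 : E → ℝ≥0∞) (x + z) :=
          hm.comp (measurable_add_const z)
        rw [lintegral_add_right _ hm, lintegral_add_right _ hmz, hAz,
          lintegral_indicator_one (hAm M)]
    _ ≤ (η / 3 + η / 3) + η / 3 := by gcongr
    _ = η := ENNReal.add_thirds η

end Translation

/-! ### Averaging over the shifts of the lattice -/

/-- By Markov each inequality fails with probability at most `1/3`, and `p` fails with probability
zero; the failures cannot cover a probability space. -/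
lemma exists_le_three_mul_lintegral {α : Type*} [MeasurableSpace α] {P : Measure α}
    [IsProbabilityMeasure P] {f g : α → ℝ≥0∞} (hf : Measurable f) (hg : Measurable g)
    {p : α → Prop} (hp : ∀ᵐ x ∂P, p x) :
    ∃ x, p x ∧ f x ≤ 3 * ∫⁻ z, f z ∂P ∧ g x ≤ 3 * ∫⁻ z, g z ∂P := by
  have key : ∀ f : α → ℝ≥0∞, Measurable f → P {x | ¬ f x ≤ 3 * ∫⁻ z, f z ∂P} ≤ 1 / 3 := by
    intro f hf
    by_cases ht : ∫⁻ z, f z ∂P = ⊤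
    · simp [ht]
    -- Markov's inequality needs a positive threshold; for zero mean, `f` vanishes almost
    -- everywhere.
    by_cases h0 : ∫⁻ z, f z ∂P = 0
    · have : P {x | ¬ f x ≤ 3 * ∫⁻ z, f z ∂P} = 0 := by
        rw [h0, ← ae_iff]
        filter_upwards [(lintegral_eq_zero_iff hf).1 h0] with x hx
        simp [hx]
      rw [this]
      exact zero_le
    · refine (measure_mono fun x hx => (not_le.1 hx).le).trans
        ((meas_ge_le_lintegral_div hf.aemeasurable (mul_ne_zero (by simp) h0)
          (ENNReal.mul_ne_top (by simp) ht)).trans (le_of_eq ?_))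
      rw [mul_comm, ENNReal.div_eq_inv_mul, ENNReal.mul_inv (Or.inl h0) (Or.inl ht),
        mul_right_comm, ENNReal.inv_mul_cancel h0 ht, one_mul, one_div]
  by_contra hcon
  push Not at hcon
  have hsub : (univ : Set α) ⊆ {x | ¬ p x} ∪ ({x | ¬ f x ≤ 3 * ∫⁻ z, f z ∂P} ∪
      {x | ¬ g x ≤ 3 * ∫⁻ z, g z ∂P}) := by
    intro x _
    by_cases h1 : p x
    · by_cases h2 : f x ≤ 3 * ∫⁻ z, f z ∂P
      · exact Or.inr (Or.inr (not_le.2 (hcon x h1 h2)))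
      · exact Or.inr (Or.inl h2)
    · exact Or.inl h1
  have h := measure_mono (μ := P) hsub
  rw [measure_univ] at h
  have h2 := h.trans ((measure_union_le _ _).trans
    (add_le_add (ae_iff.1 hp).le ((measure_union_le _ _).trans (add_le_add (key f hf) (key g hg)))))
  rw [zero_add] at h2
  refine absurd h2 (not_le.2 ?_)
  rw [ENNReal.div_add_div_same, one_add_one_eq_two]
  exact (ENNReal.div_lt_iff (by simp) (by simp)).2 (by norm_num)

section Tiling

variable {d : ℕ} (e : OrthonormalBasis (Fin d) ℝ (EuclideanSpace ℝ (Fin d)))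

/-- The set of shifts of the lattice. -/
def unitBox (d : ℕ) : Set (Fin d → ℝ) := univ.pi fun _ => Ico 0 1

lemma measurableSet_unitBox : MeasurableSet (unitBox d) :=
  MeasurableSet.univ_pi fun _ => measurableSet_Ico

lemma volume_unitBox : volume (unitBox d) = 1 := by
  simp [unitBox, Real.volume_pi_Ico]

instance : IsProbabilityMeasure (volume.restrict (unitBox d)) :=
  ⟨by rw [Measure.restrict_apply_univ, volume_unitBox]⟩

lemma latticePoint_eq_fromCoords (ε : ℝ) (y : Fin d → ℝ) (m : Fin d → ℤ) :
    latticePoint e ε y m = fromCoords e (ε • (y + fun i => (m i : ℝ))) := rfl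

lemma measurable_latticePoint (ε : ℝ) (m : Fin d → ℤ) :
    Measurable fun y => latticePoint e ε y m :=
  ((continuous_fromCoords e).comp (by fun_prop)).measurable

lemma setLIntegral_gridCube {ε : ℝ} (hε : 0 < ε) (y : Fin d → ℝ) (k : Fin d → ℤ)
    {h : EuclideanSpace ℝ (Fin d) → ℝ≥0∞} (hh : Measurable h) :
    ∫⁻ x in gridCube e ε y k, h x =
      ENNReal.ofReal ε ^ d * ∫⁻ r in unitBox d, h (latticePoint e ε (y + r) k) := by
  rw [← lintegral_indicator (measurableSet_gridCube e ε y k),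
    ← lintegral_indicator measurableSet_unitBox,
    ← (measurePreserving_fromCoords e).lintegral_comp
      (hh.indicator (measurableSet_gridCube e ε y k))]
  set G : (Fin d → ℝ) → ℝ≥0∞ := fun c => (gridCube e ε y k).indicator h (fromCoords e c) with hG
  have hGm : Measurable G :=
    (hh.indicator (measurableSet_gridCube e ε y k)).comp (continuous_fromCoords e).measurable
  have h1 : ∫⁻ c, G c = ENNReal.ofReal ε ^ d * ∫⁻ c, G (ε • c) := by
    have h2 : ∫⁻ c, G (ε • c) = ∫⁻ c, G c ∂(volume.map fun c : Fin d → ℝ => ε • c) :=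
      (lintegral_map hGm (by fun_prop)).symm
    have h3 := Measure.map_addHaar_smul (volume : Measure (Fin d → ℝ)) hε.ne'
    rw [h2, h3, lintegral_smul_measure, smul_eq_mul, ← mul_assoc, ← ENNReal.ofReal_pow hε.le,
      ← ENNReal.ofReal_mul (by positivity), Module.finrank_fin_fun, abs_of_pos (by positivity),
      mul_inv_cancel₀ (by positivity), ENNReal.ofReal_one, one_mul]
  rw [h1, ← lintegral_add_right_eq_self (fun c => G (ε • c)) (y + fun i => (k i : ℝ))]
  congr 1
  refine lintegral_congr fun r => ?_
  have h4 : fromCoords e (ε • (r + (y + fun i => (k i : ℝ)))) = latticePoint e ε (y + r) k := by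
    rw [latticePoint_eq_fromCoords]
    congr 2
    abel
  have h5 : latticePoint e ε (y + r) k ∈ gridCube e ε y k ↔ r ∈ unitBox d := by
    simp only [latticePoint_eq_fromCoords, gridCube, mem_ofPred_eq, inner_fromCoords, unitBox,
      mem_univ_pi]
    refine forall_congr' fun i => ?_
    simp only [Pi.smul_apply, Pi.add_apply, smul_eq_mul, mem_Ico]
    rw [mul_le_mul_iff_right₀ hε, mul_lt_mul_iff_right₀ hε]
    constructor <;> rintro ⟨a, b⟩ <;> constructor <;> linarith
  simp only [hG, h4]
  by_cases hr : r ∈ unitBox d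
  · rw [indicator_of_mem hr, indicator_of_mem (h5.2 hr)]
  · rw [indicator_of_notMem hr, indicator_of_notMem fun h => hr (h5.1 h)]

lemma lintegral_eq_tsum_gridCube {ε : ℝ} (hε : 0 < ε) (y : Fin d → ℝ)
    (h : EuclideanSpace ℝ (Fin d) → ℝ≥0∞) :
    ∫⁻ x, h x = ∑' k, ∫⁻ x in gridCube e ε y k, h x := by
  rw [← lintegral_iUnion (fun k => measurableSet_gridCube e ε y k)
    fun k l hkl => disjoint_gridCube e hε y hkl]
  have : ⋃ k, gridCube e ε y k = univ := eq_univ_of_forall fun x =>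
    mem_iUnion.2 (exists_mem_gridCube e hε y x)
  rw [this, setLIntegral_univ]

/-- Every point is `ε (y + m)` for exactly one shift `y` in the unit box and one `m ∈ ℤ^d`;
rescaling by `ε` gives the factor `ε ^ d`. -/
lemma lintegral_eq_average {ε : ℝ} (hε : 0 < ε) {h : EuclideanSpace ℝ (Fin d) → ℝ≥0∞}
    (hh : Measurable h) :
    ∫⁻ x, h x =
      ENNReal.ofReal ε ^ d * ∫⁻ y in unitBox d, ∑' m, h (latticePoint e ε y m) := by
  rw [lintegral_eq_tsum_gridCube e hε 0, lintegral_tsum, ← ENNReal.tsum_mul_left]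
  · refine tsum_congr fun k => ?_
    rw [setLIntegral_gridCube e hε 0 k hh]
    simp only [zero_add]
  · exact fun m => (hh.comp (measurable_latticePoint e ε m)).aemeasurable

/-- Almost every lattice avoids a given null set. Pointwise values of `u` at the vertices can thus
be exchanged for those of a measurable representative. -/
lemma ae_latticePoint {ε : ℝ} (hε : 0 < ε) {p : EuclideanSpace ℝ (Fin d) → Prop}
    (hp : ∀ᵐ x, p x) :
    ∀ᵐ y ∂volume.restrict (unitBox d), ∀ m, p (latticePoint e ε y m) := by
  obtain ⟨N, hN, hNm, hN0⟩ := exists_measurable_superset_of_null (ae_iff.1 hp)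
  have hm : Measurable (N.indicator (1 : EuclideanSpace ℝ (Fin d) → ℝ≥0∞)) :=
    measurable_one.indicator hNm
  have h := lintegral_eq_average e hε hm
  rw [lintegral_indicator_one hNm, hN0, eq_comm, mul_eq_zero] at h
  have h1 := h.resolve_left (pow_ne_zero _ (by simpa using hε))
  have hsm : Measurable fun y => ∑' m, N.indicator (1 : EuclideanSpace ℝ (Fin d) → ℝ≥0∞) (latticePoint e ε y m) :=
    Measurable.tsum fun m => hm.comp (measurable_latticePoint e ε m)
  rw [lintegral_eq_zero_iff hsm] at h1
  filter_upwards [h1] with y hy m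
  by_contra hcon
  have := ENNReal.tsum_eq_zero.1 hy m
  simp [hN hcon] at this

end Tiling

/-! ### The discrepancy between a function and its values at the vertices -/

section Discrepancy

variable {d : ℕ} (e : OrthonormalBasis (Fin d) ℝ (EuclideanSpace ℝ (Fin d)))

/-- The truncated distance of `f` to its values at the vertices, integrated over all cubes and
scaled to cubes of side one. -/
def discrepancy (f : EuclideanSpace ℝ (Fin d) → EuclideanSpace ℝ (Fin d)) (ε : ℝ)
    (y : Fin d → ℝ) : ℝ≥0∞ :=
  ∑ s, ∑' k, ∫⁻ r in unitBox d,
    min ‖f (latticePoint e ε y (vertexIndex k s)) - f (latticePoint e ε (y + r) k)‖ₑ 1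

/-- The truncated `L¹` distance of `f` to its translate. -/
def translationModulus (f : EuclideanSpace ℝ (Fin d) → EuclideanSpace ℝ (Fin d))
    (z : EuclideanSpace ℝ (Fin d)) : ℝ≥0∞ :=
  ∫⁻ x, min ‖f (x + z) - f x‖ₑ 1

variable {f : EuclideanSpace ℝ (Fin d) → EuclideanSpace ℝ (Fin d)}

lemma measurable_latticePoint_add (ε : ℝ) (k : Fin d → ℤ) :
    Measurable fun q : (Fin d → ℝ) × (Fin d → ℝ) => latticePoint e ε (q.1 + q.2) k :=
  (measurable_latticePoint e ε k).comp (measurable_fst.add measurable_snd)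

lemma measurable_discrepancy_integrand (hf : Measurable f) (ε : ℝ) (k : Fin d → ℤ)
    (s : Finset (Fin d)) :
    Measurable fun q : (Fin d → ℝ) × (Fin d → ℝ) =>
      min ‖f (latticePoint e ε q.1 (vertexIndex k s)) - f (latticePoint e ε (q.1 + q.2) k)‖ₑ 1 :=
  (((hf.comp ((measurable_latticePoint e ε _).comp measurable_fst)).sub
    (hf.comp (measurable_latticePoint_add e ε k))).enorm).min measurable_const

lemma measurable_discrepancy (hf : Measurable f) (ε : ℝ) : Measurable (discrepancy e f ε) :=
  Finset.measurable_fun_sum _ fun s _ => Measurable.tsum fun k =>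
    (measurable_discrepancy_integrand e hf ε k s).lintegral_prod_right'

/-- The corner of the unit box given by a set of coordinates. -/
def corner (s : Finset (Fin d)) : Fin d → ℝ := fun i => if i ∈ s then 1 else 0

lemma latticePoint_vertexIndex (ε : ℝ) (y : Fin d → ℝ) (k : Fin d → ℤ) (s : Finset (Fin d)) :
    latticePoint e ε y (vertexIndex k s) =
      latticePoint e ε y k + fromCoords e (ε • corner s) := by
  rw [latticePoint_eq_fromCoords, latticePoint_eq_fromCoords, ← fromCoords_add]
  congr 1
  funext i
  simp only [vertexIndex, corner, Pi.add_apply, Pi.smul_apply, smul_eq_mul]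
  push_cast
  ring

lemma latticePoint_add (ε : ℝ) (y r : Fin d → ℝ) (k : Fin d → ℤ) :
    latticePoint e ε (y + r) k = latticePoint e ε y k + fromCoords e (ε • r) := by
  rw [latticePoint_eq_fromCoords, latticePoint_eq_fromCoords, ← fromCoords_add]
  congr 1
  funext i
  simp only [Pi.add_apply, Pi.smul_apply, smul_eq_mul]
  ring

/-- For fixed position `r` in the cube, the average over the shifts and the sum over the cubes
unfold to an integral over the whole space comparing `f` at two points that differ by `ε (corner s -
r)`. -/
lemma lintegral_discrepancy (hf : Measurable f) {ε : ℝ} (hε : 0 < ε) :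
    ENNReal.ofReal ε ^ d * ∫⁻ y in unitBox d, discrepancy e f ε y =
      ∑ s, ∫⁻ r in unitBox d, translationModulus f (fromCoords e (ε • (corner s - r))) := by
  have hm := measurable_discrepancy_integrand e hf ε
  unfold discrepancy
  rw [lintegral_finsetSum _ fun s _ => Measurable.tsum fun k =>
    (hm k s).lintegral_prod_right', Finset.mul_sum]
  refine Finset.sum_congr rfl fun s _ => ?_
  have h1 : ∀ y, ∑' k, ∫⁻ r in unitBox d,
      min ‖f (latticePoint e ε y (vertexIndex k s)) - f (latticePoint e ε (y + r) k)‖ₑ 1 =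
      ∫⁻ r in unitBox d, ∑' k,
        min ‖f (latticePoint e ε y (vertexIndex k s)) - f (latticePoint e ε (y + r) k)‖ₑ 1 :=
    fun y => (lintegral_tsum fun k => ((hm k s).comp measurable_prodMk_left).aemeasurable).symm
  simp_rw [h1]
  rw [lintegral_lintegral_swap (Measurable.tsum fun k => hm k s).aemeasurable,
    ← lintegral_const_mul']
  · refine lintegral_congr fun r => ?_
    set H : EuclideanSpace ℝ (Fin d) → ℝ≥0∞ := fun x =>
      min ‖f (x + fromCoords e (ε • corner s)) - f (x + fromCoords e (ε • r))‖ₑ 1 with hH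
    have hHm : Measurable H :=
      (((hf.comp (measurable_add_const _)).sub (hf.comp (measurable_add_const _))).enorm).min
        measurable_const
    have h2 := lintegral_eq_average e hε hHm
    simp only [hH] at h2
    simp_rw [latticePoint_vertexIndex, latticePoint_add]
    rw [← h2, translationModulus,
      ← lintegral_add_right_eq_self (fun x => min ‖f (x + _) - f x‖ₑ 1) (fromCoords e (ε • r))]
    refine lintegral_congr fun x => ?_
    rw [add_assoc, ← fromCoords_add, ← smul_add, add_sub_cancel]
  · finiteness

lemma norm_fromCoords_le (c : Fin d → ℝ) {b : ℝ} (h : ∀ i, |c i| ≤ b) :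
    ‖fromCoords e c‖ ≤ d * b := by
  refine (norm_sum_le _ _).trans ?_
  calc ∑ i, ‖c i • e i‖ ≤ ∑ _i : Fin d, b := Finset.sum_le_sum fun i _ => by
        rw [norm_smul, e.orthonormal.1 i, mul_one]; exact h i
    _ = d * b := by simp

lemma lintegral_discrepancy_le (hf : Measurable f) {ε : ℝ} (hε : 0 < ε) {η : ℝ≥0∞}
    (h : ∀ z, ‖z‖ ≤ d * ε → translationModulus f z ≤ η) :
    ENNReal.ofReal ε ^ d * ∫⁻ y in unitBox d, discrepancy e f ε y ≤ 2 ^ d * η := by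
  rw [lintegral_discrepancy e hf hε]
  calc ∑ s, ∫⁻ r in unitBox d, translationModulus f (fromCoords e (ε • (corner s - r)))
      ≤ ∑ _s : Finset (Fin d), ∫⁻ _r in unitBox d, η := by
        refine Finset.sum_le_sum fun s _ => setLIntegral_mono' measurableSet_unitBox fun r hr => ?_
        refine h _ (norm_fromCoords_le e _ fun i => ?_)
        have hri := hr i (mem_univ i)
        rw [Pi.smul_apply, smul_eq_mul, abs_mul, abs_of_pos hε]
        refine mul_le_of_le_one_right hε.le ?_
        rw [Pi.sub_apply, corner, abs_le]
        split_ifs <;> constructor <;> linarith [hri.1, hri.2]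
    _ = 2 ^ d * η := by simp

/-- The sum over the vertices of the cube containing `x` of the truncated distance of `f x` to
the value at the vertex. -/
def vertexDistance (f : EuclideanSpace ℝ (Fin d) → EuclideanSpace ℝ (Fin d)) (ε : ℝ)
    (y : Fin d → ℝ) (x : EuclideanSpace ℝ (Fin d)) : ℝ≥0∞ :=
  ∑' k, (gridCube e ε y k).indicator
    (fun x => ∑ s, min ‖f (gridVertex e ε y k s) - f x‖ₑ 1) x

lemma measurable_vertexDistance_summand (hf : Measurable f) (ε : ℝ) (y : Fin d → ℝ)
    (k : Fin d → ℤ) (s : Finset (Fin d)) :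
    Measurable fun x => min ‖f (gridVertex e ε y k s) - f x‖ₑ 1 :=
  ((measurable_const.sub hf).enorm).min measurable_const

lemma measurable_vertexDistance (hf : Measurable f) (ε : ℝ) (y : Fin d → ℝ) :
    Measurable (vertexDistance e f ε y) :=
  Measurable.tsum fun k => (Finset.measurable_fun_sum _ fun s _ =>
    measurable_vertexDistance_summand e hf ε y k s).indicator (measurableSet_gridCube e ε y k)

lemma lintegral_vertexDistance (hf : Measurable f) {ε : ℝ} (hε : 0 < ε) (y : Fin d → ℝ) :
    ∫⁻ x, vertexDistance e f ε y x = ENNReal.ofReal ε ^ d * discrepancy e f ε y := by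
  have hm := measurable_vertexDistance_summand e hf ε y
  unfold vertexDistance discrepancy
  rw [lintegral_tsum fun k => ((Finset.measurable_fun_sum _ fun s _ => hm k s).indicator
    (measurableSet_gridCube e ε y k)).aemeasurable, Finset.mul_sum]
  simp_rw [lintegral_indicator (measurableSet_gridCube e ε y _)]
  rw [tsum_congr fun k => lintegral_finsetSum _ fun s _ => hm k s,
    Summable.tsum_finsetSum fun s _ => ENNReal.summable]
  refine Finset.sum_congr rfl fun s _ => ?_
  rw [← ENNReal.tsum_mul_left]
  refine tsum_congr fun k => ?_
  rw [setLIntegral_gridCube e hε y k (hm k s), gridVertex_eq]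

variable {e}

lemma vertexDistance_eq {ε : ℝ} (hε : 0 < ε) {y : Fin d → ℝ} {k : Fin d → ℤ}
    {x : EuclideanSpace ℝ (Fin d)} (hx : x ∈ gridCube e ε y k) :
    vertexDistance e f ε y x = ∑ s, min ‖f (gridVertex e ε y k s) - f x‖ₑ 1 := by
  unfold vertexDistance
  rw [tsum_eq_single k, indicator_of_mem hx]
  intro l hl
  exact indicator_of_notMem (disjoint_right.1 (disjoint_gridCube e hε y hl) hx) _

/-- The interpolated value is a convex combination of the vertex values, and below `1` the truncated
distances are the true ones. -/
lemma enorm_interp_sub_le {ε : ℝ} (hε : 0 < ε) {y : Fin d → ℝ} {k : Fin d → ℤ}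
    {x : EuclideanSpace ℝ (Fin d)} (hx : x ∈ gridCube e ε y k)
    (h : vertexDistance e f ε y x < 1) :
    ‖multilinearInterp e ε y k f x - f x‖ₑ ≤ vertexDistance e f ε y x := by
  set D := vertexDistance e f ε y x with hD
  have hs : ∀ s, ‖f (gridVertex e ε y k s) - f x‖ₑ ≤ D := by
    intro s
    have h1 : min ‖f (gridVertex e ε y k s) - f x‖ₑ 1 ≤ D := by
      rw [hD, vertexDistance_eq hε hx]
      exact Finset.single_le_sum (f := fun s => min ‖f (gridVertex e ε y k s) - f x‖ₑ 1)
        (fun _ _ => zero_le) (Finset.mem_univ s)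
    rcases min_le_iff.1 h1 with h2 | h2
    · exact h2
    · exact absurd h (not_lt.2 h2)
  have hDt : D ≠ ⊤ := (h.trans ENNReal.one_lt_top).ne
  have hc := relCoord_mem hε (gridCube_subset_closedCube e ε y k hx)
  have h1 : multilinearInterp e ε y k f x - f x =
      ∑ s, weight (relCoord e ε y k x) s • (f (gridVertex e ε y k s) - f x) := by
    simp_rw [smul_sub]
    rw [Finset.sum_sub_distrib, ← Finset.sum_smul, sum_weight, one_smul, multilinearInterp_eq]
  have h2 : ‖multilinearInterp e ε y k f x - f x‖ ≤ D.toReal := by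
    rw [h1]
    refine (norm_sum_le _ _).trans ?_
    calc ∑ s, ‖weight (relCoord e ε y k x) s • (f (gridVertex e ε y k s) - f x)‖
        ≤ ∑ s, weight (relCoord e ε y k x) s * D.toReal := by
          refine Finset.sum_le_sum fun s _ => ?_
          rw [norm_smul, Real.norm_of_nonneg (weight_nonneg hc s)]
          refine mul_le_mul_of_nonneg_left ?_ (weight_nonneg hc s)
          rw [← toReal_enorm]
          exact ENNReal.toReal_mono hDt (hs s)
      _ = D.toReal := by rw [← Finset.sum_mul, sum_weight, one_mul]
  rw [← ofReal_norm]
  exact ENNReal.ofReal_le_of_le_toReal h2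

end Discrepancy

/-! ### Choice of the shift -/

section Shift

variable {d : ℕ} {e : OrthonormalBasis (Fin d) ℝ (EuclideanSpace ℝ (Fin d))} {ε : ℝ}
  {y : Fin d → ℝ} {Ω : Set (EuclideanSpace ℝ (Fin d))}
  {u v : EuclideanSpace ℝ (Fin d) → EuclideanSpace ℝ (Fin d)}

lemma direction_eq_fromCoords {ξ : EuclideanSpace ℝ (Fin d)} (hξ : ξ ∈ directions e) :
    ∃ s : Finset (Fin d), s.Nonempty ∧ s.card ≤ 2 ∧ ξ = ∑ i ∈ s, e i := by
  classical
  unfold directions at hξ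
  rcases Finset.mem_union.1 hξ with h | h
  · obtain ⟨i, _, rfl⟩ := Finset.mem_image.1 h
    exact ⟨{i}, by simp, by simp, by simp⟩
  · obtain ⟨p, hp, rfl⟩ := Finset.mem_image.1 h
    have hne : p.1 ≠ p.2 := (Finset.mem_filter.1 hp).2.ne
    exact ⟨{p.1, p.2}, by simp, Finset.card_le_two, (Finset.sum_pair hne).symm⟩

lemma direction_ne_zero {ξ : EuclideanSpace ℝ (Fin d)} (hξ : ξ ∈ directions e) : ξ ≠ 0 := by
  obtain ⟨s, ⟨i, hi⟩, -, rfl⟩ := direction_eq_fromCoords hξ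
  intro h
  have h1 : inner ℝ (e i) (∑ j ∈ s, e j) = 1 := by
    rw [inner_sum]
    simp_rw [orthonormal_iff_ite.1 e.orthonormal]
    simp [hi]
  rw [h, inner_zero_right] at h1
  exact zero_ne_one h1

lemma enorm_direction_le {ξ : EuclideanSpace ℝ (Fin d)} (hξ : ξ ∈ directions e) : ‖ξ‖ₑ ≤ 2 := by
  obtain ⟨s, -, hs, rfl⟩ := direction_eq_fromCoords hξ
  have h1 : ‖∑ i ∈ s, e i‖ ≤ 2 := by
    refine (norm_sum_le _ _).trans ?_
    simp only [e.orthonormal.1, Finset.sum_const, nsmul_eq_mul, mul_one]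
    exact_mod_cast hs
  rw [← ofReal_norm]
  exact (ENNReal.ofReal_le_ofReal h1).trans (by simp)

lemma latticePoint_add_direction {ξ : EuclideanSpace ℝ (Fin d)} (hξ : ξ ∈ directions e)
    (m : Fin d → ℤ) : ∃ m', latticePoint e ε y m + ε • ξ = latticePoint e ε y m' := by
  obtain ⟨s, -, -, rfl⟩ := direction_eq_fromCoords hξ
  refine ⟨vertexIndex m s, ?_⟩
  rw [latticePoint_vertexIndex, fromCoords_smul]
  congr 2
  simp [fromCoords, corner]

/-- Translation by `ε ξ` maps the lattice to itself, so both endpoints of every increment are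
lattice points, where `u` and `v` agree. -/
lemma latticeEnergy_congr (hε : 0 < ε)
    (h : ∀ m, latticePoint e ε y m ∈ Ω → u (latticePoint e ε y m) = v (latticePoint e ε y m)) :
    latticeEnergy Ω e u ε y = latticeEnergy Ω e v ε y := by
  unfold latticeEnergy
  refine Finset.sum_congr rfl fun ξ hξ => tsum_congr fun m => ?_
  unfold truncIncrement
  by_cases hm : latticePoint e ε y m ∈ segmentDomain Ω ξ ε
  · rw [indicator_of_mem hm, indicator_of_mem hm]
    have h0 := hm 0 ⟨le_rfl, hε.le⟩
    have h1 := hm ε ⟨hε.le, le_rfl⟩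
    obtain ⟨m', hm'⟩ := latticePoint_add_direction (ε := ε) (y := y) hξ m
    rw [zero_smul, add_zero] at h0
    rw [hm'] at h1 ⊢
    rw [h m h0, h m' h1]
  · rw [indicator_of_notMem hm, indicator_of_notMem hm]

lemma measurable_latticeEnergy (hΩ : IsOpen Ω) (hv : Measurable v) :
    Measurable (latticeEnergy Ω e v ε) :=
  Finset.measurable_fun_sum _ fun ξ _ => Measurable.tsum fun m =>
    (measurable_truncIncrement hΩ hv ε ξ).comp (measurable_latticePoint e ε m)

lemma lintegral_latticeEnergy_le (hε : 0 < ε) (hΩ : IsOpen Ω) (hv : Measurable v)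
    (huv : ∀ᵐ x, x ∈ Ω → u x = v x)
    (hbv : ∀ ξ ∈ directions e, ∀ᵐ z : (Submodule.span ℝ {ξ})ᗮ
      ∂(μHE[d - 1] : Measure (Submodule.span ℝ {ξ})ᗮ), IsBV (sliceDomain Ω ξ z) (slice u ξ z)) :
    ENNReal.ofReal ε ^ d * ∫⁻ z in unitBox d, latticeEnergy Ω e v ε z ≤
      ENNReal.ofReal ε * (2 * ∑ ξ ∈ directions e, sliceEnergy Ω u ξ) := by
  have hm := fun ξ => measurable_truncIncrement hΩ hv ε ξ
  unfold latticeEnergy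
  have hs : ∀ ξ, Measurable fun z => ∑' m, truncIncrement Ω v ε ξ (latticePoint e ε z m) :=
    fun ξ => Measurable.tsum fun m => (hm ξ).comp (measurable_latticePoint e ε m)
  rw [lintegral_finsetSum _ fun ξ _ => hs ξ, Finset.mul_sum, Finset.mul_sum, Finset.mul_sum]
  refine Finset.sum_le_sum fun ξ hξ => ?_
  rw [← lintegral_eq_average e hε (hm ξ)]
  refine (lintegral_truncIncrement_le hΩ hv huv (direction_ne_zero hξ) (hbv ξ hξ) hε).trans ?_
  rw [mul_left_comm]
  gcongr
  exact enorm_direction_le hξ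

end Shift

/-! ### Simultaneous choice of the shift and volume of the bad cubes -/

section Choice

variable {n : ℕ} {e : OrthonormalBasis (Fin (n + 1)) ℝ (EuclideanSpace ℝ (Fin (n + 1)))} {ε : ℝ}
  {Ω : Set (EuclideanSpace ℝ (Fin (n + 1)))}
  {u v : EuclideanSpace ℝ (Fin (n + 1)) → EuclideanSpace ℝ (Fin (n + 1))}

/-- Both bounds compare with three times the mean. In the energy bound the factor `6` is this `3`
times the bound `‖ξ‖ ≤ 2`, and one power of `ε` cancels. -/
lemma exists_shift (hε : 0 < ε) (hΩ : IsOpen Ω) (hv : Measurable v)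
    (huv : ∀ᵐ x, x ∈ Ω → u x = v x)
    (hbv : ∀ ξ ∈ directions e, ∀ᵐ z : (Submodule.span ℝ {ξ})ᗮ
      ∂(μHE[n + 1 - 1] : Measure (Submodule.span ℝ {ξ})ᗮ),
      IsBV (sliceDomain Ω ξ z) (slice u ξ z)) :
    ∃ y ∈ unitBox (n + 1),
      (∀ m, latticePoint e ε y m ∈ Ω → u (latticePoint e ε y m) = v (latticePoint e ε y m)) ∧
      ENNReal.ofReal ε ^ n * latticeEnergy Ω e u ε y ≤
        6 * ∑ ξ ∈ directions e, sliceEnergy Ω u ξ ∧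
      ENNReal.ofReal ε ^ (n + 1) * discrepancy e (Ω.indicator v) ε y ≤
        3 * (ENNReal.ofReal ε ^ (n + 1) *
          ∫⁻ z in unitBox (n + 1), discrepancy e (Ω.indicator v) ε z) := by
  have hvΩ : Measurable (Ω.indicator v) := hv.indicator hΩ.measurableSet
  obtain ⟨y, ⟨hy, hyu⟩, h1, h2⟩ := exists_le_three_mul_lintegral
    (measurable_latticeEnergy (e := e) (ε := ε) hΩ hv) (measurable_discrepancy e hvΩ ε)
    ((ae_restrict_mem (measurableSet_unitBox (d := n + 1))).and (ae_latticePoint e hε huv))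
  refine ⟨y, hy, hyu, ?_, ?_⟩
  · rw [latticeEnergy_congr hε hyu]
    have hε0 : ENNReal.ofReal ε ≠ 0 := by simpa using hε
    rw [← ENNReal.mul_le_mul_iff_right hε0 ENNReal.ofReal_ne_top]
    calc ENNReal.ofReal ε * (ENNReal.ofReal ε ^ n * latticeEnergy Ω e v ε y)
        = ENNReal.ofReal ε ^ (n + 1) * latticeEnergy Ω e v ε y := by ring
      _ ≤ ENNReal.ofReal ε ^ (n + 1) *
          (3 * ∫⁻ z in unitBox (n + 1), latticeEnergy Ω e v ε z) := by gcongr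
      _ = 3 * (ENNReal.ofReal ε ^ (n + 1) *
          ∫⁻ z in unitBox (n + 1), latticeEnergy Ω e v ε z) := by ring
      _ ≤ 3 * (ENNReal.ofReal ε * (2 * ∑ ξ ∈ directions e, sliceEnergy Ω u ξ)) := by
          exact mul_le_mul_right (lintegral_latticeEnergy_le hε hΩ hv huv hbv) _
      _ = ENNReal.ofReal ε * (6 * ∑ ξ ∈ directions e, sliceEnergy Ω u ξ) := by ring
  · calc ENNReal.ofReal ε ^ (n + 1) * discrepancy e (Ω.indicator v) ε y
        ≤ ENNReal.ofReal ε ^ (n + 1) *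
          (3 * ∫⁻ z in unitBox (n + 1), discrepancy e (Ω.indicator v) ε z) := by gcongr
      _ = _ := by ring

/-- The number of bad cubes is bounded by the energy. Volume carries one more power of `ε` than
perimeter, so it vanishes in the limit. -/
lemma volume_badCubes_le (hε : 0 < ε) (hΩb : Bornology.IsBounded Ω) (y : Fin (n + 1) → ℝ) :
    volume (⋃ k ∈ badCubes Ω e u ε y, gridCube e ε y k) ≤
      ENNReal.ofReal ε * (2 ^ (n + 1) * (ENNReal.ofReal ε ^ n * latticeEnergy Ω e u ε y)) := by
  have hfin : (badCubes Ω e u ε y).Finite :=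
    (finite_insideCubes hε hΩb).subset (badCubes_subset_insideCubes hε)
  have h1 : (⋃ k ∈ badCubes Ω e u ε y, gridCube e ε y k) =
      ⋃ k ∈ hfin.toFinset, gridCube e ε y k := by simp
  rw [h1]
  refine (measure_biUnion_finset_le _ _).trans ?_
  calc ∑ k ∈ hfin.toFinset, volume (gridCube e ε y k)
      ≤ ∑ k ∈ hfin.toFinset, ENNReal.ofReal ε ^ (n + 1) * vertexEnergy Ω e u ε y k := by
        refine Finset.sum_le_sum fun k hk => ?_
        rw [volume_gridCube]
        exact le_mul_of_one_le_right zero_le (one_le_vertexEnergy hε (hfin.mem_toFinset.1 hk))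
    _ ≤ ENNReal.ofReal ε ^ (n + 1) * (2 ^ (n + 1) * latticeEnergy Ω e u ε y) := by
        rw [← Finset.mul_sum]
        gcongr
        exact sum_vertexEnergy_le _
    _ = _ := by ring

/-! ### Convergence in measure -/

lemma tendsto_volume_boundaryLayer (hΩ : IsOpen Ω) (hΩb : Bornology.IsBounded Ω) :
    Tendsto (fun ε => volume (Ω \ innerDomain Ω ε)) (𝓝[>] 0) (𝓝 0) := by
  have hΩv : volume Ω ≠ ⊤ := hΩb.measure_lt_top.ne
  have hmeas : ∀ ε, MeasurableSet (innerDomain Ω ε) := fun ε =>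
    hΩ.measurableSet.inter
      (measurableSet_lt measurable_const (Metric.continuous_infDist_pt _).measurable)
  have h := tendsto_measure_biInter_gt (μ := volume) (s := fun ε => Ω \ innerDomain Ω ε) (a := 0)
    (fun ε _ => (hΩ.measurableSet.diff (hmeas ε)).nullMeasurableSet)
    (fun i j _ hij x hx => ⟨hx.1, fun hx' => hx.2 ⟨hx.1, lt_of_le_of_lt (by gcongr) hx'.2⟩⟩)
    ⟨1, one_pos, ((measure_mono sdiff_subset).trans_lt hΩv.lt_top).ne⟩
  have h0 : ⋂ ε > (0 : ℝ), Ω \ innerDomain Ω ε = ∅ := by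
    refine eq_empty_of_forall_notMem fun x hx => ?_
    simp only [mem_iInter] at hx
    have hxΩ : x ∈ Ω := (hx 1 one_pos).1
    -- The distance to an empty frontier would be `0` by convention; boundedness of `Ω` excludes
    -- this case.
    have hne : (frontier Ω).Nonempty := by
      rw [nonempty_frontier_iff]
      refine ⟨⟨x, hxΩ⟩, fun huniv => ?_⟩
      rw [huniv] at hΩb
      exact NormedSpace.unbounded_univ ℝ _ hΩb
    have hpos : 0 < Metric.infDist x (frontier Ω) := by
      refine (isClosed_frontier.notMem_iff_infDist_pos hne).1 fun hxf => ?_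
      rw [hΩ.frontier_eq] at hxf
      exact hxf.2 hxΩ
    have hs : 0 < √((n + 1 : ℕ) : ℝ) := Real.sqrt_pos.2 (by positivity)
    refine (hx (Metric.infDist x (frontier Ω) / (2 * √((n + 1 : ℕ) : ℝ))) (by positivity)).2
      ⟨hxΩ, ?_⟩
    have : √((n + 1 : ℕ) : ℝ) * (Metric.infDist x (frontier Ω) / (2 * √((n + 1 : ℕ) : ℝ))) =
        Metric.infDist x (frontier Ω) / 2 := by
      field_simp
    rw [this]
    linarith
  rw [h0, measure_empty] at h
  exact h

/-- Up to a null set, `w` can differ from `u` by `η` only near the boundary, on a bad cube, or where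
the vertex distance is at least `min η 1`; Markov's inequality bounds the last set by the
discrepancy. -/
lemma volume_setOf_le_enorm_le (hε : 0 < ε) (hΩ : IsOpen Ω) (hv : Measurable v)
    (huv : ∀ᵐ x, x ∈ Ω → u x = v x) {y : Fin (n + 1) → ℝ}
    (hy : ∀ m, latticePoint e ε y m ∈ Ω →
      u (latticePoint e ε y m) = v (latticePoint e ε y m))
    {w : EuclideanSpace ℝ (Fin (n + 1)) → EuclideanSpace ℝ (Fin (n + 1))}
    (hw : ∀ k ∈ insideCubes Ω e ε y, k ∉ badCubes Ω e u ε y → ∀ x ∈ gridCube e ε y k,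
        w x = multilinearInterp e ε y k u x) {η : ℝ≥0∞} (hη : 0 < η) :
    volume.restrict Ω {x | η ≤ ‖w x - u x‖ₑ} ≤ volume (Ω \ innerDomain Ω ε) +
      volume (⋃ k ∈ badCubes Ω e u ε y, gridCube e ε y k) +
      (ENNReal.ofReal ε ^ (n + 1) * discrepancy e (Ω.indicator v) ε y) / min η 1 := by
  set f := Ω.indicator v with hf
  have hfm : Measurable f := hv.indicator hΩ.measurableSet
  have hηpos : min η 1 ≠ 0 := (lt_min hη one_pos).ne'
  have hηtop : min η 1 ≠ ⊤ := ((min_le_right _ _).trans_lt ENNReal.one_lt_top).ne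
  have h1 := meas_ge_le_lintegral_div (μ := volume)
    (measurable_vertexDistance e hfm ε y).aemeasurable hηpos hηtop
  rw [lintegral_vertexDistance e hfm hε] at h1
  have hsub : ({x | η ≤ ‖w x - u x‖ₑ} ∩ Ω : Set _) ≤ᵐ[volume]
      ((Ω \ innerDomain Ω ε) ∪ (⋃ k ∈ badCubes Ω e u ε y, gridCube e ε y k) ∪
        {x | min η 1 ≤ vertexDistance e f ε y x} : Set _) := by
    filter_upwards [huv] with x hx hmem
    have hxη : η ≤ ‖w x - u x‖ₑ := hmem.1
    have hxΩ : x ∈ Ω := hmem.2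
    obtain ⟨k, hk⟩ := exists_mem_gridCube e hε y x
    by_cases hin : x ∈ innerDomain Ω ε
    · by_cases hb : k ∈ badCubes Ω e u ε y
      · exact Or.inl (Or.inr (mem_iUnion₂.2 ⟨k, hb, hk⟩))
      · refine Or.inr ?_
        have hkI : k ∈ insideCubes Ω e ε y := mem_insideCubes_of_innerDomain hε hin hk
        by_contra hlt
        have hlt' : vertexDistance e f ε y x < min η 1 := not_le.1 hlt
        have h2 := enorm_interp_sub_le hε hk (hlt'.trans_le (min_le_right _ _))
        -- The interpolation uses only vertices in `Ω`, where `u` agrees with its measurable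
        -- representative by the choice of the shift.
        have h3 : multilinearInterp e ε y k f x = multilinearInterp e ε y k u x := by
          unfold multilinearInterp
          refine Finset.sum_congr rfl fun s _ => ?_
          have hvΩ : gridVertex e ε y k s ∈ Ω := hkI (gridVertex_mem_closedCube hε s)
          rw [hf, indicator_of_mem hvΩ]
          rw [gridVertex_eq] at hvΩ ⊢
          rw [hy _ hvΩ]
        have h4 : f x = u x := by rw [hf, indicator_of_mem hxΩ, hx hxΩ]
        rw [h3, h4, ← hw k hkI hb x hk] at h2
        exact absurd (hxη.trans h2) (not_le.2 (hlt'.trans_le (min_le_left _ _)))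
    · exact Or.inl (Or.inl ⟨hxΩ, hin⟩)
  rw [Measure.restrict_apply' hΩ.measurableSet]
  refine (measure_mono_ae hsub).trans ((measure_union_le _ _).trans
    (add_le_add (measure_union_le _ _) h1))

end Choice

end FinDirGBD

end

/-! ### Assembly of the bounds and of the convergence in measure -/

theorem theorem2p1 (d : ℕ) (hd : 2 ≤ d) :
    ∃ C : ℝ, 0 < C ∧
      ∀ (Ω : Set (EuclideanSpace ℝ (Fin d))), IsOpen Ω → Bornology.IsBounded Ω →
      ∀ (u : EuclideanSpace ℝ (Fin d) → EuclideanSpace ℝ (Fin d)),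
        AEMeasurable u (volume.restrict Ω) →
      ∀ (e : OrthonormalBasis (Fin d) ℝ (EuclideanSpace ℝ (Fin d))),
        (∀ ξ ∈ FinDirGBD.directions e,
          (∀ᵐ z : (Submodule.span ℝ {ξ})ᗮ ∂(μHE[d - 1] : Measure (Submodule.span ℝ {ξ})ᗮ),
            FinDirGBD.IsBV (FinDirGBD.sliceDomain Ω ξ z) (FinDirGBD.slice u ξ z)) ∧
          FinDirGBD.sliceEnergy Ω u ξ < ⊤) →
      ∃ (uε : ℝ → EuclideanSpace ℝ (Fin d) → EuclideanSpace ℝ (Fin d))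
        (B : ℝ → Set (EuclideanSpace ℝ (Fin d))) (y : ℝ → Fin d → ℝ),
        (∀ ε : ℝ, 0 < ε →
          FinDirGBD.IsSBVInfty Ω (uε ε) ∧
          -- `B ε` is the finite union of the bad cubes of the grid with shift `y ε`
          (∀ i, y ε i ∈ Ico (0 : ℝ) 1) ∧
          (FinDirGBD.badCubes Ω e u ε (y ε)).Finite ∧
          B ε = ⋃ k ∈ FinDirGBD.badCubes Ω e u ε (y ε), FinDirGBD.gridCube e ε (y ε) k ∧
          B ε ⊆ Ω ∧
          FinDirGBD.jumpSet Ω (uε ε) ⊆ frontier (B ε) ∧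
          -- `uε ε` is `0` on the bad cubes and the multilinear interpolation of `u` on the others
          (∀ x ∈ B ε, uε ε x = 0) ∧
          (∀ k, closure (FinDirGBD.gridCube e ε (y ε) k) ⊆ Ω →
            k ∉ FinDirGBD.badCubes Ω e u ε (y ε) →
            ∀ x ∈ FinDirGBD.gridCube e ε (y ε) k,
              uε ε x = FinDirGBD.multilinearInterp e ε (y ε) k u x) ∧
          (∫⁻ x in FinDirGBD.innerDomain Ω ε,
              ENNReal.ofReal (FinDirGBD.symGradNorm Ω (uε ε) x)) +
            μHE[d - 1] (FinDirGBD.essentialBoundary (B ε) ∩ FinDirGBD.innerDomain Ω ε) ≤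
            ENNReal.ofReal C * ∑ ξ ∈ FinDirGBD.directions e, FinDirGBD.sliceEnergy Ω u ξ) ∧
        TendstoInMeasure (volume.restrict Ω) uε (𝓝[>] 0) u := by
  obtain ⟨n, rfl⟩ : ∃ n, d = n + 1 := ⟨d - 1, by omega⟩
  set K : ℝ := 5 * (n + 1) ^ 3 * 2 ^ (n + 1) + 2 * (n + 1) with hK
  have hK0 : 0 < K := by positivity
  -- `K` comes from the bound for a fixed shift, `2 ^ (n + 1)` from the multiplicity of lattice
  -- points as vertices, and `6` from the choice of the shift.
  refine ⟨K * (2 ^ (n + 1) * 6), by positivity, fun Ω hΩ hΩb u hu e hΛ => ?_⟩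
  set v := hu.mk u with hv
  have hvm : Measurable v := hu.measurable_mk
  have huv : ∀ᵐ x, x ∈ Ω → u x = v x := (ae_restrict_iff' hΩ.measurableSet).1 hu.ae_eq_mk
  have hΛtop : ∑ ξ ∈ FinDirGBD.directions e, FinDirGBD.sliceEnergy Ω u ξ ≠ ⊤ :=
    (ENNReal.sum_lt_top.2 fun ξ hξ => (hΛ ξ hξ).2).ne
  have key := fun (ε : ℝ) (hε : 0 < ε) =>
    FinDirGBD.exists_shift hε hΩ hvm huv fun ξ hξ => (hΛ ξ hξ).1
  choose! y hybox hyu hyE hyD using key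
  have key2 := fun (ε : ℝ) (hε : 0 < ε) => FinDirGBD.exists_gridApprox hε hΩ hΩb e u (y ε)
  choose! w hw hwJ hw0 hwI hwE using key2
  have hBΩ : ∀ ε, 0 < ε → ∀ k ∈ FinDirGBD.badCubes Ω e u ε (y ε),
      FinDirGBD.gridCube e ε (y ε) k ⊆ Ω := fun ε _ k hk => subset_closure.trans hk.1
  refine ⟨w, fun ε => ⋃ k ∈ FinDirGBD.badCubes Ω e u ε (y ε), FinDirGBD.gridCube e ε (y ε) k, y,
    fun ε hε => ⟨hw ε hε, fun i => hybox ε hε i (mem_univ i),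
      (FinDirGBD.finite_insideCubes hε hΩb).subset (FinDirGBD.badCubes_subset_insideCubes hε), rfl,
      iUnion₂_subset (hBΩ ε hε), hwJ ε hε, hw0 ε hε, fun k hk hkb => ?_, ?_⟩, ?_⟩
  · rw [FinDirGBD.closure_gridCube e hε] at hk
    exact hwI ε hε k hk hkb
  · refine (hwE ε hε).trans ?_
    rw [← hK, ENNReal.ofReal_mul hK0.le, mul_assoc (ENNReal.ofReal K)]
    refine mul_le_mul' le_rfl ?_
    rw [mul_left_comm, ENNReal.ofReal_mul (by positivity), ENNReal.ofReal_pow (by positivity),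
      mul_assoc]
    simpa using mul_le_mul_right (hyE ε hε) (2 ^ (n + 1) : ℝ≥0∞)
  · rw [tendstoInMeasure_iff_enorm]
    intro η hη _
    have hfm : Measurable (Ω.indicator v) := hvm.indicator hΩ.measurableSet
    have hηpos : min η 1 ≠ 0 := (lt_min hη one_pos).ne'
    have t1 := FinDirGBD.tendsto_volume_boundaryLayer hΩ hΩb
    have t2 : Tendsto (fun ε => volume (⋃ k ∈ FinDirGBD.badCubes Ω e u ε (y ε),
        FinDirGBD.gridCube e ε (y ε) k)) (𝓝[>] 0) (𝓝 0) := by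
      have t3 : Tendsto (fun ε => ENNReal.ofReal ε * (2 ^ (n + 1) *
          (6 * ∑ ξ ∈ FinDirGBD.directions e, FinDirGBD.sliceEnergy Ω u ξ))) (𝓝[>] 0) (𝓝 0) := by
        have t4 : Tendsto (fun ε : ℝ => ENNReal.ofReal ε) (𝓝[>] 0) (𝓝 0) := by
          have := (ENNReal.continuous_ofReal.tendsto 0).mono_left (nhdsWithin_le_nhds (s := Ioi 0))
          simpa using this
        have := ENNReal.Tendsto.mul_const (b := 2 ^ (n + 1) *
          (6 * ∑ ξ ∈ FinDirGBD.directions e, FinDirGBD.sliceEnergy Ω u ξ)) t4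
          (Or.inr (by finiteness))
        simpa using this
      refine tendsto_of_tendsto_of_tendsto_of_le_of_le' tendsto_const_nhds t3
        (Eventually.of_forall fun _ => zero_le) ?_
      filter_upwards [self_mem_nhdsWithin] with ε hε
      refine (FinDirGBD.volume_badCubes_le hε hΩb (y ε)).trans ?_
      exact mul_le_mul_right (mul_le_mul_right (hyE ε hε) _) _
    have t5 : Tendsto (fun ε => ENNReal.ofReal ε ^ (n + 1) *
        FinDirGBD.discrepancy e (Ω.indicator v) ε (y ε)) (𝓝[>] 0) (𝓝 0) := by
      rw [ENNReal.tendsto_nhds_zero]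
      intro δ hδ
      -- The loss between translation modulus and discrepancy: `3` from Markov's inequality and one
      -- term for each vertex of a cube.
      set c : ℝ≥0∞ := 3 * 2 ^ (n + 1) with hc
      have hc0 : c ≠ 0 := by positivity
      have hctop : c ≠ ⊤ := by finiteness
      have hmod := ENNReal.tendsto_nhds_zero.1 (FinDirGBD.tendsto_lintegral_min_translate hfm
        ((measure_mono support_indicator_subset).trans_lt hΩb.measure_lt_top).ne) (δ / c)
        (ENNReal.div_pos hδ.ne' hctop)
      obtain ⟨r, hr, hrz⟩ := Metric.eventually_nhds_iff.1 hmod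
      -- The translations that occur have length at most `(n + 1) ε`, which is then smaller than
      -- `r`.
      filter_upwards [Ioo_mem_nhdsGT (show (0 : ℝ) < r / (n + 2) by positivity)] with ε hε
      refine (hyD ε hε.1).trans ?_
      have h1 := FinDirGBD.lintegral_discrepancy_le e hfm hε.1 (η := δ / c) fun z hz =>
        hrz (y := z) (by
          rw [dist_zero_right]
          have := (lt_div_iff₀ (by positivity)).1 hε.2
          push_cast at hz
          nlinarith [hε.1])
      calc 3 * _ ≤ 3 * (2 ^ (n + 1) * (δ / c)) := mul_le_mul_right h1 3
        _ = c * (δ / c) := by rw [hc, mul_assoc]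
        _ = δ := ENNReal.mul_div_cancel hc0 hctop
    have t6 := (t1.add t2).add (ENNReal.Tendsto.div_const t5 (Or.inr hηpos))
    rw [ENNReal.zero_div, add_zero, add_zero] at t6
    refine tendsto_of_tendsto_of_tendsto_of_le_of_le' tendsto_const_nhds t6
      (Eventually.of_forall fun _ => zero_le) ?_
    filter_upwards [self_mem_nhdsWithin] with ε hε
    exact FinDirGBD.volume_setOf_le_enorm_le hε hΩ hvm huv (hyu ε hε) (hwI ε hε) hη
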